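/- Conventions. An extended metric on a set $X$ is a metric that may have one infinitely remote point $\omega$: $d(x,\omega)=\infty$ for all $x\ne\omega$, $d(\omega,\omega)=0$, all other distances are finite, and such a point is unique if it exists. A quadruple $(x,y,z,u)$ is admissible if no entry occurs three or four times in it; its cross-ratio triple is $\big(d(x,y)d(z,u):d(x,z)d(y,u):d(x,u)d(y,z)\big)\in\mathbb{R}P^2$, where infinite factors cancel. A Möbius space is a set $X$ with a Möbius structure, i.e. an equivalence class of extended metrics with equal cross-ratio triples on all admissible quadruples. A Möbius map is an injective map preserving these cross-ratio triples; a Möbius automorphism is a bijective Möbius map $X\to X$. $X$ is compact if it is compact in the topology of a finite metric of the structure, and it is a Ptolemy space if $d(x,z)d(y,u)\le d(x,y)d(z,u)+d(x,u)d(y,z)$ for every metric $d$ of the structure and every admissible quadruple. An admissible quadruple $(x,z,y,u)$ is harmonic if $d(x,z)d(y,u)=d(x,u)d(y,z)$. An $\mathbb{R}$-circle (a $\mathbb{C}$-circle) is a subset of $X$ that is Möbius equivalent to $\mathbb{R}\cup\{\infty\}$ with the metric $|s-t|$ (respectively $|s-t|^{1/2}$). Let $X$ be a compact Ptolemy space such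 that: (E$_{\mathbb C}$) through every two distinct points there is a unique $\mathbb{C}$-circle; (E$_{\mathbb R}$) for every $\mathbb{C}$-circle $F$, $\omega\in F$ and $u\in X\setminus F$ there is a unique $\mathbb{R}$-circle through $\omega,u$ that intersects $F\setminus\{\omega\}$; (O) for every $\mathbb{R}$-circle $\sigma$ and every $\mathbb{C}$-circle $F$ with common distinct points $o,\omega$: if $u,v\in\sigma$ and $(o,u,\omega,v)$ is harmonic, then $(w,u,o,v)$ is harmonic for every $w\in F$; and if $x,y\in F$ and $(o,x,\omega,y)$ is harmonic, then $(w,x,\omega,y)$ is harmonic for every $w\in\sigma$. Fix $\omega\in X$, let $X_\omega=X\setminus\{\omega\}$ be endowed with a metric $|xy|$ of the Möbius structure with infinitely remote point $\omega$, and call $\mathbb{R}$-lines and $\mathbb{C}$-lines the sets $\sigma\setminus\{\omega\}$ for $\mathbb{R}$-circles, respectively $\mathbb{C}$-circles, $\sigma\ni\omega$. For an $\mathbb{R}$-line $\sigma$ the semi-$\mathbb{C}$-plane $R_\sigma\subset X_\omega$ is the union of all $\mathbb{C}$-lines meeting $\sigma$. If $F$ is the $\mathbb{C}$-line and $\sigma$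 an $\mathbb{R}$-line through $o\in X_\omega$, then $x\in R_\sigma$ has the coordinates $x_F$ and $x_\sigma$: $x_F=x$ if $x\in F$, and otherwise $x_F$ is the intersection point of $F$ with the $\mathbb{R}$-line through $x$ that meets $F$; and $x_\sigma$ is the intersection point of $\sigma$ with the $\mathbb{C}$-line through $x$. Proposition. Let $o\in X_\omega$ and $\lambda>0$, and let $F$ be the $\mathbb{C}$-line through $o$. There is exactly one map $h=h_{o,\lambda}:X_\omega\to X_\omega$, $h(o)=o$, such that (1) $h$ preserves $F$ and acts on it as the homothety $c(t)\mapsto c(\lambda^2t)$, for the parametrizations $c:\mathbb{R}\to F$ with $c(0)=o$, $|c(s)c(t)|=|s-t|^{1/2}$; (2) $h$ preserves every $\mathbb{R}$-line $\sigma$ through $o$ and acts on it as the homothety $c(t)\mapsto c(\lambda t)$, for the parametrizations $c:\mathbb{R}\to\sigma$ with $c(0)=o$, $|c(s)c(t)|=|s-t|$; (3) $h$ preserves every semi-$\mathbb{C}$-plane containing $F$, and on the semi-$\mathbb{C}$-plane $R_\sigma$ spanned by $F$ and an $\mathbb{R}$-line $\sigma$ through $o$ it acts coordinatewise: $h(x)_F=h(x_F)$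 and $h(x)_\sigma=h(x_\sigma)$. This map is a homothety of $X_\omega$ with coefficient $\lambda$, i.e. $|h(x)h(y)|=\lambda|xy|$ for all $x,y\in X_\omega$, and, extended by $h(\omega)=\omega$, it is a Möbius automorphism of $X$. -/

import Mathlib

open scoped ENNReal

/-! ### Extended metrics and cross-ratios -/

/-- `ω` is infinitely remote for `δ`: all other points have infinite distance to `ω`. -/
def IsRemotePoint {X : Type*} (δ : X → X → ℝ≥0∞) (ω : X) : Prop :=
  ∀ x, x ≠ ω → δ x ω = ⊤

/-- An extended metric on `X`: a metric for which one infinitely remote point is allowed; infinite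
distances occur only at an infinitely remote point, and such a point is unique if it exists. -/
structure ExtMetric (X : Type*) where
  dist : X → X → ℝ≥0∞
  dist_self : ∀ x, dist x x = 0
  eq_of_dist_eq_zero : ∀ x y, dist x y = 0 → x = y
  symm : ∀ x y, dist x y = dist y x
  triangle : ∀ x y z, dist x z ≤ dist x y + dist y z
  remote_of_top : ∀ x y, dist x y = ⊤ → IsRemotePoint dist x ∨ IsRemotePoint dist y
  remote_unique : ∀ ω ω', IsRemotePoint dist ω → IsRemotePoint dist ω' → ω = ω'

namespace ExtMetric

variable {X : Type*}

/-- `ω` is the infinitely remote point of `d`. -/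
def Remote (d : ExtMetric X) (ω : X) : Prop := IsRemotePoint d.dist ω

/-- `d` is an ordinary metric (no infinite distances). -/
def Finite (d : ExtMetric X) : Prop := ∀ x y, d.dist x y ≠ ⊤

/-- The metric space given by an extended metric without infinite distances. -/
@[reducible] noncomputable def toMetricSpace (d : ExtMetric X) (hd : d.Finite) : MetricSpace X where
  dist x y := (d.dist x y).toReal
  dist_self x := by simp [d.dist_self]
  dist_comm x y := by rw [d.symm]
  dist_triangle x y z := by
    rw [← ENNReal.toReal_add (hd x y) (hd y z)]
    exact ENNReal.toReal_mono (ENNReal.add_ne_top.2 ⟨hd x y, hd y z⟩) (d.triangle x y z)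
  eq_of_dist_eq_zero {x y} h := by
    rcases (ENNReal.toReal_eq_zero_iff _).1 h with h | h
    · exact d.eq_of_dist_eq_zero x y h
    · exact absurd h (hd x y)

open Classical in
/-- The real factor that `d x y` contributes to a homogeneous expression in the distances of a
quadruple. An infinite distance contributes `1`: in each of the three products of opposite
distances of a quadruple that contains the infinitely remote point once, exactly one factor is
infinite, and these factors cancel. -/
noncomputable def factor (d : ExtMetric X) (x y : X) : ℝ :=
  if d.dist x y = ⊤ then 1 else (d.dist x y).toReal

/-- Homogeneous coordinates of the cross-ratio triple
`(d(x,y)d(z,u) : d(x,z)d(y,u) : d(x,u)d(y,z))`. -/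
noncomputable def crt (d : ExtMetric X) (x y z u : X) : Fin 3 → ℝ :=
  ![d.factor x y * d.factor z u, d.factor x z * d.factor y u, d.factor x u * d.factor y z]

end ExtMetric

/-- Equality of points of the real projective plane given by homogeneous coordinates. -/
def SameProjPoint (a b : Fin 3 → ℝ) : Prop := ∃ k : ℝ, k ≠ 0 ∧ a = k • b

/-- A quadruple is admissible if no entry occurs three or four times in it. -/
def Admissible {X : Type*} (x y z u : X) : Prop :=
  ¬(x = y ∧ y = z) ∧ ¬(x = y ∧ y = u) ∧ ¬(x = z ∧ z = u) ∧ ¬(y = z ∧ z = u)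

/-- Two extended metrics are Möbius equivalent if they have the same cross-ratio triples on all
admissible quadruples. -/
def MoebiusEquivalent {X : Type*} (d d' : ExtMetric X) : Prop :=
  ∀ x y z u, Admissible x y z u → SameProjPoint (d.crt x y z u) (d'.crt x y z u)

/-! ### Möbius structures -/

/-- A Möbius structure on `X`: a Möbius equivalence class of extended metrics. -/
structure MoebiusStructure (X : Type*) where
  metrics : Set (ExtMetric X)
  nonempty : metrics.Nonempty
  equivalent : ∀ d ∈ metrics, ∀ d' ∈ metrics, MoebiusEquivalent d d'
  full : ∀ d ∈ metrics, ∀ d', MoebiusEquivalent d d' → d' ∈ metrics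

lemma SameProjPoint.refl (a : Fin 3 → ℝ) : SameProjPoint a a := ⟨1, one_ne_zero, by simp⟩

lemma SameProjPoint.symm {a b : Fin 3 → ℝ} (h : SameProjPoint a b) : SameProjPoint b a := by
  obtain ⟨k, hk, rfl⟩ := h
  exact ⟨k⁻¹, inv_ne_zero hk, by rw [smul_smul, inv_mul_cancel₀ hk, one_smul]⟩

lemma SameProjPoint.trans {a b c : Fin 3 → ℝ} (h : SameProjPoint a b) (h' : SameProjPoint b c) :
    SameProjPoint a c := by
  obtain ⟨k, hk, rfl⟩ := h
  obtain ⟨l, hl, rfl⟩ := h'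
  exact ⟨k * l, mul_ne_zero hk hl, by rw [smul_smul]⟩

/-- The Möbius structure generated by an extended metric. -/
def ExtMetric.moebiusStructure {X : Type*} (d : ExtMetric X) : MoebiusStructure X where
  metrics := {d' | MoebiusEquivalent d d'}
  nonempty := ⟨d, fun _ _ _ _ _ => SameProjPoint.refl _⟩
  equivalent := fun _ h₁ _ h₂ x y z u hQ => ((h₁ x y z u hQ).symm).trans (h₂ x y z u hQ)
  full := fun _ h₁ _ h₂ x y z u hQ => (h₁ x y z u hQ).trans (h₂ x y z u hQ)

/-- A Möbius map: injective, and preserving the cross-ratio triples of admissible quadruples. -/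
def IsMoebiusMap {X Y : Type*} (M : MoebiusStructure X) (N : MoebiusStructure Y) (f : X → Y) :
    Prop :=
  Function.Injective f ∧ ∀ d ∈ M.metrics, ∀ e ∈ N.metrics, ∀ x y z u, Admissible x y z u →
    SameProjPoint (e.crt (f x) (f y) (f z) (f u)) (d.crt x y z u)

/-- A Möbius automorphism: a bijective Möbius self-map. -/
def IsMoebiusAutomorphism {X : Type*} (M : MoebiusStructure X) (f : X → X) : Prop :=
  Function.Bijective f ∧ IsMoebiusMap M M f

/-! ### The extended real line and its square root -/

/-- The distance on `Y ∪ {∞}` that extends a distance on `Y` and has `∞` as remote point. -/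
noncomputable def extendedDist {Y : Type*} (δ : Y → Y → ℝ) : OnePoint Y → OnePoint Y → ℝ≥0∞
  | OnePoint.infty, OnePoint.infty => 0
  | OnePoint.infty, OnePoint.some _ => ⊤
  | OnePoint.some _, OnePoint.infty => ⊤
  | OnePoint.some x, OnePoint.some y => ENNReal.ofReal (δ x y)

/-- The extended metric on `Y ∪ {∞}`, with infinitely remote point `∞`, given by a metric `δ` on a
set `Y` with more than one point. -/
noncomputable def ExtMetric.ofMetric {Y : Type*} [Nontrivial Y] (δ : Y → Y → ℝ)
    (h_self : ∀ x, δ x x = 0) (h_pos : ∀ x y, x ≠ y → 0 < δ x y) (h_symm : ∀ x y, δ x y = δ y x)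
    (h_tri : ∀ x y z, δ x z ≤ δ x y + δ y z) : ExtMetric (OnePoint Y) where
  dist := extendedDist δ
  dist_self x := by
    cases x <;> simp [extendedDist, h_self]
  eq_of_dist_eq_zero x y h := by
    cases x <;> cases y <;> simp [extendedDist] at h ⊢
    by_contra hne
    exact absurd (h_pos _ _ hne) (not_lt.2 h)
  symm x y := by
    cases x <;> cases y <;> simp [extendedDist, h_symm]
  triangle x y z := by
    have hn : ∀ x y, 0 ≤ δ x y := fun x y => by
      by_cases h : x = y
      · rw [h, h_self]
      · exact (h_pos x y h).le
    cases x <;> cases y <;> cases z <;> simp [extendedDist]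
    rw [← ENNReal.ofReal_add (hn _ _) (hn _ _)]
    exact ENNReal.ofReal_le_ofReal (h_tri _ _ _)
  remote_of_top x y h := by
    cases x
    · left
      intro w hw
      cases w
      · exact absurd rfl hw
      · rfl
    · cases y
      · right
        intro w hw
        cases w
        · exact absurd rfl hw
        · rfl
      · simp [extendedDist] at h
  remote_unique := by
    have key : ∀ ω, IsRemotePoint (extendedDist δ) ω → ω = OnePoint.infty := by
      intro ω h
      cases ω with
      | infty => rfl
      | coe y =>
        obtain ⟨z, hz⟩ := exists_ne y
        have := h (OnePoint.some z) (by simpa using hz)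
        simp [extendedDist] at this
    intro ω ω' h h'
    rw [key ω h, key ω' h']

/-- The extended real line `ℝ ∪ {∞}` with the metric `|x - y|`. -/
noncomputable def extRealLine : ExtMetric (OnePoint ℝ) :=
  ExtMetric.ofMetric (fun x y => |x - y|) (by simp) (fun x y h => abs_pos.2 (sub_ne_zero.2 h))
    (fun x y => abs_sub_comm x y) (fun x y z => abs_sub_le x y z)

/-- The square root of the extended real line: `ℝ ∪ {∞}` with the metric `|x - y|^(1/2)`. -/
noncomputable def sqrtExtRealLine : ExtMetric (OnePoint ℝ) :=
  ExtMetric.ofMetric (fun x y => √|x - y|) (by simp)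
    (fun x y h => Real.sqrt_pos.2 (abs_pos.2 (sub_ne_zero.2 h)))
    (fun x y => by rw [abs_sub_comm])
    (fun x y z => (Real.sqrt_le_sqrt (abs_sub_le x y z)).trans
      (by
        rw [Real.sqrt_le_left (by positivity), add_sq, Real.sq_sqrt (abs_nonneg _),
          Real.sq_sqrt (abs_nonneg _)]
        nlinarith [mul_nonneg (Real.sqrt_nonneg |x - y|) (Real.sqrt_nonneg |y - z|)]))

/-! ### Ptolemy spaces, circles and the incidence axioms -/

namespace MoebiusStructure

variable {X : Type*} (M : MoebiusStructure X)

/-- `X` is compact in the topology of a (finite) metric of the Möbius structure. -/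
def Compact : Prop :=
  ∃ d ∈ M.metrics, ∃ hd : d.Finite,
    @CompactSpace X (d.toMetricSpace hd).toPseudoMetricSpace.toUniformSpace.toTopologicalSpace

/-- The Ptolemy inequality holds for every metric of the structure. -/
def Ptolemy : Prop :=
  ∀ d ∈ M.metrics, ∀ x y z u, Admissible x y z u →
    d.factor x z * d.factor y u ≤ d.factor x y * d.factor z u + d.factor x u * d.factor y z

/-- An `ℝ`-circle: a subset that is Möbius equivalent to the extended real line. -/
def IsRCircle (σ : Set X) : Prop :=
  ∃ f : OnePoint ℝ → X, IsMoebiusMap extRealLine.moebiusStructure M f ∧ Set.range f = σ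

/-- A `ℂ`-circle: a subset that is Möbius equivalent to the square root of the extended real
line. -/
def IsCCircle (F : Set X) : Prop :=
  ∃ f : OnePoint ℝ → X, IsMoebiusMap sqrtExtRealLine.moebiusStructure M f ∧ Set.range f = F

/-- The quadruple `(x, z, y, u)` is harmonic: it is admissible and its cross-ratio triple is
`(1 : * : 1)`, that is, `d(x,z) d(y,u) = d(x,u) d(y,z)`. -/
def Harmonic (x z y u : X) : Prop :=
  Admissible x z y u ∧
    ∀ d ∈ M.metrics, d.factor x z * d.factor y u = d.factor x u * d.factor y z

/-- Through every two distinct points there is a unique `ℂ`-circle. -/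
def AxiomEC : Prop :=
  ∀ x y : X, x ≠ y → ∃! F : Set X, M.IsCCircle F ∧ x ∈ F ∧ y ∈ F

/-- For every `ℂ`-circle `F`, `ω ∈ F` and `u ∉ F` there is a unique `ℝ`-circle through `ω`, `u`
that intersects `F \ {ω}`. -/
def AxiomER : Prop :=
  ∀ F : Set X, M.IsCCircle F → ∀ ω ∈ F, ∀ u ∉ F,
    ∃! σ : Set X, M.IsRCircle σ ∧ ω ∈ σ ∧ u ∈ σ ∧ (σ ∩ (F \ {ω})).Nonempty

/-- Given an `ℝ`-circle `σ` and a `ℂ`-circle `F` with common distinct points `o`, `ω`: if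
`u, v ∈ σ` and `(o, u, ω, v)` is harmonic, then `(w, u, o, v)` is harmonic for all `w ∈ F`. -/
def AxiomOC : Prop :=
  ∀ σ F : Set X, M.IsRCircle σ → M.IsCCircle F → ∀ o ω : X, o ≠ ω → o ∈ σ → o ∈ F → ω ∈ σ → ω ∈ F →
    ∀ u ∈ σ, ∀ v ∈ σ, M.Harmonic o u ω v → ∀ w ∈ F, M.Harmonic w u o v

/-- Given an `ℝ`-circle `σ` and a `ℂ`-circle `F` with common distinct points `o`, `ω`: if
`x, y ∈ F` and `(o, x, ω, y)` is harmonic, then `(w, x, ω, y)` is harmonic for all `w ∈ σ`. -/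
def AxiomOR : Prop :=
  ∀ σ F : Set X, M.IsRCircle σ → M.IsCCircle F → ∀ o ω : X, o ≠ ω → o ∈ σ → o ∈ F → ω ∈ σ → ω ∈ F →
    ∀ x ∈ F, ∀ y ∈ F, M.Harmonic o x ω y → ∀ w ∈ σ, M.Harmonic w x ω y

/-! ### Lines, projections and semi-`ℂ`-planes in `X_ω = X \ {ω}`

An `ℝ`-line (`ℂ`-line) in `X_ω` is represented by the `ℝ`-circle (`ℂ`-circle) through `ω` that
contains it. -/

/-- The circle `σ` gives an `ℝ`-line of `X_ω` through `o`. -/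
def IsRLine (ω o : X) (σ : Set X) : Prop := M.IsRCircle σ ∧ ω ∈ σ ∧ o ∈ σ ∧ o ≠ ω

/-- The circle `F` gives a `ℂ`-line of `X_ω` through `o`. -/
def IsCLine (ω o : X) (F : Set X) : Prop := M.IsCCircle F ∧ ω ∈ F ∧ o ∈ F ∧ o ≠ ω

/-- `p` is the projection `μ_{F,ω}(u)` of `u ∈ X_ω` to the `ℂ`-line `F \ {ω}`: `p = u` if `u ∈ F`;
otherwise `p` is the point where `F \ {ω}` is hit by the `ℝ`-circle through `ω` and `u` that
meets `F \ {ω}`. -/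
def IsVerticalProj (ω : X) (F : Set X) (u p : X) : Prop :=
  (u ∈ F ∧ p = u) ∨
    (u ∉ F ∧ p ∈ F ∧ p ≠ ω ∧ ∃ σ : Set X, M.IsRCircle σ ∧ ω ∈ σ ∧ u ∈ σ ∧ p ∈ σ)

/-- `p` is a point where the `ℝ`-line `σ \ {ω}` meets the `ℂ`-line through `u`. -/
def IsHorizontalProj (ω : X) (σ : Set X) (u p : X) : Prop :=
  p ∈ σ ∧ p ≠ ω ∧ ∃ G : Set X, M.IsCLine ω u G ∧ p ∈ G

/-- The semi-`ℂ`-plane `π_ω⁻¹(π_ω(σ)) ⊆ X_ω` over an `ℝ`-line `σ`, where `π_ω` maps a point of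
`X_ω` to the `ℂ`-circle through this point and `ω`: the union of all `ℂ`-lines that meet the
`ℝ`-line. -/
def semiCPlane (ω : X) (σ : Set X) : Set X :=
  {x | ∃ p ∈ σ, p ≠ ω ∧ ∃ G : Set X, M.IsCLine ω x G ∧ p ∈ G}

/-- `h` acts on the `ℝ`-line `σ \ {ω}` as the homothety with center `o` and coefficient `lam`:
`c t ↦ c (lam * t)` in unit speed parametrizations `c` with `c 0 = o`. -/
def ScalesRLine (d : ExtMetric X) (ω o : X) (lam : ℝ) (σ : Set X) (h : X → X) : Prop :=
  ∀ c : ℝ → X, Set.range c = σ \ {ω} → c 0 = o →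
    (∀ s t, d.dist (c s) (c t) = ENNReal.ofReal |s - t|) → ∀ t, h (c t) = c (lam * t)

/-- `h` acts on the `ℂ`-line `F \ {ω}` as the homothety with center `o` and coefficient `lam`.
In a parametrization `c` with `c 0 = o` and `d (c s) (c t) = |s - t|^(1/2)` this is
`c t ↦ c (lam ^ 2 * t)`. -/
def ScalesCLine (d : ExtMetric X) (ω o : X) (lam : ℝ) (F : Set X) (h : X → X) : Prop :=
  ∀ c : ℝ → X, Set.range c = F \ {ω} → c 0 = o →
    (∀ s t, d.dist (c s) (c t) = ENNReal.ofReal (√|s - t|)) → ∀ t, h (c t) = c (lam ^ 2 * t)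

/-- `h` is the map `h_{o,lam} : X_ω → X_ω`, extended to `X` by `h ω = ω`. It preserves the
`ℂ`-line `F` through `o` and all `ℝ`-lines `σ` through `o` and scales them by `lam`; it preserves
every semi-`ℂ`-plane that contains `F`, and acts coordinatewise, `(x_F, x_σ) ↦ (h x_F, h x_σ)`, on
the semi-`ℂ`-plane spanned by `F` and `σ`. The extended metric `d` has `ω` as infinitely remote
point. -/
structure IsPureHomothetyMap (d : ExtMetric X) (ω o : X) (lam : ℝ) (h : X → X) : Prop where
  map_omega : h ω = ω
  mapsTo : ∀ x, x ≠ ω → h x ≠ ω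
  map_center : h o = o
  image_cline : ∀ F, M.IsCLine ω o F → h '' F = F
  scales_cline : ∀ F, M.IsCLine ω o F → ScalesCLine d ω o lam F h
  image_rline : ∀ σ, M.IsRLine ω o σ → h '' σ = σ
  scales_rline : ∀ σ, M.IsRLine ω o σ → ScalesRLine d ω o lam σ h
  image_semiCPlane : ∀ F σ, M.IsCLine ω o F → M.IsRCircle σ → ω ∈ σ →
    F \ {ω} ⊆ M.semiCPlane ω σ → h '' M.semiCPlane ω σ = M.semiCPlane ω σ
  coordinatewise : ∀ F σ, M.IsCLine ω o F → M.IsRLine ω o σ →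
    ∀ x ∈ M.semiCPlane ω σ, ∀ xF xσ,
      M.IsVerticalProj ω F x xF → M.IsHorizontalProj ω σ x xσ →
        M.IsVerticalProj ω F (h x) (h xF) ∧ M.IsHorizontalProj ω σ (h x) (h xσ)

end MoebiusStructure

/-!
The factors of a metric of the structure whose remote point is `ω` form a two-point function `q`
that is a metric on `X \ {ω}`, and Möbius maps are the maps that change `q` by a conformal factor.
An `ℝ`-line and a `ℂ`-line that meet in `o` satisfy `|xy|⁴ = |xo|⁴ + |yo|⁴`. Hence sliding along
the `ℂ`-lines is an action of `(ℝ, +)` on `X_ω` by isometries. Let `F` be the `ℂ`-circle through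
`o` and `ω`. The shifts that fix `ω` and those that fix `o` generate the projective group of `F`,
so some word in them acts on `F` as the homothety `t ↦ λ² t`, and it is a homothety of `X_ω` with
coefficient `λ`. It may still rotate the `ℝ`-lines through `o`. The words form a one-parameter
family in which the parameter `b` of the shifts fixing `o` tends to `0`, and since `ℂ`-circles are
tangent to `ℂ`-lines, the rotation disappears in a limit along an ultrafilter, which exists by
compactness. The pure homothety is unique because the coordinates `x_F` and `x_σ` determine `x`.
-/

namespace MoebiusGauge

open Filter Topology

/-! ### Model circles and conformal maps -/

/-- The distance profiles `x ↦ x` and `x ↦ √x` of the model circles `ℝ ∪ {∞}`, by their common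
properties on `[0, ∞)`. -/
structure IsProfile (p : ℝ → ℝ) : Prop where
  map_zero : p 0 = 0
  map_mul : ∀ x y, 0 ≤ x → 0 ≤ y → p (x * y) = p x * p y
  bijOn : Set.BijOn p (Set.Ioi 0) (Set.Ioi 0)

namespace IsProfile

lemma id : IsProfile fun x => x :=
  ⟨rfl, fun _ _ _ _ => rfl, Set.bijOn_id _⟩

lemma sqrt : IsProfile Real.sqrt :=
  ⟨Real.sqrt_zero, fun _ y hx _ => Real.sqrt_mul hx y, fun _ hx => Real.sqrt_pos.2 hx,
    fun _ hx _ hy h => (Real.sqrt_inj (le_of_lt hx) (le_of_lt hy)).1 h,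
    fun y (hy : 0 < y) => ⟨y ^ 2, pow_pos hy 2, Real.sqrt_sq hy.le⟩⟩

variable {p : ℝ → ℝ} {x : ℝ}

lemma map_pos (hp : IsProfile p) (hx : 0 < x) : 0 < p x := hp.bijOn.mapsTo hx

lemma map_one (hp : IsProfile p) : p 1 = 1 := by
  have h := hp.map_mul 1 1 zero_le_one zero_le_one
  rw [mul_one] at h
  exact (mul_eq_left₀ (hp.map_pos one_pos).ne').1 h.symm

lemma map_inv (hp : IsProfile p) (hx : 0 < x) : p x⁻¹ = (p x)⁻¹ := by
  refine eq_inv_of_mul_eq_one_left ?_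
  rw [← hp.map_mul _ _ (inv_nonneg.2 hx.le) hx.le, inv_mul_cancel₀ hx.ne', hp.map_one]

lemma injOn (hp : IsProfile p) : Set.InjOn p (Set.Ici 0) := by
  rintro x (hx : 0 ≤ x) y (hy : 0 ≤ y) h
  rcases hx.eq_or_lt with rfl | hx
  · rcases hy.eq_or_lt with rfl | hy
    · rfl
    · exact absurd (hp.map_zero.symm.trans h) (hp.map_pos hy).ne
  · rcases hy.eq_or_lt with rfl | hy
    · exact absurd (h.trans hp.map_zero) (hp.map_pos hx).ne'
    · exact hp.bijOn.injOn hx hy h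

end IsProfile

/-- The factors `d.factor x y` of the extended metric `p |s - t|` on `ℝ ∪ {∞}`: the infinite
distance counts as `1`. -/
noncomputable def model (p : ℝ → ℝ) : OnePoint ℝ → OnePoint ℝ → ℝ
  | OnePoint.infty, OnePoint.infty => 0
  | OnePoint.infty, OnePoint.some _ => 1
  | OnePoint.some _, OnePoint.infty => 1
  | OnePoint.some x, OnePoint.some y => p |x - y|

/-- A map that pulls the two-point function `q'` back to a conformal multiple of `q`. Between
the gauges of Möbius structures these are the Möbius maps. -/
def IsConformalMap {X Y : Type*} (q : Y → Y → ℝ) (q' : X → X → ℝ) (f : Y → X) : Prop :=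
  ∃ φ : Y → ℝ, (∀ y, 0 < φ y) ∧ ∀ x y, q' (f x) (f y) = φ x * φ y * q x y

lemma IsConformalMap.comp {X Y Z : Type*} {q : X → X → ℝ} {q' : Y → Y → ℝ} {q'' : Z → Z → ℝ}
    {g : Y → Z} {f : X → Y} (hg : IsConformalMap q' q'' g) (hf : IsConformalMap q q' f) :
    IsConformalMap q q'' (g ∘ f) := by
  obtain ⟨ψ, hψ, hg⟩ := hg
  obtain ⟨φ, hφ, hf⟩ := hf
  refine ⟨fun x => ψ (f x) * φ x, fun x => mul_pos (hψ _) (hφ _), fun x y => ?_⟩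
  simp only [Function.comp_apply, hg, hf]
  ring

/-- The involution `s ↦ r + 1 / s` of the extended line, with `∞ ↦ r` and `0 ↦ ∞`. -/
noncomputable def invAt (r : ℝ) : OnePoint ℝ → OnePoint ℝ
  | OnePoint.infty => OnePoint.some r
  | OnePoint.some s => if s = 0 then OnePoint.infty else OnePoint.some (r + s⁻¹)

lemma surjective_invAt (r : ℝ) : Function.Surjective (invAt r) := by
  intro y
  cases y with
  | infty => exact ⟨OnePoint.some 0, by simp [invAt]⟩
  | coe t =>
    by_cases h : t = r
    · exact ⟨OnePoint.infty, by simp [invAt, h]⟩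
    · exact ⟨OnePoint.some (t - r)⁻¹, by simp [invAt, sub_ne_zero.2 h]⟩

lemma abs_invAt_sub_invAt (r : ℝ) {s t : ℝ} (hs : s ≠ 0) (ht : t ≠ 0) :
    |r + s⁻¹ - (r + t⁻¹)| = |s|⁻¹ * |t|⁻¹ * |s - t| := by
  rw [← abs_inv, ← abs_inv, ← abs_mul, ← abs_mul, ← abs_neg]
  congr 1
  field_simp
  ring

lemma isConformalMap_invAt {p : ℝ → ℝ} (hp : IsProfile p) (r : ℝ) :
    IsConformalMap (model p) (model p) (invAt r) := by
  have h0 := hp.map_zero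
  have hpos {s : ℝ} (hs : s ≠ 0) : 0 < p |s| := hp.map_pos (abs_pos.2 hs)
  have hinv {s : ℝ} (hs : s ≠ 0) : p |s|⁻¹ = (p |s|)⁻¹ := hp.map_inv (abs_pos.2 hs)
  refine ⟨fun x => x.elim 1 fun s => if s = 0 then 1 else (p |s|)⁻¹, fun x => ?_, fun x y => ?_⟩
  · cases x with
    | infty => exact one_pos
    | coe s => by_cases hs : s = 0 <;> simp [hs, hpos]
  · cases x with
    | infty =>
      cases y with
      | infty => simp [invAt, model, h0]
      | coe t => by_cases ht : t = 0 <;> simp [invAt, model, ht, abs_inv, hinv]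
    | coe s =>
      cases y with
      | infty => by_cases hs : s = 0 <;> simp [invAt, model, hs, abs_inv, hinv]
      | coe t =>
        by_cases hs : s = 0 <;> by_cases ht : t = 0
        · simp [invAt, model, hs, ht, h0]
        · simp [invAt, model, hs, ht, (hpos ht).ne']
        · simp [invAt, model, hs, ht, (hpos hs).ne']
        · simp only [invAt, model, hs, ht, if_false, OnePoint.elim_some]
          rw [abs_invAt_sub_invAt r hs ht, hp.map_mul _ _ (by positivity) (abs_nonneg _),
            hp.map_mul _ _ (by positivity) (by positivity), hinv hs, hinv ht]

/-! ### Gauges, circles and lines -/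

/-- A gauge: a positive symmetric two-point function with the Ptolemy inequality, such as the
factors of an extended metric of a Ptolemy space. -/
structure IsGauge {X : Type*} (q : X → X → ℝ) : Prop where
  symm : ∀ x y, q x y = q y x
  self : ∀ x, q x x = 0
  pos : ∀ x y, x ≠ y → 0 < q x y
  ptolemy : ∀ x y z u, q x z * q y u ≤ q x y * q z u + q x u * q y z

/-- The gauge `q` is normalized at `ω`; a gauge given by an extended metric is normalized at the
infinitely remote point. -/
def NormalizedAt {X : Type*} (q : X → X → ℝ) (ω : X) : Prop := ∀ x, x ≠ ω → q x ω = 1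

/-- A circle with profile `p`: a conformal image of `ℝ ∪ {∞}` with the metric `p |s - t|`. -/
def IsCircle {X : Type*} (p : ℝ → ℝ) (q : X → X → ℝ) (σ : Set X) : Prop :=
  ∃ f : OnePoint ℝ → X, IsConformalMap (model p) q f ∧ Set.range f = σ

/-- A parametrized line with profile `p`: a curve in `X \ {ω}` with `q (c s) (c t) = p |s - t|`. -/
structure IsLine {X : Type*} (p : ℝ → ℝ) (q : X → X → ℝ) (ω : X) (c : ℝ → X) : Prop where
  ne : ∀ s, c s ≠ ω
  dist : ∀ s t, q (c s) (c t) = p |s - t|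

section Lines

variable {X : Type*} {p : ℝ → ℝ} {q : X → X → ℝ} {ω : X} {σ : Set X} {c c' : ℝ → X}

lemma IsGauge.eq_of_eq_zero (hq : IsGauge q) {x y : X} (h : q x y = 0) : x = y := by
  by_contra hne
  exact (hq.pos x y hne).ne' h

lemma IsGauge.nonneg (hq : IsGauge q) (x y : X) : 0 ≤ q x y := by
  rcases eq_or_ne x y with rfl | h
  · rw [hq.self]
  · exact (hq.pos x y h).le

lemma IsGauge.triangle (hq : IsGauge q) (hω : NormalizedAt q ω) {x y z : X} (hx : x ≠ ω)
    (hy : y ≠ ω) (hz : z ≠ ω) : q x z ≤ q x y + q y z := by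
  have h := hq.ptolemy x y z ω
  rw [hω x hx, hω y hy, hω z hz] at h
  linarith

lemma IsConformalMap.injective {Y : Type*} {q : Y → Y → ℝ} {q' : X → X → ℝ} {g : Y → X}
    (hg : IsConformalMap q q' g) (hself : ∀ x, q' x x = 0) (hpos : ∀ x y, x ≠ y → 0 < q x y) :
    Function.Injective g := by
  obtain ⟨φ, hφ, h⟩ := hg
  intro x y hxy
  by_contra hne
  have hzero : φ x * φ y * q x y = 0 := by rw [← h, hxy, hself]
  exact (mul_pos (mul_pos (hφ x) (hφ y)) (hpos x y hne)).ne' hzero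

lemma IsConformalMap.exists_homothety (hn : NormalizedAt q ω) (hq : IsGauge q) {g : X → X}
    (hg : IsConformalMap q q g) (hgω : g ω = ω) :
    ∃ k, 0 < k ∧ ∀ x y, x ≠ ω → y ≠ ω → q (g x) (g y) = k * q x y := by
  have hinj := hg.injective hq.self hq.pos
  obtain ⟨φ, hφ, h⟩ := hg
  have hφω : ∀ x, x ≠ ω → φ x = (φ ω)⁻¹ := by
    intro x hx
    have hgx : g x ≠ ω := fun h => hx (hinj (h.trans hgω.symm))
    have hxω := h x ω
    rw [hgω, hn x hx, hn _ hgx, mul_one] at hxω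
    exact eq_inv_of_mul_eq_one_left hxω.symm
  have hpos := inv_pos.2 (hφ ω)
  exact ⟨(φ ω)⁻¹ * (φ ω)⁻¹, mul_pos hpos hpos, fun x y hx hy => by rw [h, hφω x hx, hφω y hy]⟩

lemma IsCircle.image {Y : Type*} {q' : Y → Y → ℝ} {g : X → Y} (h : IsCircle p q σ)
    (hg : IsConformalMap q q' g) : IsCircle p q' (g '' σ) := by
  obtain ⟨f, hf, rfl⟩ := h
  exact ⟨g ∘ f, hg.comp hf, Set.range_comp g f⟩

lemma IsCircle.exists_map_infty (hp : IsProfile p) (hσ : IsCircle p q σ) (hω : ω ∈ σ) :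
    ∃ f : OnePoint ℝ → X,
      IsConformalMap (model p) q f ∧ Set.range f = σ ∧ f OnePoint.infty = ω := by
  obtain ⟨f, hf, rfl⟩ := hσ
  obtain ⟨x, hx⟩ := hω
  cases x with
  | infty => exact ⟨f, hf, rfl, hx⟩
  | coe r =>
    exact ⟨f ∘ invAt r, hf.comp (isConformalMap_invAt hp r), (surjective_invAt r).range_comp f, hx⟩

lemma IsCircle.exists_affine_map (hp : IsProfile p) (hq : IsGauge q) (hn : NormalizedAt q ω)
    (hσ : IsCircle p q σ) (hω : ω ∈ σ) :
    ∃ (f : ℝ → X) (a : ℝ), 0 < a ∧ Set.range f = σ \ {ω} ∧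
      ∀ s t, a * q (f s) (f t) = p |s - t| := by
  obtain ⟨f, ⟨φ, hφ, hf⟩, rfl, hfω⟩ := hσ.exists_map_infty hp hω
  have hdist_infty (s : ℝ) : q (f s) ω = φ s * φ OnePoint.infty := by
    simpa only [hfω, model, mul_one] using hf (OnePoint.some s) OnePoint.infty
  have hfs (s : ℝ) : f s ≠ ω := fun hs => by
    have := hdist_infty s
    rw [hs, hq.self] at this
    exact (mul_pos (hφ _) (hφ _)).ne this
  have hφs (s : ℝ) : φ s * φ OnePoint.infty = 1 := by rw [← hdist_infty, hn _ (hfs s)]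
  refine ⟨fun s => f s, φ OnePoint.infty ^ 2, pow_pos (hφ _) 2, ?_, fun s t => ?_⟩
  · ext x
    constructor
    · rintro ⟨s, rfl⟩
      exact ⟨⟨_, rfl⟩, hfs _⟩
    · rintro ⟨⟨y, rfl⟩, hy⟩
      cases y with
      | infty => exact absurd hfω hy
      | coe y => exact ⟨y, rfl⟩
  · simp only [hf, model]
    linear_combination (p |s - t| * φ t * φ OnePoint.infty) * hφs s + p |s - t| * hφs t

lemma IsCircle.exists_line (hp : IsProfile p) (hq : IsGauge q) (hn : NormalizedAt q ω)
    (hσ : IsCircle p q σ) (hω : ω ∈ σ) {o : X} (ho : o ∈ σ) (hne : o ≠ ω) :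
    ∃ c, IsLine p q ω c ∧ c 0 = o ∧ Set.range c = σ \ {ω} := by
  obtain ⟨f, a, ha, hrange, hf⟩ := hσ.exists_affine_map hp hq hn hω
  obtain ⟨r, rfl⟩ : o ∈ Set.range f := hrange ▸ ⟨ho, hne⟩
  obtain ⟨k, hk : 0 < k, hpk⟩ := hp.bijOn.surjOn ha
  have hsurj : Function.Surjective fun s : ℝ => r + k * s := fun y =>
    ⟨(y - r) / k, by simp only; field_simp; ring⟩
  refine ⟨fun s => f (r + k * s), ⟨fun s => ?_, fun s t => ?_⟩, by simp,
    (hsurj.range_comp f).trans hrange⟩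
  · exact (hrange.subset ⟨_, rfl⟩ : f (r + k * s) ∈ σ \ {ω}).2
  · refine mul_left_cancel₀ ha.ne' ?_
    rw [hf, add_sub_add_left_eq_sub, ← mul_sub, abs_mul, abs_of_pos hk,
      hp.map_mul _ _ hk.le (abs_nonneg _), hpk]

lemma IsLine.isCircle (hq : IsGauge q) (hn : NormalizedAt q ω) (hc : IsLine p q ω c) :
    IsCircle p q (insert ω (Set.range c)) := by
  have hω (s : ℝ) : q (c s) ω = 1 := hn _ (hc.ne s)
  refine ⟨fun x => x.elim ω c, ⟨fun _ => 1, fun _ => one_pos, fun x y => ?_⟩, ?_⟩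
  · cases x <;> cases y <;> simp [model, hq.self, hω, hq.symm ω, hc.dist]
  · ext x
    constructor
    · rintro ⟨y, rfl⟩
      cases y with
      | infty => exact Or.inl rfl
      | coe s => exact Or.inr ⟨s, rfl⟩
    · rintro (rfl | ⟨s, rfl⟩)
      · exact ⟨OnePoint.infty, rfl⟩
      · exact ⟨OnePoint.some s, rfl⟩

lemma IsLine.injective (hp : IsProfile p) (hq : IsGauge q) (hc : IsLine p q ω c) :
    Function.Injective c := by
  intro s t h
  by_contra hne
  have hdist := hc.dist s t
  rw [h, hq.self] at hdist
  exact (hp.map_pos (abs_pos.2 (sub_ne_zero.2 hne))).ne hdist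

lemma IsLine.shift (hc : IsLine p q ω c) (a : ℝ) : IsLine p q ω fun s => c (a + s) :=
  ⟨fun _ => hc.ne _, fun s t => by rw [hc.dist, add_sub_add_left_eq_sub]⟩

lemma IsLine.neg (hc : IsLine p q ω c) : IsLine p q ω fun s => c (-s) :=
  ⟨fun _ => hc.ne _, fun s t => by rw [hc.dist, neg_sub_neg, abs_sub_comm]⟩

lemma IsLine.range_eq_diff (hc : IsLine p q ω c) :
    Set.range c = insert ω (Set.range c) \ {ω} := by
  refine (Set.insert_sdiff_self_of_notMem ?_).symm
  rintro ⟨s, hs⟩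
  exact hc.ne s hs

lemma range_shift (c : ℝ → X) (a : ℝ) : Set.range (fun s => c (a + s)) = Set.range c :=
  (add_left_surjective a).range_comp c

lemma eq_add_or_eq_sub_of_isometry {g : ℝ → ℝ} (hg : Isometry g) :
    (∀ t, g t = g 0 + t) ∨ ∀ t, g t = g 0 - t := by
  have hdist (s t : ℝ) : |g s - g t| = |s - t| := by
    rw [← Real.dist_eq, ← Real.dist_eq, hg.dist_eq]
  have hpt (t : ℝ) : g t = g 0 + t ∨ g t = g 0 - t := by
    rcases abs_eq_abs.1 (hdist t 0) with h | h
    · left; linarith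
    · right; linarith
  refine (hpt 1).imp (fun h1 t => ?_) fun h1 t => ?_
  all_goals
    rcases hpt t with h | h
    · rcases abs_eq_abs.1 (hdist t 1) with h' | h' <;> linarith
    · rcases abs_eq_abs.1 (hdist t 1) with h' | h' <;> linarith

lemma IsLine.eq_or_eq_neg (hp : IsProfile p) (hq : IsGauge q) (hc : IsLine p q ω c)
    (hc' : IsLine p q ω c') (h0 : c' 0 = c 0) (hr : Set.range c' ⊆ Set.range c) :
    (∀ t, c' t = c t) ∨ ∀ t, c' t = c (-t) := by
  choose g hg using fun t => hr ⟨t, rfl⟩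
  have hg0 : g 0 = 0 := hc.injective hp hq (by rw [hg, h0])
  have hiso : Isometry g := Isometry.of_dist_eq fun s t => by
    have hdist := hc.dist (g s) (g t)
    rw [hg, hg, hc'.dist] at hdist
    exact (hp.injOn (Set.mem_Ici.2 (abs_nonneg _)) (Set.mem_Ici.2 (abs_nonneg _)) hdist).symm
  refine (eq_add_or_eq_sub_of_isometry hiso).imp (fun h t => ?_) fun h t => ?_
  · rw [← hg, h, hg0, zero_add]
  · rw [← hg, h, hg0, zero_sub]

end Lines

/-! ### Incidence axioms for gauges -/

/-- An `ℝ`-circle of a gauge. -/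
abbrev IsRealCircle {X : Type*} (q : X → X → ℝ) (σ : Set X) : Prop := IsCircle (fun x => x) q σ

/-- A `ℂ`-circle of a gauge. -/
abbrev IsComplexCircle {X : Type*} (q : X → X → ℝ) (F : Set X) : Prop := IsCircle Real.sqrt q F

/-- A parametrized `ℝ`-line. -/
abbrev IsRealLine {X : Type*} (q : X → X → ℝ) (ω : X) (c : ℝ → X) : Prop :=
  IsLine (fun x => x) q ω c

/-- A parametrized `ℂ`-line. -/
abbrev IsComplexLine {X : Type*} (q : X → X → ℝ) (ω : X) (c : ℝ → X) : Prop :=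
  IsLine Real.sqrt q ω c

/-- A gauge with the axioms (E_ℂ), (E_ℝ) and (O). For the quadruples of pairwise distinct points in
(O), harmonicity of `(x, z, y, u)` is the equation `q x z * q y u = q x u * q y z`. -/
structure IsIncidenceGauge {X : Type*} (q : X → X → ℝ) : Prop extends IsGauge q where
  existsUnique_complexCircle : ∀ x y : X, x ≠ y → ∃! F : Set X, IsComplexCircle q F ∧ x ∈ F ∧ y ∈ F
  existsUnique_realCircle : ∀ F : Set X, IsComplexCircle q F → ∀ ω ∈ F, ∀ u ∉ F,
    ∃! σ : Set X, IsRealCircle q σ ∧ ω ∈ σ ∧ u ∈ σ ∧ (σ ∩ (F \ {ω})).Nonempty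
  harmonic_complexCircle : ∀ σ F : Set X, IsRealCircle q σ → IsComplexCircle q F →
    ∀ o ∈ σ ∩ F, ∀ ω ∈ σ ∩ F, o ≠ ω → ∀ u ∈ σ \ {o, ω}, ∀ v ∈ σ \ {o, ω},
    q o u * q ω v = q o v * q u ω → ∀ w ∈ F, q w u * q o v = q w v * q u o
  harmonic_realCircle : ∀ σ F : Set X, IsRealCircle q σ → IsComplexCircle q F →
    ∀ o ∈ σ ∩ F, ∀ ω ∈ σ ∩ F, o ≠ ω → ∀ x ∈ F \ {o, ω}, ∀ y ∈ F \ {o, ω},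
    q o x * q ω y = q o y * q x ω → ∀ w ∈ σ, q w x * q ω y = q w y * q x ω

/-- A gauge with the incidence axioms that is normalized at `ω`: on `X \ {ω}` it is a metric. -/
structure IsAffineGauge {X : Type*} (q : X → X → ℝ) (ω : X) : Prop extends IsIncidenceGauge q where
  normalized : NormalizedAt q ω

lemma IsAffineGauge.isCircle {X : Type*} {q : X → X → ℝ} {ω : X} {p : ℝ → ℝ} {c : ℝ → X}
    (hq : IsAffineGauge q ω) (hc : IsLine p q ω c) : IsCircle p q (insert ω (Set.range c)) :=
  hc.isCircle hq.toIsGauge hq.normalized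

section Rescale

variable {X : Type*} {p : ℝ → ℝ} {q : X → X → ℝ} {ψ : X → ℝ}

/-- Multiplication of a gauge by a conformal factor. -/
def rescale (ψ : X → ℝ) (q : X → X → ℝ) : X → X → ℝ := fun x y => ψ x * ψ y * q x y

lemma isConformalMap_id_rescale (hψ : ∀ x, 0 < ψ x) : IsConformalMap q (rescale ψ q) id :=
  ⟨ψ, hψ, fun _ _ => rfl⟩

lemma isConformalMap_rescale_id (hψ : ∀ x, 0 < ψ x) : IsConformalMap (rescale ψ q) q id := by
  refine ⟨fun x => (ψ x)⁻¹, fun x => inv_pos.2 (hψ x), fun x y => ?_⟩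
  have hx := (hψ x).ne'
  have hy := (hψ y).ne'
  simp only [rescale, id_eq]
  field_simp

lemma isCircle_rescale_iff (hψ : ∀ x, 0 < ψ x) {σ : Set X} :
    IsCircle p (rescale ψ q) σ ↔ IsCircle p q σ :=
  ⟨fun h => Set.image_id σ ▸ h.image (isConformalMap_rescale_id hψ),
    fun h => Set.image_id σ ▸ h.image (isConformalMap_id_rescale hψ)⟩

lemma isConformalMap_of_rescale (hψ : ∀ x, 0 < ψ x) {g : X → X}
    (h : ∀ x y, rescale ψ q (g x) (g y) = rescale ψ q x y) : IsConformalMap q q g :=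
  ((isConformalMap_rescale_id hψ).comp (g := id) (f := g)
    ⟨fun _ => 1, fun _ => one_pos, fun x y => by rw [h, one_mul, one_mul]⟩).comp
      (isConformalMap_id_rescale hψ)

lemma rescale_mul_rescale_eq_iff (hψ : ∀ x, 0 < ψ x) (a b c d : X) :
    rescale ψ q a b * rescale ψ q c d = rescale ψ q a d * rescale ψ q b c ↔
      q a b * q c d = q a d * q b c := by
  have hleft : rescale ψ q a b * rescale ψ q c d = ψ a * ψ b * ψ c * ψ d * (q a b * q c d) := by
    simp only [rescale]; ring
  have hright : rescale ψ q a d * rescale ψ q b c = ψ a * ψ b * ψ c * ψ d * (q a d * q b c) := by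
    simp only [rescale]; ring
  rw [hleft, hright]
  exact mul_right_inj' (by simp only [ne_eq, mul_eq_zero, (hψ _).ne', or_self, not_false_iff])

lemma IsGauge.rescale (hq : IsGauge q) (hψ : ∀ x, 0 < ψ x) : IsGauge (rescale ψ q) where
  symm x y := by simp only [MoebiusGauge.rescale, hq.symm x y, mul_comm (ψ x)]
  self x := by simp [MoebiusGauge.rescale, hq.self]
  pos x y h := mul_pos (mul_pos (hψ _) (hψ _)) (hq.pos x y h)
  ptolemy x y z u := by
    have hpos : 0 ≤ ψ x * ψ y * (ψ z * ψ u) :=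
      (mul_pos (mul_pos (hψ x) (hψ y)) (mul_pos (hψ z) (hψ u))).le
    have := mul_le_mul_of_nonneg_left (hq.ptolemy x y z u) hpos
    simp only [MoebiusGauge.rescale]
    linarith

lemma IsIncidenceGauge.rescale (hq : IsIncidenceGauge q) (hψ : ∀ x, 0 < ψ x) :
    IsIncidenceGauge (rescale ψ q) where
  toIsGauge := hq.toIsGauge.rescale hψ
  existsUnique_complexCircle := by
    simpa only [isCircle_rescale_iff hψ] using hq.existsUnique_complexCircle
  existsUnique_realCircle := by
    simpa only [isCircle_rescale_iff hψ] using hq.existsUnique_realCircle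
  harmonic_complexCircle := by
    simpa only [isCircle_rescale_iff hψ, rescale_mul_rescale_eq_iff hψ]
      using hq.harmonic_complexCircle
  harmonic_realCircle := by
    simpa only [isCircle_rescale_iff hψ, rescale_mul_rescale_eq_iff hψ]
      using hq.harmonic_realCircle

open Classical in
/-- The conformal factor that normalizes a gauge at `a`. -/
noncomputable def normFactor (q : X → X → ℝ) (a x : X) : ℝ := if x = a then 1 else (q x a)⁻¹

/-- The gauge `q` normalized at `a`. -/
noncomputable def normAt (q : X → X → ℝ) (a : X) : X → X → ℝ := rescale (normFactor q a) q

lemma normFactor_pos (hq : IsGauge q) (a x : X) : 0 < normFactor q a x := by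
  unfold normFactor
  split_ifs with h
  · exact one_pos
  · exact inv_pos.2 (hq.pos x a h)

lemma normAt_apply (q : X → X → ℝ) {a x y : X} (hx : x ≠ a) (hy : y ≠ a) :
    normAt q a x y = q x y / (q x a * q y a) := by
  simp only [normAt, rescale, normFactor, hx, hy, if_false]
  field_simp

lemma IsIncidenceGauge.normAt (hq : IsIncidenceGauge q) (a : X) : IsAffineGauge (normAt q a) a where
  toIsIncidenceGauge := hq.rescale (normFactor_pos hq.toIsGauge a)
  normalized x hx := by
    simp only [MoebiusGauge.normAt, MoebiusGauge.rescale, normFactor, hx, if_false, if_true,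
      mul_one]
    exact inv_mul_cancel₀ (hq.pos x a hx).ne'

end Rescale

/-! ### The quartic law -/

section QuadraticForms

lemma eq_of_mul_midpoint_le {α β α' β' : ℝ} (hα : 0 < α) (hβ : 0 < β) (hα' : 0 ≤ α')
    (h : α * β ≤ α' * β') (hmid : (α + α') / 2 * ((β + β') / 2) ≤ α * β) : α' = α := by
  have hsum : α * β' + α' * β ≤ 2 * (α * β) := by linarith
  have hprod : (α * β) ^ 2 ≤ (α * β') * (α' * β) := by
    linarith [mul_le_mul_of_nonneg_left h (mul_pos hα hβ).le]
  have hβ' : 0 ≤ β' := by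
    by_contra! hneg
    linarith [mul_pos hα hβ, mul_nonpos_of_nonneg_of_nonpos hα' hneg.le]
  have hsum_sq := pow_le_pow_left₀ (by positivity) hsum 2
  have heq : α * β' = α' * β := by
    refine sub_eq_zero.1 (pow_eq_zero_iff two_ne_zero |>.1 (le_antisymm ?_ (sq_nonneg _)))
    linarith
  rw [heq, ← sq] at hprod
  have hle : α * β ≤ α' * β := le_of_sq_le_sq hprod (by positivity)
  exact mul_right_cancel₀ hβ.ne' (le_antisymm (by linarith) hle)

variable {G : ℝ → ℝ} {α β m ρ : ℝ}

/-- `G` is invariant under the inversion of the line with center `m` and radius `ρ`, up to the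
conformal factor of the inversion; the center corresponds to infinity, where `G t ∼ |t|`. -/
structure IsInversion (G : ℝ → ℝ) (m ρ : ℝ) : Prop where
  radius_ne_zero : ρ ≠ 0
  center : G m = |ρ|
  map : ∀ s t, s * t = ρ ^ 2 → |s| * G (m + t) = |ρ| * G (m + s)

/-- The coefficients `(α, β)` of the quadratic forms `α t ^ 2 + β` below `G ^ 2`. -/
def lowerForms (G : ℝ → ℝ) : Set (ℝ × ℝ) :=
  {z | (0 ≤ z.1 ∧ z.1 ≤ 1 ∧ 0 ≤ z.2) ∧ ∀ t, z.1 * t ^ 2 + z.2 ≤ G t ^ 2}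

lemma isCompact_lowerForms (G : ℝ → ℝ) : IsCompact (lowerForms G) := by
  refine (isCompact_Icc (a := ((0 : ℝ), (0 : ℝ))) (b := (1, G 0 ^ 2))).of_isClosed_subset ?_ ?_
  · refine IsClosed.inter ?_ ?_
    · exact (isClosed_le continuous_const continuous_fst).inter
        ((isClosed_le continuous_fst continuous_const).inter
          (isClosed_le continuous_const continuous_snd))
    · change IsClosed {z : ℝ × ℝ | ∀ t, z.1 * t ^ 2 + z.2 ≤ G t ^ 2}
      simp only [Set.ofPred_forall]
      exact isClosed_iInter fun t => isClosed_le (by fun_prop) continuous_const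
  · rintro z ⟨⟨h0, h1, h2⟩, hle⟩
    exact ⟨⟨h0, h2⟩, h1, by simpa using hle 0⟩

lemma exists_isMaxOn_lowerForms (hG0 : 0 < G 0) (hmin : ∀ t, G 0 ≤ G t) (habs : ∀ t, |t| ≤ G t) :
    ∃ α β, 0 < α ∧ 0 < β ∧ (α, β) ∈ lowerForms G ∧
      IsMaxOn (fun z : ℝ × ℝ => z.1 * z.2) (lowerForms G) (α, β) := by
  have hmem : ((1 / 2 : ℝ), G 0 ^ 2 / 2) ∈ lowerForms G := by
    refine ⟨⟨by norm_num, by norm_num, by positivity⟩, fun t => ?_⟩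
    have ht : t ^ 2 ≤ G t ^ 2 := sq_abs t ▸ pow_le_pow_left₀ (abs_nonneg t) (habs t) 2
    have h0 : G 0 ^ 2 ≤ G t ^ 2 := pow_le_pow_left₀ hG0.le (hmin t) 2
    simp only
    linarith
  obtain ⟨⟨α, β⟩, hαβ, hmax⟩ := (isCompact_lowerForms G).exists_isMaxOn ⟨_, hmem⟩
    (f := fun z : ℝ × ℝ => z.1 * z.2) (by fun_prop)
  have hpos : 0 < α * β :=
    lt_of_lt_of_le (by positivity : 0 < 1 / 2 * (G 0 ^ 2 / 2)) (isMaxOn_iff.1 hmax _ hmem)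
  exact ⟨α, β, pos_of_mul_pos_left hpos hαβ.1.2.2, pos_of_mul_pos_right hpos hαβ.1.1, hαβ, hmax⟩

lemma IsInversion.form_le (h : IsInversion G m ρ) (hα : α ≤ 1)
    (hle : ∀ t, α * t ^ 2 + β ≤ G t ^ 2) (t : ℝ) :
    α * (m * t + (ρ ^ 2 - m ^ 2)) ^ 2 + β * (t - m) ^ 2 ≤ ρ ^ 2 * G t ^ 2 := by
  obtain ⟨s, rfl⟩ : ∃ s, t = m + s := ⟨t - m, by ring⟩
  rcases eq_or_ne s 0 with rfl | hs
  · rw [add_zero, h.center, sq_abs]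
    linarith [mul_le_mul_of_nonneg_right hα (sq_nonneg (ρ ^ 2))]
  have hinv : s * (ρ ^ 2 / s) = ρ ^ 2 := mul_div_cancel₀ _ hs
  have hG : s ^ 2 * G (m + ρ ^ 2 / s) ^ 2 = ρ ^ 2 * G (m + s) ^ 2 := by
    rw [← sq_abs s, ← sq_abs ρ, ← mul_pow, ← mul_pow, ← h.map _ _ hinv, sq_abs]
  have hform := mul_le_mul_of_nonneg_left (hle (m + ρ ^ 2 / s)) (sq_nonneg s)
  rw [hG] at hform
  refine le_trans (le_of_eq ?_) hform
  linear_combination -(α * (2 * m * s + ρ ^ 2 + s * (ρ ^ 2 / s))) * hinv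

/-- A form below `G ^ 2` is transported by the inversion and averaged over `t ↦ -t`. -/
lemma IsInversion.mem_lowerForms (h : IsInversion G m ρ) (heven : ∀ t, G (-t) = G t)
    (hαβ : (α, β) ∈ lowerForms G) :
    ((α * m ^ 2 + β) / ρ ^ 2, (α * (ρ ^ 2 - m ^ 2) ^ 2 + β * m ^ 2) / ρ ^ 2) ∈ lowerForms G := by
  obtain ⟨⟨hα0, hα1, hβ0⟩, hle⟩ := hαβ
  simp only at hα0 hα1 hβ0 hle
  have hρ : 0 < ρ ^ 2 := sq_pos_of_ne_zero h.radius_ne_zero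
  refine ⟨⟨by positivity, ?_, by positivity⟩, fun t => ?_⟩
  · rw [div_le_one hρ, ← sq_abs ρ, ← h.center]
    exact hle m
  · have hform := h.form_le hα1 hle t
    have hform_neg := h.form_le hα1 hle (-t)
    rw [heven] at hform_neg
    simp only
    rw [div_mul_eq_mul_div, ← add_div, div_le_iff₀ hρ]
    linarith

lemma IsInversion.mul_add_eq_zero (h : IsInversion G m ρ) (heven : ∀ t, G (-t) = G t)
    (hα : 0 < α) (hβ : 0 < β) (hαβ : (α, β) ∈ lowerForms G)
    (hmax : IsMaxOn (fun z : ℝ × ℝ => z.1 * z.2) (lowerForms G) (α, β)) :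
    α * (m ^ 2 - ρ ^ 2) + β = 0 := by
  have hρ : 0 < ρ ^ 2 := sq_pos_of_ne_zero h.radius_ne_zero
  have hmem := h.mem_lowerForms heven hαβ
  set α' := (α * m ^ 2 + β) / ρ ^ 2 with hα'
  set β' := (α * (ρ ^ 2 - m ^ 2) ^ 2 + β * m ^ 2) / ρ ^ 2 with hβ'
  have hdet : α' * β' = α * β + (m * (α * (m ^ 2 - ρ ^ 2) + β) / ρ ^ 2) ^ 2 := by
    rw [hα', hβ']
    field_simp [h.radius_ne_zero]
    ring
  have hmid : ((α + α') / 2, (β + β') / 2) ∈ lowerForms G := by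
    obtain ⟨⟨h0, h1, h2⟩, hle⟩ := hmem
    obtain ⟨⟨_, h1', _⟩, hle'⟩ := hαβ
    simp only at h0 h1 h2 hle h1' hle'
    exact ⟨⟨by positivity, by simp only; linarith, by positivity⟩,
      fun t => by simp only; linarith [hle t, hle' t]⟩
  have heq : α' = α := eq_of_mul_midpoint_le hα hβ hmem.1.1
    (hdet ▸ le_add_of_nonneg_right (sq_nonneg _)) (isMaxOn_iff.1 hmax _ hmid)
  rw [hα', div_eq_iff hρ.ne'] at heq
  linear_combination heq

/-- A form of maximal determinant `α * β` below `G ^ 2` is fixed by all inversions, and this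
determines the value of `G` at their centers. -/
lemma sq_eq_of_inversions (hG0 : 0 < G 0) (hmin : ∀ t, G 0 ≤ G t) (habs : ∀ t, |t| ≤ G t)
    (heven : ∀ t, G (-t) = G t) (hinv : ∀ w ≠ 0, ∃ m, IsInversion G m (w - m)) (t : ℝ) :
    G t ^ 2 = t ^ 2 + G 0 ^ 2 := by
  obtain ⟨α, β, hα, hβ, hαβ, hmax⟩ := exists_isMaxOn_lowerForms hG0 hmin habs
  have hK : 0 < β / α := div_pos hβ hα
  have key (t : ℝ) : G t ^ 2 = t ^ 2 + β / α := by
    have hsq := Real.sq_sqrt (add_nonneg (sq_nonneg t) hK.le)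
    have hw : t + √(t ^ 2 + β / α) ≠ 0 := fun h => by
      rw [eq_neg_of_add_eq_zero_right h] at hsq
      linarith [neg_sq t]
    obtain ⟨m, hm⟩ := hinv _ hw
    have hfix := hm.mul_add_eq_zero heven hα hβ hαβ hmax
    obtain rfl : m = t := by
      refine mul_left_cancel₀ (mul_ne_zero hα.ne' hw) ?_
      have : α * (β / α) = β := mul_div_cancel₀ _ hα.ne'
      linear_combination (1 / 2) * hfix + (1 / 2) * this + (α / 2) * hsq
    rw [hm.center, sq_abs, add_sub_cancel_left, hsq]
  have h0 := key 0
  rw [key t, h0]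
  ring

end QuadraticForms

section Quartic

variable {X : Type*} {p : ℝ → ℝ} {q : X → X → ℝ} {ω : X} {r e : ℝ → X}

lemma IsLine.mem_diff_pair (hp : IsProfile p) (hq : IsGauge q) {c : ℝ → X} (hc : IsLine p q ω c)
    {s t : ℝ} (h : s ≠ t) : c s ∈ insert ω (Set.range c) \ {c t, ω} := by
  refine ⟨Or.inr ⟨s, rfl⟩, ?_⟩
  rintro (h' | h')
  · exact h (hc.injective hp hq h')
  · exact hc.ne s h'

lemma IsAffineGauge.dist_neg_realLine (hq : IsAffineGauge q ω) (hr : IsRealLine q ω r)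
    (he : IsComplexLine q ω e) (h0 : r 0 = e 0) (s t : ℝ) : q (e t) (r (-s)) = q (e t) (r s) := by
  rcases eq_or_ne s 0 with rfl | hs
  · rw [neg_zero]
  have h := hq.harmonic_complexCircle _ _ (hq.isCircle hr) (hq.isCircle he)
    (r 0) ⟨Or.inr ⟨0, rfl⟩, Or.inr ⟨0, h0.symm⟩⟩ ω ⟨Or.inl rfl, Or.inl rfl⟩ (hr.ne 0)
    (r s) (hr.mem_diff_pair .id hq.toIsGauge hs)
    (r (-s)) (hr.mem_diff_pair .id hq.toIsGauge (neg_ne_zero.2 hs))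
    (by
      rw [hr.dist, hr.dist, hq.symm ω, hq.normalized _ (hr.ne _), hq.normalized _ (hr.ne _)]
      simp)
    (e t) (Or.inr ⟨t, rfl⟩)
  simp only [hr.dist, sub_neg_eq_add, zero_add, sub_zero] at h
  exact (mul_right_cancel₀ (abs_pos.2 hs).ne' h).symm

lemma IsAffineGauge.dist_neg_complexLine (hq : IsAffineGauge q ω) (hr : IsRealLine q ω r)
    (he : IsComplexLine q ω e) (h0 : r 0 = e 0) (s t : ℝ) : q (r s) (e (-t)) = q (r s) (e t) := by
  rcases eq_or_ne t 0 with rfl | ht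
  · rw [neg_zero]
  have h := hq.harmonic_realCircle _ _ (hq.isCircle hr) (hq.isCircle he)
    (e 0) ⟨Or.inr ⟨0, h0⟩, Or.inr ⟨0, rfl⟩⟩ ω ⟨Or.inl rfl, Or.inl rfl⟩ (he.ne 0)
    (e t) (he.mem_diff_pair .sqrt hq.toIsGauge ht)
    (e (-t)) (he.mem_diff_pair .sqrt hq.toIsGauge (neg_ne_zero.2 ht))
    (by
      rw [he.dist, he.dist, hq.symm ω, hq.normalized _ (he.ne _), hq.normalized _ (he.ne _)]
      simp)
    (r s) (Or.inr ⟨s, rfl⟩)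
  rw [hq.symm ω, hq.normalized _ (he.ne _), hq.normalized _ (he.ne _), mul_one, mul_one] at h
  exact h.symm

lemma IsAffineGauge.eq_zero_of_meet (hq : IsAffineGauge q ω) (hr : IsRealLine q ω r)
    (he : IsComplexLine q ω e) (h0 : r 0 = e 0) {a b : ℝ} (h : r a = e b) : a = 0 ∧ b = 0 := by
  have hdist := hq.dist_neg_realLine hr he h0 a b
  rw [h, hq.self] at hdist
  have ha : a = -a := hr.injective .id hq.toIsGauge (h.trans (hq.eq_of_eq_zero hdist))
  obtain rfl : a = 0 := by linarith
  exact ⟨rfl, (he.injective .sqrt hq.toIsGauge (h0.symm.trans h)).symm⟩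

lemma IsAffineGauge.isInversion_sq_dist (hq : IsAffineGauge q ω) (he : IsComplexLine q ω e)
    {σ : Set X} (hσ : IsRealCircle q σ) {x : X} (hx : x ∈ σ) (hxω : x ≠ ω) {m ρ : ℝ} (hρ : ρ ≠ 0)
    (hmem : e (m + ρ) ∈ σ) (hmem' : e (m - ρ) ∈ σ) :
    IsInversion (fun t => q x (e t) ^ 2) m ρ := by
  have hinj := he.injective .sqrt hq.toIsGauge
  have hharm := hq.harmonic_realCircle σ _ hσ (hq.isCircle he) (e (m - ρ)) ⟨hmem', Or.inr ⟨_, rfl⟩⟩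
    (e (m + ρ)) ⟨hmem, Or.inr ⟨_, rfl⟩⟩ fun h => hρ (by linarith [hinj h])
  have hmem_diff {s : ℝ} (h1 : s ≠ -ρ) (h2 : s ≠ ρ) :
      e (m + s) ∈ insert ω (Set.range e) \ {e (m - ρ), e (m + ρ)} :=
    ⟨Or.inr ⟨_, rfl⟩, not_or.2 ⟨fun h => h1 (by linarith [hinj h]),
      fun h => h2 (by linarith [hinj h])⟩⟩
  refine ⟨hρ, ?_, fun s t hst => ?_⟩
  · have h := hharm ω ⟨Or.inl rfl, not_or.2 ⟨(he.ne _).symm, (he.ne _).symm⟩⟩ (e (m + 0))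
      (hmem_diff (neg_ne_zero.2 hρ).symm hρ.symm)
      (by simp [hq.normalized _ (he.ne _), he.dist, hq.symm ω]) x hx
    simp only [add_zero, he.dist, hq.normalized _ hxω, hq.symm ω, hq.normalized _ (he.ne _),
      add_sub_cancel_left, one_mul, mul_one] at h
    rw [← h, Real.sq_sqrt (abs_nonneg _)]
  · rcases eq_or_ne s ρ with rfl | hsρ
    · rw [mul_left_cancel₀ hρ (hst.trans (sq s))]
    rcases eq_or_ne s (-ρ) with rfl | hsρ'
    · rw [mul_left_cancel₀ (neg_ne_zero.2 hρ) (hst.trans (neg_mul_neg ρ ρ ▸ sq ρ)), abs_neg]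
    have h := hharm (e (m + s)) (hmem_diff hsρ' hsρ) (e (m + t))
      (hmem_diff (by rintro rfl; exact hsρ' (mul_right_cancel₀ (neg_ne_zero.2 hρ) (by linarith)))
        (by rintro rfl; exact hsρ (mul_right_cancel₀ hρ (by linarith)))) (by
          simp only [he.dist, ← Real.sqrt_mul (abs_nonneg _), ← abs_mul]
          congr 1
          rw [abs_eq_abs]
          left
          linear_combination 2 * hst) x hx
    have hsq := congrArg (· ^ 2) h
    simp only [he.dist, mul_pow, Real.sq_sqrt (abs_nonneg _), add_sub_add_left_eq_sub] at hsq
    have habs : |s| * |ρ - t| = |ρ| * |s - ρ| := by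
      rw [← abs_mul, ← abs_mul, abs_eq_abs]
      left
      linear_combination -hst
    refine mul_right_cancel₀ (abs_pos.2 (sub_ne_zero.2 hsρ)).ne' ?_
    linear_combination q x (e (m + s)) ^ 2 * habs - |s| * hsq

lemma IsAffineGauge.exists_isInversion (hq : IsAffineGauge q ω) (hr : IsRealLine q ω r)
    (he : IsComplexLine q ω e) (h0 : r 0 = e 0) {s : ℝ} (hs : s ≠ 0) {w : ℝ} (hw : w ≠ 0) :
    ∃ m, IsInversion (fun t => q (r s) (e t) ^ 2) m (w - m) := by
  have hF := hq.isCircle he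
  have hsF : r s ∉ insert ω (Set.range e) := by
    rintro (h | ⟨t, h⟩)
    · exact hr.ne _ h
    · exact hs (hq.eq_zero_of_meet hr he h0 h.symm).1
  obtain ⟨σ, ⟨hσ, hwσ, hsσ, z, hzσ, hzF, hzw⟩, -⟩ :=
    hq.existsUnique_realCircle _ hF (e w) (Or.inr ⟨w, rfl⟩) (r s) hsF
  rcases hzF with rfl | ⟨η, rfl⟩
  · have hσr : σ = insert z (Set.range r) :=
      (hq.existsUnique_realCircle _ hF z (Or.inl rfl) (r s) hsF).unique
        ⟨hσ, hzσ, hsσ, e w, hwσ, Or.inr ⟨w, rfl⟩, he.ne w⟩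
        ⟨hq.isCircle hr, Or.inl rfl, Or.inr ⟨s, rfl⟩, r 0, Or.inr ⟨0, rfl⟩,
          Or.inr ⟨0, h0.symm⟩, hr.ne 0⟩
    rw [hσr] at hwσ
    rcases hwσ with h | ⟨a, h⟩
    · exact absurd h (he.ne w)
    · exact absurd (hq.eq_zero_of_meet hr he h0 h).2 hw
  · have hη : w ≠ η := by rintro rfl; exact hzw rfl
    refine ⟨(w + η) / 2,
      hq.isInversion_sq_dist he hσ hsσ (hr.ne s) (fun h => hη (by linarith)) ?_ ?_⟩
    · rwa [add_sub_cancel]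
    · rwa [show (w + η) / 2 - (w - (w + η) / 2) = η by ring]

lemma sqrt_abs_pow_four (t : ℝ) : √|t| ^ 4 = t ^ 2 := by
  rw [pow_mul (√|t|) 2 2, Real.sq_sqrt (abs_nonneg t), sq_abs]

lemma IsAffineGauge.abs_le_dist (hq : IsAffineGauge q ω) (hr : IsRealLine q ω r)
    (he : IsComplexLine q ω e) (h0 : r 0 = e 0) (s t : ℝ) : |s| ≤ q (r s) (e t) := by
  have h := hq.triangle hq.normalized (hr.ne s) (he.ne t) (hr.ne (-s))
  rw [hr.dist, hq.dist_neg_realLine hr he h0, hq.symm (e t), sub_neg_eq_add, ← two_mul, abs_mul,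
    abs_two] at h
  linarith

lemma IsAffineGauge.sqrt_abs_le_dist (hq : IsAffineGauge q ω) (hr : IsRealLine q ω r)
    (he : IsComplexLine q ω e) (h0 : r 0 = e 0) {s : ℝ} (hs : s ≠ 0) (t : ℝ) :
    √|t| ≤ q (r s) (e t) := by
  have h := hq.ptolemy (e t) (r s) (e 0) (r (-s))
  rw [hq.dist_neg_realLine hr he h0 s t, ← h0, hr.dist, hr.dist, hr.dist, h0, he.dist,
    hq.symm (e t)] at h
  simp only [sub_zero, zero_add, sub_neg_eq_add, ← two_mul, abs_mul, abs_two] at h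
  exact le_of_mul_le_mul_right (by linarith) (abs_pos.2 hs)

lemma IsAffineGauge.dist_pow_four (hq : IsAffineGauge q ω) (hr : IsRealLine q ω r)
    (he : IsComplexLine q ω e) (h0 : r 0 = e 0) (s t : ℝ) : q (r s) (e t) ^ 4 = s ^ 4 + t ^ 2 := by
  rcases eq_or_ne s 0 with rfl | hs
  · rw [h0, he.dist, sqrt_abs_pow_four]
    ring
  have hG0 : q (r s) (e 0) ^ 2 = s ^ 2 := by rw [← h0, hr.dist, sub_zero, sq_abs]
  have key := sq_eq_of_inversions (G := fun t => q (r s) (e t) ^ 2) (hG0 ▸ sq_pos_of_ne_zero hs)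
    (fun t => by
      simpa only [hG0, sq_abs] using
        pow_le_pow_left₀ (abs_nonneg s) (hq.abs_le_dist hr he h0 s t) 2)
    (fun t => by
      simpa only [Real.sq_sqrt (abs_nonneg t)] using
        pow_le_pow_left₀ (Real.sqrt_nonneg _) (hq.sqrt_abs_le_dist hr he h0 hs t) 2)
    (fun t => by simp only [hq.dist_neg_complexLine hr he h0])
    (fun w hw => hq.exists_isInversion hr he h0 hs hw) t
  simp only [hG0] at key
  linear_combination key

end Quartic

/-! ### Fibers and vertical shifts -/

section Fibers

variable {X : Type*} {q : X → X → ℝ} {ω : X} {e e' : ℝ → X}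

lemma pow_four_inj {a b : ℝ} (ha : 0 ≤ a) (hb : 0 ≤ b) (h : a ^ 4 = b ^ 4) : a = b :=
  (pow_left_inj₀ ha hb four_ne_zero).1 h

lemma IsAffineGauge.exists_complexLine (hq : IsAffineGauge q ω) {x : X} (hx : x ≠ ω) :
    ∃ e, IsComplexLine q ω e ∧ e 0 = x := by
  obtain ⟨F, ⟨hF, hxF, hωF⟩, -⟩ := hq.existsUnique_complexCircle x ω hx
  obtain ⟨e, he, h0, -⟩ := hF.exists_line .sqrt hq.toIsGauge hq.normalized hωF hxF hx
  exact ⟨e, he, h0⟩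

lemma IsAffineGauge.range_complexLine_eq (hq : IsAffineGauge q ω) (he : IsComplexLine q ω e)
    (he' : IsComplexLine q ω e') {s t : ℝ} (h : e s = e' t) : Set.range e = Set.range e' := by
  have hF := (hq.existsUnique_complexCircle (e s) ω (he.ne s)).unique
    ⟨hq.isCircle he, Or.inr ⟨s, rfl⟩, Or.inl rfl⟩ ⟨hq.isCircle he', Or.inr ⟨t, h.symm⟩, Or.inl rfl⟩
  rw [he.range_eq_diff, hF, ← he'.range_eq_diff]

lemma IsAffineGauge.exists_realLine_foot (hq : IsAffineGauge q ω) (he : IsComplexLine q ω e)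
    {u : X} (hu : u ≠ ω) (hue : u ∉ Set.range e) :
    ∃ r t s, IsRealLine q ω r ∧ r 0 = e t ∧ r s = u := by
  obtain ⟨σ, ⟨hσ, hωσ, huσ, z, hzσ, hzF, hzω⟩, -⟩ :=
    hq.existsUnique_realCircle _ (hq.isCircle he) ω (Or.inl rfl) u (not_or.2 ⟨hu, hue⟩)
  obtain ⟨t, rfl⟩ := hzF.resolve_left hzω
  obtain ⟨r, hr, h0, hrσ⟩ := hσ.exists_line .id hq.toIsGauge hq.normalized hωσ hzσ hzω
  obtain ⟨s, hs⟩ : u ∈ Set.range r := hrσ ▸ ⟨huσ, hu⟩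
  exact ⟨r, t, s, hr, h0, hs⟩

lemma IsAffineGauge.exists_foot (hq : IsAffineGauge q ω) (he : IsComplexLine q ω e)
    (he' : IsComplexLine q ω e') (s : ℝ) :
    ∃ ρ τ, 0 ≤ ρ ∧ (∀ t, q (e' s) (e t) ^ 4 = ρ ^ 4 + (t - τ) ^ 2) ∧
      ∀ s', q (e' s') (e τ) ^ 4 = ρ ^ 4 + (s' - s) ^ 2 := by
  by_cases hue : e' s ∈ Set.range e
  · obtain ⟨τ, hτ⟩ := hue
    refine ⟨0, τ, le_rfl, fun t => ?_, fun s' => ?_⟩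
    · rw [← hτ, he.dist, sqrt_abs_pow_four]; ring
    · rw [hτ, he'.dist, sqrt_abs_pow_four]; ring
  · obtain ⟨r, τ, a, hr, h0, ha⟩ := hq.exists_realLine_foot he (he'.ne s) hue
    have habs : |a| ^ 4 = a ^ 4 := Even.pow_abs ⟨2, rfl⟩ a
    refine ⟨|a|, τ, abs_nonneg _, fun t => ?_, fun s' => ?_⟩
    · have h := hq.dist_pow_four hr (he.shift τ) (by rw [h0, add_zero]) a (t - τ)
      rw [habs, ← h, ha, add_sub_cancel]
    · have h := hq.dist_pow_four (hr.shift a) (he'.shift s) (by rw [add_zero, add_zero, ha]) (-a)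
        (s' - s)
      rw [add_neg_cancel, h0, add_sub_cancel, Even.neg_pow ⟨2, rfl⟩] at h
      rw [habs, ← h, hq.symm]

lemma IsAffineGauge.fiber_dist (hq : IsAffineGauge q ω) (he : IsComplexLine q ω e)
    (he' : IsComplexLine q ω e') : ∃ D n, 0 ≤ D ∧
      ((∀ s t, q (e' s) (e t) ^ 4 = D ^ 4 + (t - s - n) ^ 2) ∨
        ∀ s t, q (e' s) (e t) ^ 4 = D ^ 4 + (t + s - n) ^ 2) := by
  choose ρ τ hρ hdist hfoot using hq.exists_foot he he'
  have hcompare (a b : ℝ) : ρ a ^ 4 + (τ b - τ a) ^ 2 = ρ b ^ 4 + (a - b) ^ 2 := by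
    rw [← hdist, hfoot]
  have hconst (s : ℝ) : ρ s ^ 4 = ρ 0 ^ 4 := by
    linarith [hcompare s 0, hcompare 0 s, sub_sq_comm s 0, sub_sq_comm (τ s) (τ 0)]
  have hiso : Isometry τ := Isometry.of_dist_eq fun s t => by
    rw [Real.dist_eq, Real.dist_eq, ← sq_eq_sq_iff_abs_eq_abs]
    linarith [hcompare s t, hconst s, hconst t, sub_sq_comm (τ s) (τ t)]
  refine ⟨ρ 0, τ 0, hρ 0, (eq_add_or_eq_sub_of_isometry hiso).imp ?_ ?_⟩
  all_goals
    intro h s t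
    rw [hdist, hconst, h]
    ring

/-- The `ℂ`-lines `e` and `e'` are oriented in the same way: the distance of `e' s` and `e t`
depends on `t - s` only. -/
def CoOriented (q : X → X → ℝ) (e e' : ℝ → X) : Prop :=
  ∃ D n, 0 ≤ D ∧ ∀ s t, q (e' s) (e t) ^ 4 = D ^ 4 + (t - s - n) ^ 2

lemma IsLine.coOriented_self (he : IsComplexLine q ω e) : CoOriented q e e :=
  ⟨0, 0, le_rfl, fun s t => by rw [he.dist, sqrt_abs_pow_four]; ring⟩

lemma IsAffineGauge.exists_coOriented (hq : IsAffineGauge q ω) (he : IsComplexLine q ω e) {x : X}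
    (hx : x ≠ ω) : ∃ e', IsComplexLine q ω e' ∧ e' 0 = x ∧ CoOriented q e e' := by
  obtain ⟨e', he', h0⟩ := hq.exists_complexLine hx
  obtain ⟨D, n, hD, h | h⟩ := hq.fiber_dist he he'
  · exact ⟨e', he', h0, D, n, hD, h⟩
  · exact ⟨_, he'.neg, by rwa [neg_zero], D, n, hD, fun s t => by rw [h]; ring⟩

lemma exists_lt_sq_add (M c : ℝ) : ∃ s : ℝ, M < (2 * s + c) ^ 2 := by
  refine ⟨(|M| + 1 - c) / 2, ?_⟩
  rw [mul_div_cancel₀ _ two_ne_zero, sub_add_cancel]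
  linarith [sq_nonneg |M|, le_abs_self M, abs_nonneg M, add_sq |M| 1]

lemma CoOriented.trans (hq : IsAffineGauge q ω) {e₀ e₁ e₂ : ℝ → X} (he₀ : IsComplexLine q ω e₀)
    (he₁ : IsComplexLine q ω e₁) (he₂ : IsComplexLine q ω e₂) (h₁ : CoOriented q e₀ e₁)
    (h₂ : CoOriented q e₀ e₂) : CoOriented q e₁ e₂ := by
  obtain ⟨D, n, hD, h | h⟩ := hq.fiber_dist he₁ he₂
  · exact ⟨D, n, hD, h⟩
  exfalso
  obtain ⟨D₁, n₁, hD₁, h₁⟩ := h₁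
  obtain ⟨D₂, n₂, hD₂, h₂⟩ := h₂
  obtain ⟨s, hs⟩ := exists_lt_sq_add ((D₂ + D₁) ^ 4) (n₂ - n₁ - n)
  have hdist₁ : q (e₁ (s + n₂ - n₁)) (e₀ (s + n₂)) = D₁ :=
    pow_four_inj (hq.nonneg _ _) hD₁ (by rw [h₁]; ring)
  have hdist₂ : q (e₂ s) (e₀ (s + n₂)) = D₂ :=
    pow_four_inj (hq.nonneg _ _) hD₂ (by rw [h₂]; ring)
  have hle : q (e₂ s) (e₁ (s + n₂ - n₁)) ≤ D₂ + D₁ := by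
    have := hq.triangle hq.normalized (he₂.ne s) (he₀.ne (s + n₂)) (he₁.ne (s + n₂ - n₁))
    rwa [hdist₂, hq.symm (e₀ _), hdist₁] at this
  have hle4 := pow_le_pow_left₀ (hq.nonneg _ _) hle 4
  rw [h, show s + n₂ - n₁ + s - n = 2 * s + (n₂ - n₁ - n) by ring] at hle4
  linarith [pow_nonneg hD 4]

lemma CoOriented.eq_shift (hq : IsAffineGauge q ω) {e₀ c c' : ℝ → X} (hc : IsComplexLine q ω c)
    (hc' : IsComplexLine q ω c') (h : CoOriented q e₀ c) (h' : CoOriented q e₀ c') {s : ℝ}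
    (h0 : c' 0 = c s) : ∀ t, c' t = c (s + t) := by
  have hr : Set.range c' ⊆ Set.range fun t => c (s + t) := by
    rw [range_shift]
    exact (hq.range_complexLine_eq hc' hc h0).subset
  refine ((hc.shift s).eq_or_eq_neg .sqrt hq.toIsGauge hc' (by rwa [add_zero]) hr).resolve_right
    fun hneg => ?_
  obtain ⟨D, n, hD, h⟩ := h
  obtain ⟨D', n', -, h'⟩ := h'
  obtain ⟨t, ht⟩ := exists_lt_sq_add (D' ^ 4) (n' - s - n)
  have hdist := h' t (t + n')
  rw [hneg, h, show t + n' - (s + -t) - n = 2 * t + (n' - s - n) by ring,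
    show t + n' - t - n' = 0 by ring] at hdist
  linarith [pow_nonneg hD 4]

/-- A one-parameter group of vertical shifts of `X \ {ω}`, extended by `ω ↦ ω`: its orbits are the
`ℂ`-lines with consistent orientations. -/
structure IsShiftGroup (q : X → X → ℝ) (ω : X) (T : ℝ → X → X) : Prop where
  map_omega : ∀ a, T a ω = ω
  zero : ∀ x, T 0 x = x
  add : ∀ a b x, T (a + b) x = T a (T b x)
  complexLine : ∀ x, x ≠ ω → IsComplexLine q ω fun a => T a x
  dist : ∀ x y, x ≠ ω → y ≠ ω → ∃ D h, ∀ a b, q (T a x) (T b y) ^ 4 = D ^ 4 + (h + b - a) ^ 2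

open Classical in
lemma IsAffineGauge.exists_isShiftGroup (hq : IsAffineGauge q ω) {e₀ : ℝ → X}
    (he₀ : IsComplexLine q ω e₀) : ∃ T, IsShiftGroup q ω T ∧ ∀ a t, T a (e₀ t) = e₀ (t + a) := by
  choose! E hE hE0 hEo using fun x (hx : x ≠ ω) => hq.exists_coOriented he₀ hx
  let T a x := if x = ω then ω else E x a
  have hTω (a : ℝ) : T a ω = ω := if_pos rfl
  have hT {x : X} (hx : x ≠ ω) (a : ℝ) : T a x = E x a := if_neg hx
  refine ⟨T, ⟨hTω, fun x => ?_, fun a b x => ?_, fun x hx => ?_, fun x y hx hy => ?_⟩,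
    fun a t => ?_⟩
  · rcases eq_or_ne x ω with rfl | hx
    · exact hTω 0
    · rw [hT hx, hE0 x hx]
  · rcases eq_or_ne x ω with rfl | hx
    · simp only [hTω]
    · have hne := (hE x hx).ne b
      rw [hT hx, hT hx, hT hne, CoOriented.eq_shift hq (hE x hx) (hE _ hne) (hEo x hx) (hEo _ hne)
        (hE0 _ hne), add_comm]
  · simpa only [hT hx] using hE x hx
  · obtain ⟨D, n, -, h⟩ := CoOriented.trans hq he₀ (hE y hy) (hE x hx) (hEo y hy) (hEo x hx)
    refine ⟨D, -n, fun a b => ?_⟩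
    rw [hT hx, hT hy, h]
    ring
  · have hne := he₀.ne t
    rw [hT hne]
    exact CoOriented.eq_shift hq he₀ (hE _ hne) he₀.coOriented_self (hEo _ hne) (hE0 _ hne) a

namespace IsShiftGroup

variable {T : ℝ → X → X}

lemma ne (hT : IsShiftGroup q ω T) {x : X} (hx : x ≠ ω) (a : ℝ) : T a x ≠ ω :=
  (hT.complexLine x hx).ne a

lemma neg_apply (hT : IsShiftGroup q ω T) (a : ℝ) (x : X) : T (-a) (T a x) = x := by
  rw [← hT.add, neg_add_cancel, hT.zero]

lemma apply_neg (hT : IsShiftGroup q ω T) (a : ℝ) (x : X) : T a (T (-a) x) = x := by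
  rw [← hT.add, add_neg_cancel, hT.zero]

lemma isometry (hT : IsShiftGroup q ω T) (hq : IsAffineGauge q ω) (a : ℝ) (x y : X) :
    q (T a x) (T a y) = q x y := by
  rcases eq_or_ne y ω with rfl | hy
  · rcases eq_or_ne x y with rfl | hx
    · rw [hq.self, hq.self]
    · rw [hT.map_omega, hq.normalized _ (hT.ne hx a), hq.normalized _ hx]
  rcases eq_or_ne x ω with rfl | hx
  · rw [hT.map_omega, hq.symm, hq.normalized _ (hT.ne hy a), hq.symm, hq.normalized _ hy]
  obtain ⟨D, h, hd⟩ := hT.dist x y hx hy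
  have hd0 := hd 0 0
  rw [hT.zero, hT.zero] at hd0
  exact pow_four_inj (hq.nonneg _ _) (hq.nonneg _ _) (by rw [hd, hd0]; ring)

lemma dist_left (hT : IsShiftGroup q ω T) {x y : X} (hx : x ≠ ω) (hy : y ≠ ω) :
    ∃ D h, ∀ b, q x (T b y) ^ 4 = D ^ 4 + (h + b) ^ 2 := by
  obtain ⟨D, h, hd⟩ := hT.dist x y hx hy
  refine ⟨D, h, fun b => ?_⟩
  have := hd 0 b
  rwa [hT.zero, sub_zero] at this

lemma dist_realLine (hT : IsShiftGroup q ω T) (hq : IsAffineGauge q ω) {r : ℝ → X}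
    (hr : IsRealLine q ω r) (s s' a : ℝ) :
    q (r s) (T a (r s')) ^ 4 = (s - s') ^ 4 + a ^ 2 := by
  have h := hq.dist_pow_four (hr.shift s') (hT.complexLine (r s') (hr.ne s'))
    (by rw [add_zero, hT.zero]) (s - s') a
  rwa [add_sub_cancel] at h

end IsShiftGroup

end Fibers

/-! ### Shifts along a `ℂ`-circle -/

section Frame

variable {X : Type*} {q : X → X → ℝ} {ω : X}

lemma IsGauge.normAt_pow_four_mul (hq : IsGauge q) {a x y : X} (hx : x ≠ a) (hy : y ≠ a) :
    normAt q a x y ^ 4 * (q x a ^ 4 * q y a ^ 4) = q x y ^ 4 := by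
  have hxa := (hq.pos x a hx).ne'
  have hya := (hq.pos y a hy).ne'
  rw [normAt_apply q hx hy]
  field_simp

/-- A parametrized `ℂ`-line `e` of an affine gauge with the shifts `n` along it that fix `ω`, and
the shifts `m` that fix `e 0`. In the parameter of `e` these are the translations `t ↦ t + a` and
the maps `t ↦ t / (1 + b t)`, which generate the projective group. -/
structure IsFrame (q : X → X → ℝ) (ω : X) (e : ℝ → X) (n m : ℝ → X → X) : Prop where
  gauge : IsAffineGauge q ω
  complexLine : IsComplexLine q ω e
  shift_n : IsShiftGroup q ω n
  shift_m : IsShiftGroup (normAt q (e 0)) (e 0) m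
  n_apply : ∀ a t, n a (e t) = e (t + a)
  m_apply : ∀ b t, 1 + b * t ≠ 0 → m b (e t) = e (t / (1 + b * t))
  m_pole : ∀ b t, 1 + b * t = 0 → m b (e t) = ω
  m_omega : ∀ b, b ≠ 0 → m b ω = e b⁻¹

/-- The line `e` with the parameter `t ↦ 1 / t`, where `ω` takes the place of `e 0`. -/
noncomputable def invLine (ω : X) (e : ℝ → X) (t : ℝ) : X := if t = 0 then ω else e t⁻¹

lemma invLine_zero (e : ℝ → X) : invLine ω e 0 = ω := if_pos rfl

lemma invLine_of_ne_zero (e : ℝ → X) {t : ℝ} (ht : t ≠ 0) : invLine ω e t = e t⁻¹ := if_neg ht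

lemma IsAffineGauge.isComplexLine_invLine (hq : IsAffineGauge q ω) {e : ℝ → X}
    (he : IsComplexLine q ω e) :
    IsComplexLine (MoebiusGauge.normAt q (e 0)) (e 0) (invLine ω e) := by
  have hω (t : ℝ) : q ω (e t) = 1 := by rw [hq.symm, hq.normalized _ (he.ne t)]
  have hcenter (t : ℝ) : q (e t⁻¹) (e 0) = (√|t|)⁻¹ := by
    rw [he.dist, sub_zero, abs_inv, Real.sqrt_inv]
  have hne (t : ℝ) : invLine ω e t ≠ e 0 := by
    rcases eq_or_ne t 0 with rfl | ht
    · rw [invLine_zero]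
      exact (he.ne 0).symm
    · rw [invLine_of_ne_zero e ht]
      exact fun h => inv_ne_zero ht (he.injective .sqrt hq.toIsGauge h)
  refine ⟨hne, fun s t => ?_⟩
  rw [normAt_apply q (hne s) (hne t)]
  rcases eq_or_ne s 0 with rfl | hs <;> rcases eq_or_ne t 0 with rfl | ht
  · rw [hq.self, zero_div, sub_self, abs_zero, Real.sqrt_zero]
  · rw [invLine_zero, invLine_of_ne_zero e ht, hω, hω, hcenter, zero_sub, abs_neg, one_mul, one_div,
      inv_inv]
  · rw [invLine_zero, invLine_of_ne_zero e hs, hq.symm, hω, hω, hcenter, sub_zero, mul_one, one_div,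
      inv_inv]
  · rw [invLine_of_ne_zero e hs, invLine_of_ne_zero e ht, hcenter, hcenter, he.dist, ← mul_inv,
      div_inv_eq_mul, ← Real.sqrt_mul (abs_nonneg _), ← Real.sqrt_mul (abs_nonneg _), ← abs_mul,
      ← abs_mul, abs_sub_comm s t]
    congr 2
    field_simp

lemma IsAffineGauge.exists_isFrame (hq : IsAffineGauge q ω) {e : ℝ → X}
    (he : IsComplexLine q ω e) : ∃ n m, IsFrame q ω e n m := by
  obtain ⟨n, hn, hn_apply⟩ := hq.exists_isShiftGroup he
  obtain ⟨m, hm, hm_apply⟩ :=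
    (hq.toIsIncidenceGauge.normAt (e 0)).exists_isShiftGroup (hq.isComplexLine_invLine he)
  refine ⟨n, m, hq, he, hn, hm, hn_apply, fun b t h => ?_, fun b t h => ?_, fun b hb => ?_⟩
  · rcases eq_or_ne t 0 with rfl | ht
    · rw [zero_div]
      exact hm.map_omega b
    · have hinv : t⁻¹ + b = ((t / (1 + b * t)))⁻¹ := by field_simp
      have hmt := hm_apply b t⁻¹
      rwa [hinv, invLine_of_ne_zero e (inv_ne_zero ht), inv_inv,
        invLine_of_ne_zero e (inv_ne_zero (div_ne_zero ht h)), inv_inv] at hmt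
  · have ht : t ≠ 0 := by
      rintro rfl
      rw [mul_zero, add_zero] at h
      exact one_ne_zero h
    have hpole : t⁻¹ + b = 0 := by
      field_simp
      linarith
    have hmt := hm_apply b t⁻¹
    rwa [hpole, invLine_zero, invLine_of_ne_zero e (inv_ne_zero ht), inv_inv] at hmt
  · have hm0 := hm_apply b 0
    rwa [invLine_zero, zero_add, invLine_of_ne_zero e hb] at hm0

/-- The `ℂ`-circle of a frame. -/
def frameCircle (ω : X) (e : ℝ → X) : Set X := insert ω (Set.range e)

/-- The squared modulus of `1 + b (a + i s²)`: this is the conformal factor by which the shift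
`m b` changes the fourth power of the distance to `e 0` (see `IsFrame.dist_mn_center`). -/
def modSq (b a s : ℝ) : ℝ := (1 + a * b) ^ 2 + b ^ 2 * s ^ 4

lemma modSq_pos (b a : ℝ) {s : ℝ} (hs : s ≠ 0) : 0 < modSq b a s := by
  unfold modSq
  rcases eq_or_ne b 0 with rfl | hb
  · norm_num
  · positivity

/-- The fourth power of the distance of `x'` and `n c (m b (n a x))`, multiplied by the conformal
factor of `m b` when `x` has the parameter `s` on an `ℝ`-line through `e 0`. -/
def wordDist (q : X → X → ℝ) (n m : ℝ → X → X) (x' x : X) (s : ℝ) (c b a : ℝ) : ℝ :=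
  q x' (n c (m b (n a x))) ^ 4 * modSq b a s

variable {e : ℝ → X} {n m : ℝ → X → X}

lemma ne_omega_of_notMem {x : X} (hx : x ∉ frameCircle ω e) : x ≠ ω := fun h => hx (Or.inl h)

lemma ne_center_of_notMem {x : X} (hx : x ∉ frameCircle ω e) : x ≠ e 0 :=
  fun h => hx (Or.inr ⟨0, h.symm⟩)

namespace IsFrame

lemma isConformalMap_n (hf : IsFrame q ω e n m) (a : ℝ) : IsConformalMap q q (n a) :=
  ⟨fun _ => 1, fun _ => one_pos, fun x y => by
    rw [hf.shift_n.isometry hf.gauge, one_mul, one_mul]⟩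

lemma gauge_normAt (hf : IsFrame q ω e n m) : IsAffineGauge (normAt q (e 0)) (e 0) :=
  hf.gauge.toIsIncidenceGauge.normAt (e 0)

lemma isConformalMap_m (hf : IsFrame q ω e n m) (b : ℝ) : IsConformalMap q q (m b) :=
  isConformalMap_of_rescale (normFactor_pos hf.gauge.toIsGauge _)
    (hf.shift_m.isometry hf.gauge_normAt b)

lemma n_mem (hf : IsFrame q ω e n m) {x : X} (a : ℝ) (hx : x ∈ frameCircle ω e) :
    n a x ∈ frameCircle ω e := by
  rcases hx with rfl | ⟨t, rfl⟩
  · exact Or.inl (hf.shift_n.map_omega a)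
  · exact Or.inr ⟨t + a, (hf.n_apply a t).symm⟩

lemma m_mem (hf : IsFrame q ω e n m) {x : X} (b : ℝ) (hx : x ∈ frameCircle ω e) :
    m b x ∈ frameCircle ω e := by
  rcases hx with rfl | ⟨t, rfl⟩
  · rcases eq_or_ne b 0 with rfl | hb
    · exact Or.inl (hf.shift_m.zero x)
    · exact Or.inr ⟨b⁻¹, (hf.m_omega b hb).symm⟩
  · rcases eq_or_ne (1 + b * t) 0 with h | h
    · exact Or.inl (hf.m_pole b t h)
    · exact Or.inr ⟨_, (hf.m_apply b t h).symm⟩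

lemma n_notMem (hf : IsFrame q ω e n m) {x : X} (a : ℝ) (hx : x ∉ frameCircle ω e) :
    n a x ∉ frameCircle ω e :=
  fun h => hx (hf.shift_n.neg_apply a x ▸ hf.n_mem (-a) h)

lemma m_notMem (hf : IsFrame q ω e n m) {x : X} (b : ℝ) (hx : x ∉ frameCircle ω e) :
    m b x ∉ frameCircle ω e :=
  fun h => hx (hf.shift_m.neg_apply b x ▸ hf.m_mem (-b) h)

variable {r : ℝ → X} {s s' : ℝ}

lemma realLine_notMem (hf : IsFrame q ω e n m) (hr : IsRealLine q ω r) (h0 : r 0 = e 0)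
    (hs : s ≠ 0) : r s ∉ frameCircle ω e := by
  rintro (h | ⟨t, h⟩)
  · exact hr.ne s h
  · exact hs (hf.gauge.eq_zero_of_meet hr hf.complexLine h0 h.symm).1

lemma dist_n (hf : IsFrame q ω e n m) (hr : IsRealLine q ω r) (h0 : r 0 = e 0) (a s t : ℝ) :
    q (n a (r s)) (e t) ^ 4 = s ^ 4 + (t - a) ^ 2 := by
  have h := hf.n_apply a (t - a)
  rw [sub_add_cancel] at h
  rw [← h, hf.shift_n.isometry hf.gauge, hf.gauge.dist_pow_four hr hf.complexLine h0]

lemma dist_n_center (hf : IsFrame q ω e n m) (hr : IsRealLine q ω r) (h0 : r 0 = e 0) (a s : ℝ) :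
    q (n a (r s)) (e 0) ^ 4 = s ^ 4 + a ^ 2 := by
  rw [hf.dist_n hr h0, zero_sub, neg_sq]

lemma dist_mn_center (hf : IsFrame q ω e n m) (hr : IsRealLine q ω r) (h0 : r 0 = e 0) (b a : ℝ)
    (hs : s ≠ 0) : q (m b (n a (r s))) (e 0) ^ 4 * modSq b a s = s ^ 4 + a ^ 2 := by
  have hq := hf.gauge
  have hy := hf.n_notMem a (hf.realLine_notMem hr h0 hs)
  have hz := hf.m_notMem b hy
  have hy_center := hf.dist_n_center hr h0 a s
  rcases eq_or_ne b 0 with rfl | hb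
  · rw [hf.shift_m.zero, hy_center, modSq]; ring
  have hpole : e (-b)⁻¹ ≠ e 0 := fun h =>
    inv_ne_zero (neg_ne_zero.2 hb) (hf.complexLine.injective .sqrt hq.toIsGauge h)
  have hz_omega := hq.normAt_pow_four_mul (ne_center_of_notMem hz) (hf.complexLine.ne 0).symm
  have hy_pole := hq.normAt_pow_four_mul (ne_center_of_notMem hy) hpole
  rw [← hf.shift_m.isometry hf.gauge_normAt (-b), hf.shift_m.neg_apply,
    hf.m_omega _ (neg_ne_zero.2 hb), hq.normalized _ (ne_omega_of_notMem hz), hq.symm ω,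
    hq.normalized _ (hf.complexLine.ne 0), one_pow, mul_one] at hz_omega
  rw [hy_center, hf.dist_n hr h0, hf.complexLine.dist, sqrt_abs_pow_four, sub_zero] at hy_pole
  have hmod : modSq b a s = b ^ 2 * (s ^ 4 + ((-b)⁻¹ - a) ^ 2) := by
    unfold modSq
    field_simp
    ring
  have hb_inv : b ^ 2 * (-b)⁻¹ ^ 2 = 1 := by field_simp
  rw [hmod, ← hy_pole]
  linear_combination (s ^ 4 + a ^ 2) * hz_omega +
    (s ^ 4 + a ^ 2) * q (m b (n a (r s))) (e 0) ^ 4 * normAt q (e 0) (n a (r s)) (e (-b)⁻¹) ^ 4 *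
      hb_inv

lemma wordDist_quadratic_c (hf : IsFrame q ω e n m) (hr : IsRealLine q ω r) (h0 : r 0 = e 0)
    (hs : s ≠ 0) (s' b a : ℝ) :
    ∃ E h, ∀ c, wordDist q n m (r s') (r s) s c b a = (E + (h + c) ^ 2) * modSq b a s := by
  have hz := hf.m_notMem b (hf.n_notMem a (hf.realLine_notMem hr h0 hs))
  obtain ⟨D, h, hd⟩ := hf.shift_n.dist_left (hr.ne s') (ne_omega_of_notMem hz)
  exact ⟨D ^ 4, h, fun c => by rw [wordDist, hd]⟩

lemma wordDist_eq_normAt (hf : IsFrame q ω e n m) (hr : IsRealLine q ω r) (h0 : r 0 = e 0)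
    (hs : s ≠ 0) (hs' : s' ≠ 0) (c b a : ℝ) :
    wordDist q n m (r s') (r s) s c b a =
      normAt q (e 0) (n (-c) (r s')) (m b (n a (r s))) ^ 4 *
        ((s' ^ 4 + c ^ 2) * (s ^ 4 + a ^ 2)) := by
  have hx' := hf.n_notMem (-c) (hf.realLine_notMem hr h0 hs')
  have hz := hf.m_notMem b (hf.n_notMem a (hf.realLine_notMem hr h0 hs))
  rw [wordDist, ← hf.shift_n.isometry hf.gauge (-c), hf.shift_n.neg_apply,
    ← hf.gauge.normAt_pow_four_mul (ne_center_of_notMem hx') (ne_center_of_notMem hz),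
    ← hf.dist_mn_center hr h0 b a hs, ← neg_sq c, ← hf.dist_n_center hr h0 (-c) s']
  ring

lemma wordDist_quadratic_b (hf : IsFrame q ω e n m) (hr : IsRealLine q ω r) (h0 : r 0 = e 0)
    (hs : s ≠ 0) (hs' : s' ≠ 0) (c a : ℝ) :
    ∃ E h, ∀ b, wordDist q n m (r s') (r s) s c b a =
      (E + (h + b) ^ 2) * ((s' ^ 4 + c ^ 2) * (s ^ 4 + a ^ 2)) := by
  have hx' := hf.n_notMem (-c) (hf.realLine_notMem hr h0 hs')
  have hy := hf.n_notMem a (hf.realLine_notMem hr h0 hs)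
  obtain ⟨D, h, hd⟩ := hf.shift_m.dist_left (ne_center_of_notMem hx') (ne_center_of_notMem hy)
  exact ⟨D ^ 4, h, fun b => by rw [hf.wordDist_eq_normAt hr h0 hs hs', hd]⟩

lemma wordDist_swap (hf : IsFrame q ω e n m) (hr : IsRealLine q ω r) (h0 : r 0 = e 0)
    (hs : s ≠ 0) (hs' : s' ≠ 0) (c b a : ℝ) :
    wordDist q n m (r s') (r s) s c b a =
      q (m (-b) (n (-c) (r s'))) (n a (r s)) ^ 4 * modSq (-b) (-c) s' := by
  have hx' := hf.m_notMem (-b) (hf.n_notMem (-c) (hf.realLine_notMem hr h0 hs'))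
  have hy := hf.n_notMem a (hf.realLine_notMem hr h0 hs)
  rw [hf.wordDist_eq_normAt hr h0 hs hs', ← hf.shift_m.isometry hf.gauge_normAt (-b),
    hf.shift_m.neg_apply,
    ← hf.gauge.normAt_pow_four_mul (ne_center_of_notMem hx') (ne_center_of_notMem hy), ← neg_sq c,
    ← hf.dist_mn_center hr h0 (-b) (-c) hs', ← hf.dist_n_center hr h0 a s]
  ring

lemma wordDist_quadratic_a (hf : IsFrame q ω e n m) (hr : IsRealLine q ω r) (h0 : r 0 = e 0)
    (hs : s ≠ 0) (hs' : s' ≠ 0) (c b : ℝ) :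
    ∃ E h, ∀ a, wordDist q n m (r s') (r s) s c b a = (E + (h + a) ^ 2) * modSq (-b) (-c) s' := by
  have hx' := hf.m_notMem (-b) (hf.n_notMem (-c) (hf.realLine_notMem hr h0 hs'))
  obtain ⟨D, h, hd⟩ := hf.shift_n.dist_left (ne_omega_of_notMem hx') (hr.ne s)
  exact ⟨D ^ 4, h, fun a => by rw [hf.wordDist_swap hr h0 hs hs', hd]⟩

lemma wordDist_zero_b (hf : IsFrame q ω e n m) (hr : IsRealLine q ω r) (s s' c a : ℝ) :
    wordDist q n m (r s') (r s) s c 0 a = (s - s') ^ 4 + (a + c) ^ 2 := by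
  rw [wordDist, hf.shift_m.zero, ← hf.shift_n.add, hf.shift_n.dist_realLine hf.gauge hr, modSq]
  ring

lemma normAt_dist_realLine (hf : IsFrame q ω e n m) (hr : IsRealLine q ω r) (h0 : r 0 = e 0)
    (hs : s ≠ 0) (hs' : s' ≠ 0) (b : ℝ) :
    normAt q (e 0) (r s') (m b (r s)) ^ 4 * (s ^ 4 * s' ^ 4) =
      (s - s') ^ 4 + b ^ 2 * (s ^ 4 * s' ^ 4) := by
  have hq := hf.gauge
  have hG := hf.gauge_normAt
  have hne {s : ℝ} (hs : s ≠ 0) : r s ≠ e 0 := ne_center_of_notMem (hf.realLine_notMem hr h0 hs)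
  have hσ : IsRealCircle (normAt q (e 0)) (insert ω (Set.range r)) :=
    (isCircle_rescale_iff (normFactor_pos hq.toIsGauge _)).2 (hq.isCircle hr)
  obtain ⟨c, hc, -, hcσ⟩ := hσ.exists_line .id hG.toIsGauge hG.normalized (Or.inr ⟨0, h0⟩)
    (Or.inl rfl) (hf.complexLine.ne 0).symm
  obtain ⟨τ, hτ⟩ : r s ∈ Set.range c := hcσ ▸ ⟨Or.inr ⟨s, rfl⟩, hne hs⟩
  obtain ⟨τ', hτ'⟩ : r s' ∈ Set.range c := hcσ ▸ ⟨Or.inr ⟨s', rfl⟩, hne hs'⟩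
  have habs (x : ℝ) : |x| ^ 4 = x ^ 4 := Even.pow_abs ⟨2, rfl⟩ x
  have hshift := hf.shift_m.dist_realLine hG hc τ' τ b
  have hdist := hq.normAt_pow_four_mul (hne hs') (hne hs)
  rw [hτ, hτ'] at hshift
  rw [← hτ, ← hτ', hc.dist, hτ, hτ', ← h0, hr.dist, hr.dist, hr.dist, sub_zero, sub_zero, habs,
    habs, habs, habs] at hdist
  rw [hshift]
  linear_combination hdist

lemma wordDist_only_b (hf : IsFrame q ω e n m) (hr : IsRealLine q ω r) (h0 : r 0 = e 0)
    (hs : s ≠ 0) (hs' : s' ≠ 0) (b : ℝ) :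
    wordDist q n m (r s') (r s) s 0 b 0 = (s - s') ^ 4 + b ^ 2 * (s ^ 4 * s' ^ 4) := by
  rw [hf.wordDist_eq_normAt hr h0 hs hs', neg_zero, hf.shift_n.zero, hf.shift_n.zero,
    ← hf.normAt_dist_realLine hr h0 hs hs']
  ring

end IsFrame

end Frame

/-! ### The form of the words in shifts -/

section WordForm

/-- The part of `wordForm` that is determined by its leading coefficients in each variable. -/
def wordLeadingForm (s s' c b a : ℝ) : ℝ :=
  (a + c + a * b * c) ^ 2 + s ^ 4 * s' ^ 4 * b ^ 2 + s ^ 4 * (1 + b * c) ^ 2 +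
    s' ^ 4 * (1 + a * b) ^ 2

/-- The polynomial in `c`, `b`, `a` to which `wordDist` is equal for two points of an `ℝ`-line with
the parameters `s` and `s'`. The constants `α` and `β` vanish when the group generated by the shifts
acts as in the model, the boundary of a complex hyperbolic plane. -/
def wordForm (s s' α β c b a : ℝ) : ℝ :=
  wordLeadingForm s s' c b a + ((s - s') ^ 4 - s ^ 4 - s' ^ 4) +
    (α - 4 * s * s' ^ 3) * (a * b) + (β - 4 * s' * s ^ 3) * (b * c)

lemma eq_zero_of_forall_div_le {P Q τ : ℝ} (hP : 0 ≤ P)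
    (h : ∀ b ≠ 0, τ / b ≤ P * b ^ 2 + Q) : τ = 0 := by
  by_contra hτ
  have hPτ : 0 ≤ P * τ ^ 2 := by positivity
  obtain ⟨K, hK⟩ : ∃ K, K = |Q| + P * τ ^ 2 + 1 := ⟨_, rfl⟩
  have hK1 : 1 ≤ K := by linarith [abs_nonneg Q]
  have hK0 : K ≠ 0 := by linarith
  have hle := h (τ / K) (div_ne_zero hτ hK0)
  rw [div_div_cancel₀ hτ] at hle
  have hsq : (τ / K) ^ 2 ≤ τ ^ 2 := by
    rw [div_pow]
    exact div_le_self (sq_nonneg _) (one_le_pow₀ hK1)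
  linarith [mul_le_mul_of_nonneg_left hsq hP, le_abs_self Q]

lemma trilinear_coeff_eq_zero {s s' ρ κ₁ κ₂ τ : ℝ}
    (h : ∀ c b a, 0 ≤ wordLeadingForm s s' c b a + ρ + κ₁ * (a * b) + κ₂ * (b * c) +
      τ * (a * b * c)) : τ = 0 := by
  refine eq_zero_of_forall_div_le (P := 2 * (s ^ 4 * s' ^ 4))
    (Q := 2 * (4 * s ^ 4 + s' ^ 4 / 4 + ρ - κ₁ / 2 + κ₂)) (by positivity) fun b hb => ?_
  -- At `c = 1 / b` and `a = -1 / (2 b)` the square `(a + c + a b c) ^ 2` vanishes.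
  have hvalue : wordLeadingForm s s' (1 / b) b (-1 / (2 * b)) + ρ + κ₁ * (-1 / (2 * b) * b) +
      κ₂ * (b * (1 / b)) + τ * (-1 / (2 * b) * b * (1 / b)) =
      s ^ 4 * s' ^ 4 * b ^ 2 + (4 * s ^ 4 + s' ^ 4 / 4 + ρ - κ₁ / 2 + κ₂) - τ / b / 2 := by
    unfold wordLeadingForm
    field_simp
    ring
  linarith [hvalue ▸ h (1 / b) b (-1 / (2 * b))]

/-- A function of three variables that is quadratic in each of them, with leading coefficients as
for the word `n c ∘ m b ∘ n a`, differs from `wordLeadingForm` by a function that is affine in each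
variable. -/
lemma exists_eq_wordForm {Φ : ℝ → ℝ → ℝ → ℝ} {s s' : ℝ}
    (hc : ∀ b a, ∃ E h, ∀ c, Φ c b a = (E + (h + c) ^ 2) * modSq b a s)
    (hb : ∀ c a, ∃ E h, ∀ b, Φ c b a =
      (E + (h + b) ^ 2) * ((s' ^ 4 + c ^ 2) * (s ^ 4 + a ^ 2)))
    (ha : ∀ c b, ∃ E h, ∀ a, Φ c b a = (E + (h + a) ^ 2) * modSq (-b) (-c) s')
    (hzero_b : ∀ c a, Φ c 0 a = (s - s') ^ 4 + (a + c) ^ 2)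
    (honly_b : ∀ b, Φ 0 b 0 = (s - s') ^ 4 + b ^ 2 * (s ^ 4 * s' ^ 4))
    (hpos : ∀ c b a, 0 ≤ Φ c b a) : ∃ α β : ℝ, ∀ c b a, Φ c b a = wordForm s s' α β c b a := by
  set Ψ : ℝ → ℝ → ℝ → ℝ := fun c b a => Φ c b a - wordLeadingForm s s' c b a with hΨ
  have affine_c (c b a) : Ψ c b a = Ψ 0 b a + c * (Ψ 1 b a - Ψ 0 b a) := by
    obtain ⟨E, h, H⟩ := hc b a
    simp only [hΨ, H, modSq, wordLeadingForm]
    ring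
  have affine_b (c b a) : Ψ c b a = Ψ c 0 a + b * (Ψ c 1 a - Ψ c 0 a) := by
    obtain ⟨E, h, H⟩ := hb c a
    simp only [hΨ, H, wordLeadingForm]
    ring
  have affine_a (c b a) : Ψ c b a = Ψ c b 0 + a * (Ψ c b 1 - Ψ c b 0) := by
    obtain ⟨E, h, H⟩ := ha c b
    simp only [hΨ, H, modSq, wordLeadingForm]
    ring
  set ρ := (s - s') ^ 4 - s ^ 4 - s' ^ 4 with hρ
  have Ψ_zero_b (c a) : Ψ c 0 a = ρ := by
    simp only [hΨ, hzero_b, hρ, wordLeadingForm]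
    ring
  have Ψ_only_b : Ψ 0 1 0 = ρ := by
    simp only [hΨ, honly_b, hρ, wordLeadingForm]
    ring
  have hΦ (c b a) : Φ c b a = wordLeadingForm s s' c b a + ρ + (Ψ 0 1 1 - ρ) * (a * b) +
      (Ψ 1 1 0 - ρ) * (b * c) + (Ψ 1 1 1 - Ψ 1 1 0 - Ψ 0 1 1 + ρ) * (a * b * c) := by
    have h : Φ c b a = wordLeadingForm s s' c b a + Ψ c b a := by
      simp only [hΨ]
      ring
    rw [h, affine_b c b a, Ψ_zero_b, affine_c c 1 a, affine_a 0 1 a, affine_a 1 1 a, Ψ_only_b]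
    ring
  have hτ := trilinear_coeff_eq_zero fun c b a => hΦ c b a ▸ hpos c b a
  refine ⟨Ψ 0 1 1 - ρ + 4 * s * s' ^ 3, Ψ 1 1 0 - ρ + 4 * s' * s ^ 3, fun c b a => ?_⟩
  rw [hΦ, hτ, wordForm]
  ring

lemma eq_and_nonneg_of_forall_mul_nonneg {α β : ℝ}
    (h : ∀ l, 0 < l → l ≠ 1 → 0 ≤ (1 - l) * (α - β * l)) : α = β ∧ 0 ≤ α := by
  have hlim : Filter.Tendsto (fun l => α - β * l) (nhds 1) (nhds (α - β)) := by
    have : Continuous fun l => α - β * l := by fun_prop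
    simpa using this.tendsto 1
  have hle : 0 ≤ α - β := by
    refine ge_of_tendsto (hlim.mono_left nhdsWithin_le_nhds)
      (Filter.mem_of_superset (Ioo_mem_nhdsLT one_pos) fun l hl => ?_)
    exact nonneg_of_mul_nonneg_right (h l hl.1 hl.2.ne) (sub_pos.2 hl.2)
  have hge : α - β ≤ 0 := by
    refine le_of_tendsto (hlim.mono_left (nhdsWithin_le_nhds (s := Set.Ioi 1)))
      (Filter.mem_of_superset self_mem_nhdsWithin fun l (hl : 1 < l) => ?_)
    exact nonpos_of_mul_nonneg_right (h l (one_pos.trans hl) hl.ne') (sub_neg.2 hl)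
  have hαβ : α = β := by linarith
  refine ⟨hαβ, ?_⟩
  have := h (1 / 2) (by norm_num) (by norm_num)
  rw [← hαβ] at this
  linarith

end WordForm

/-! ### Dilations as words in shifts -/

section Words

variable {X : Type*} {q : X → X → ℝ} {ω : X} {e r : ℝ → X} {n m : ℝ → X → X}

lemma sqrt_sqrt_pow_four (x : ℝ) : √√(x ^ 4) = |x| := by
  rw [show x ^ 4 = (x ^ 2) ^ 2 by ring, Real.sqrt_sq (sq_nonneg _), Real.sqrt_sq_eq_abs]

lemma tendsto_of_pow_four {ι : Type*} {F : Filter ι} {f : ι → ℝ} {x : ℝ} (hf : ∀ i, 0 ≤ f i)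
    (h : Tendsto (fun i => f i ^ 4) F (𝓝 (x ^ 4))) : Tendsto f F (𝓝 |x|) := by
  have hsqrt := h.sqrt.sqrt
  rw [sqrt_sqrt_pow_four] at hsqrt
  exact hsqrt.congr fun i => by rw [sqrt_sqrt_pow_four, abs_of_nonneg (hf i)]

lemma tendsto_of_mul_eq {f : ℝ → ℝ} {l A B C : ℝ} (hl : l ≠ 0) (hC : 0 ≤ C)
    (h : ∀ b ≠ 0, f b * (1 / l ^ 2 + b ^ 2 * C) = A / l ^ 2 + b ^ 2 * B) :
    Tendsto f (𝓝[≠] 0) (𝓝 A) := by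
  have hpos (b : ℝ) : 1 / l ^ 2 + b ^ 2 * C ≠ 0 := by positivity
  have hcont : Continuous fun b : ℝ => (A / l ^ 2 + b ^ 2 * B) / (1 / l ^ 2 + b ^ 2 * C) :=
    Continuous.div (by fun_prop) (by fun_prop) hpos
  have hlim := (hcont.tendsto 0).mono_left (nhdsWithin_le_nhds (s := {0}ᶜ))
  have hvalue : (A / l ^ 2 + 0 ^ 2 * B) / (1 / l ^ 2 + 0 ^ 2 * C) = A := by field_simp; simp
  rw [hvalue] at hlim
  refine hlim.congr' ?_
  filter_upwards [self_mem_nhdsWithin] with b hb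
  rw [← h b hb, mul_div_cancel_right₀ _ (hpos b)]

lemma IsAffineGauge.abs_dist_sub_le (hq : IsAffineGauge q ω) {x y z : X} (hx : x ≠ ω)
    (hy : y ≠ ω) (hz : z ≠ ω) : |q x z - q y z| ≤ q x y := by
  have hxz := hq.triangle hq.normalized hx hy hz
  have hyz := hq.triangle hq.normalized hy hx hz
  rw [hq.symm y x] at hyz
  exact abs_le.2 ⟨by linarith, by linarith⟩

/-- A word in the shifts of a frame that fixes neither `ω` nor `e 0`, but converges on the `ℂ`-line
to the map `e t ↦ e (l² t)` as `b → 0`. -/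
noncomputable def slide (n m : ℝ → X → X) (l b : ℝ) (x : X) : X :=
  n ((l - 1) / b) (m b (n ((1 / l - 1) / b) x))

/-- The word in the shifts of a frame that maps `e t` to `e (l² t)` and fixes `ω`. It is a homothety
with coefficient `l`, but may fail to preserve the `ℝ`-lines through `e 0`. -/
noncomputable def dilation (n m : ℝ → X → X) (l b : ℝ) (x : X) : X := slide n m l b (m (-(b * l)) x)

namespace IsFrame

lemma slide_eq_dilation (hf : IsFrame q ω e n m) (l b : ℝ) (x : X) :
    slide n m l b x = dilation n m l b (m (b * l) x) := by
  rw [dilation, hf.shift_m.neg_apply]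

lemma dilation_omega (hf : IsFrame q ω e n m) {l b : ℝ} (hl : l ≠ 0) (hb : b ≠ 0) :
    dilation n m l b ω = ω := by
  rw [dilation, slide, hf.m_omega _ (neg_ne_zero.2 (mul_ne_zero hb hl)), hf.n_apply, hf.m_pole,
    hf.shift_n.map_omega]
  field_simp
  ring

lemma dilation_apply (hf : IsFrame q ω e n m) {l b : ℝ} (hl : l ≠ 0) (hb : b ≠ 0) (t : ℝ) :
    dilation n m l b (e t) = e (l ^ 2 * t) := by
  rw [dilation, slide]
  by_cases h : 1 + -(b * l) * t = 0
  · rw [hf.m_pole _ _ h, hf.shift_n.map_omega, hf.m_omega _ hb, hf.n_apply]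
    congr 1
    field_simp
    linear_combination l * h
  · obtain ⟨w, hw⟩ : ∃ w, w = 1 + -(b * l) * t := ⟨_, rfl⟩
    have ht : t = (1 - w) / (b * l) := by
      rw [hw]
      field_simp
      ring
    have hwl : 1 + b * (t / w + (1 / l - 1) / b) = 1 / (l * w) := by
      rw [← hw] at h
      rw [ht]
      field_simp
      ring
    rw [hf.m_apply _ _ h, ← hw, hf.n_apply, hf.m_apply, hwl, hf.n_apply]
    · rw [← hw] at h
      congr 1
      rw [ht]
      field_simp
      ring
    · rw [hwl]
      exact one_div_ne_zero (mul_ne_zero hl (hw ▸ h))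

lemma isConformalMap_dilation (hf : IsFrame q ω e n m) (l b : ℝ) :
    IsConformalMap q q (dilation n m l b) :=
  (hf.isConformalMap_n _).comp <| (hf.isConformalMap_m _).comp <|
    (hf.isConformalMap_n _).comp (hf.isConformalMap_m _)

lemma dilation_ne (hf : IsFrame q ω e n m) {l b : ℝ} (hl : l ≠ 0) (hb : b ≠ 0) {x : X}
    (hx : x ≠ ω) : dilation n m l b x ≠ ω := fun h =>
  hx ((hf.isConformalMap_dilation l b).injective hf.gauge.self hf.gauge.pos
    (h.trans (hf.dilation_omega hl hb).symm))

lemma dist_dilation (hf : IsFrame q ω e n m) {l b : ℝ} (hl : 0 < l) (hb : b ≠ 0) {x y : X}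
    (hx : x ≠ ω) (hy : y ≠ ω) : q (dilation n m l b x) (dilation n m l b y) = l * q x y := by
  obtain ⟨k, -, h⟩ := IsConformalMap.exists_homothety hf.gauge.normalized hf.gauge.toIsGauge
    (hf.isConformalMap_dilation l b) (hf.dilation_omega hl.ne' hb)
  have hk := h (e 1) (e 0) (hf.complexLine.ne 1) (hf.complexLine.ne 0)
  rw [hf.dilation_apply hl.ne' hb, hf.dilation_apply hl.ne' hb, hf.complexLine.dist,
    hf.complexLine.dist, mul_one, mul_zero, sub_zero, sub_zero, abs_one, Real.sqrt_one, mul_one,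
    abs_of_nonneg (sq_nonneg l), Real.sqrt_sq hl.le] at hk
  rw [h _ _ hx hy, hk]

lemma slide_notMem (hf : IsFrame q ω e n m) {x : X} (l b : ℝ) (hx : x ∉ frameCircle ω e) :
    slide n m l b x ∉ frameCircle ω e :=
  hf.n_notMem _ (hf.m_notMem _ (hf.n_notMem _ hx))

/-! ### The defect of a pair of points -/

lemma exists_wordDist_eq (hf : IsFrame q ω e n m) (hr : IsRealLine q ω r) (h0 : r 0 = e 0)
    {s s' : ℝ} (hs : s ≠ 0) (hs' : s' ≠ 0) :
    ∃ α β : ℝ, ∀ c b a, wordDist q n m (r s') (r s) s c b a = wordForm s s' α β c b a :=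
  exists_eq_wordForm (fun b a => hf.wordDist_quadratic_c hr h0 hs s' b a)
    (fun c a => hf.wordDist_quadratic_b hr h0 hs hs' c a)
    (fun c b => hf.wordDist_quadratic_a hr h0 hs hs' c b)
    (fun c a => hf.wordDist_zero_b hr s s' c a)
    (fun b => hf.wordDist_only_b hr h0 hs hs' b)
    fun _ b a => mul_nonneg (pow_nonneg (hf.gauge.nonneg _ _) 4) (modSq_pos b a hs).le

end IsFrame

lemma modSq_slide {b l : ℝ} (hl : l ≠ 0) (hb : b ≠ 0) (s : ℝ) :
    modSq b ((1 / l - 1) / b) s = 1 / l ^ 2 + b ^ 2 * s ^ 4 := by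
  unfold modSq
  field_simp
  ring

lemma dist_slide {s s' α β : ℝ}
    (hw : ∀ c b a, wordDist q n m (r s') (r s) s c b a = wordForm s s' α β c b a) {l b : ℝ}
    (hl : l ≠ 0) (hb : b ≠ 0) :
    q (r s') (slide n m l b (r s)) ^ 4 * (1 / l ^ 2 + b ^ 2 * s ^ 4) =
      ((s' - l * s) ^ 4 + l * ((1 - l) * (α - β * l))) / l ^ 2 + b ^ 2 * (s ^ 4 * s' ^ 4) := by
  rw [← modSq_slide hl hb, slide, ← wordDist, hw, wordForm, wordLeadingForm]
  field_simp
  ring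

lemma tendsto_dist_slide {s s' α β : ℝ}
    (hw : ∀ c b a, wordDist q n m (r s') (r s) s c b a = wordForm s s' α β c b a) {l : ℝ}
    (hl : l ≠ 0) :
    Tendsto (fun b => q (r s') (slide n m l b (r s)) ^ 4) (𝓝[≠] 0)
      (𝓝 ((s' - l * s) ^ 4 + l * ((1 - l) * (α - β * l)))) :=
  tendsto_of_mul_eq hl (by positivity) fun _ => dist_slide hw hl

namespace IsFrame

lemma dist_slide_center (hf : IsFrame q ω e n m) (hr : IsRealLine q ω r) (h0 : r 0 = e 0)
    {s l b : ℝ} (hs : s ≠ 0) (hl : l ≠ 0) (hl1 : l ≠ 1) (hb : b ≠ 0) :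
    q (slide n m l b (r s)) (e 0) ^ 4 * (1 / l ^ 2 + b ^ 2 * s ^ 4) = l ^ 2 * s ^ 4 := by
  have hq := hf.gauge
  set c := (l - 1) / b with hc
  set a := (1 / l - 1) / b with ha
  have hc0 : c ≠ 0 := div_ne_zero (sub_ne_zero.2 hl1) hb
  have hy := hf.n_notMem a (hf.realLine_notMem hr h0 hs)
  have hne {t : ℝ} (ht : t ≠ 0) : e t ≠ e 0 := fun h =>
    ht (hf.complexLine.injective .sqrt hq.toIsGauge h)
  have hm_apply : m b (e (-(c / l))) = e (-c) := by
    have hbc : 1 + b * -(c / l) = 1 / l := by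
      rw [hc]
      field_simp
      ring
    rw [hf.m_apply _ _ (by rw [hbc]; exact one_div_ne_zero hl), hbc]
    congr 1
    field_simp
  have hy_center := hf.dist_n_center hr h0 a s
  have hz_center := hf.dist_mn_center hr h0 b a hs
  have hy_dist : q (n a (r s)) (e (-(c / l))) ^ 4 = s ^ 4 := by
    have hca : -(c / l) - a = 0 := by
      rw [hc, ha]
      field_simp
      ring
    rw [hf.dist_n hr h0, hca, zero_pow two_ne_zero, add_zero]
  have hslide : q (slide n m l b (r s)) (e 0) = q (m b (n a (r s))) (e (-c)) := by
    rw [slide, ← neg_add_cancel c, ← hf.n_apply, hf.shift_n.isometry hq]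
  have hz := hq.normAt_pow_four_mul (ne_center_of_notMem (hf.m_notMem b hy))
    (hne (neg_ne_zero.2 hc0))
  have hy' := hq.normAt_pow_four_mul (ne_center_of_notMem hy)
    (hne (neg_ne_zero.2 (div_ne_zero hc0 hl)))
  rw [← hm_apply, hf.shift_m.isometry hf.gauge_normAt, hm_apply, hf.complexLine.dist,
    sqrt_abs_pow_four, sub_zero, neg_sq] at hz
  rw [hy_dist, hy_center, hf.complexLine.dist, sqrt_abs_pow_four, sub_zero, neg_sq] at hy'
  have hdiv : (c / l) ^ 2 * l ^ 2 = c ^ 2 := by field_simp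
  rw [← modSq_slide hl hb, hslide, ← hz, ← hy', ← hz_center, ← hdiv]
  ring

lemma tendsto_dist_slide_center (hf : IsFrame q ω e n m) (hr : IsRealLine q ω r) (h0 : r 0 = e 0)
    {s l : ℝ} (hs : s ≠ 0) (hl : l ≠ 0) (hl1 : l ≠ 1) :
    Tendsto (fun b => q (slide n m l b (r s)) (e 0)) (𝓝[≠] 0) (𝓝 |l * s|) := by
  refine tendsto_of_pow_four (fun _ => hf.gauge.nonneg _ _) ?_
  refine tendsto_of_mul_eq (B := 0) hl (by positivity : 0 ≤ s ^ 4) fun b hb => ?_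
  rw [hf.dist_slide_center hr h0 hs hl hl1 hb]
  field_simp
  ring

lemma one_sub_mul_nonneg (hf : IsFrame q ω e n m) (hr : IsRealLine q ω r) (h0 : r 0 = e 0)
    {s s' α β l : ℝ} (hs : 0 < s) (hs' : 0 < s')
    (hw : ∀ c b a, wordDist q n m (r s') (r s) s c b a = wordForm s s' α β c b a)
    (hl : 0 < l) (hl1 : l ≠ 1) : 0 ≤ (1 - l) * (α - β * l) := by
  have hlim := hf.tendsto_dist_slide_center hr h0 hs.ne' hl.ne' hl1
  rw [abs_of_pos (mul_pos hl hs)] at hlim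
  have hle : (s' - l * s) ^ 4 ≤ (s' - l * s) ^ 4 + l * ((1 - l) * (α - β * l)) := by
    refine le_of_tendsto_of_tendsto ((tendsto_const_nhds.sub hlim).pow 4)
      (tendsto_dist_slide hw hl.ne') (Eventually.of_forall fun b => ?_)
    have hslide := hf.slide_notMem l b (hf.realLine_notMem hr h0 hs.ne')
    have hdist := hf.gauge.abs_dist_sub_le (hr.ne s') (ne_omega_of_notMem hslide)
      (hf.complexLine.ne 0)
    rw [← h0, hr.dist, sub_zero, abs_of_pos hs', h0] at hdist
    beta_reduce
    rw [← Even.pow_abs (by decide : Even 4) (s' - _)]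
    exact pow_le_pow_left₀ (abs_nonneg _) hdist 4
  exact nonneg_of_mul_nonneg_right (by linarith) hl

/-- The number `δ` measures how far the slides are from converging to a homothety along the
`ℝ`-line. -/
lemma exists_defect (hf : IsFrame q ω e n m) (hr : IsRealLine q ω r) (h0 : r 0 = e 0) {s s' : ℝ}
    (hs : 0 < s) (hs' : 0 < s') :
    ∃ δ : ℝ, 0 ≤ δ ∧
      (∀ c b a, wordDist q n m (r s') (r s) s c b a = wordForm s s' δ δ c b a) ∧
      ∀ l ≠ 0, Tendsto (fun b => q (r s') (slide n m l b (r s)) ^ 4) (𝓝[≠] 0)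
        (𝓝 ((s' - l * s) ^ 4 + l * δ * (l - 1) ^ 2)) := by
  obtain ⟨α, β, hw⟩ := hf.exists_wordDist_eq hr h0 hs.ne' hs'.ne'
  obtain ⟨rfl, hα⟩ := eq_and_nonneg_of_forall_mul_nonneg
    fun l => hf.one_sub_mul_nonneg hr h0 hs hs' hw (l := l)
  refine ⟨α, hα, hw, fun l hl => ?_⟩
  convert tendsto_dist_slide hw hl using 2
  ring

end IsFrame

end Words

/-! ### Tangency of ℂ-circles -/

section Tangency

variable {X : Type*} {q : X → X → ℝ} {ω : X} {e r : ℝ → X} {n m : ℝ → X → X}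

/-- Closed bounded subsets of the complement of `ω` are compact, in terms of convergence of
ultrafilters with respect to the gauge. -/
def IsProper (q : X → X → ℝ) (ω : X) : Prop :=
  ∀ (U : Ultrafilter X) (y : X) (R : ℝ), y ≠ ω → (∀ᶠ x in U, x ≠ ω ∧ q x y ≤ R) →
    ∃ z, z ≠ ω ∧ Tendsto (fun x => q x z) U (𝓝 0)

lemma IsProper.exists_tendsto (hP : IsProper q ω) {ι : Type*} {U : Ultrafilter ι} {x : ι → X}
    {y : X} {R : ℝ} (hy : y ≠ ω) (hx : ∀ᶠ i in U, x i ≠ ω ∧ q (x i) y ≤ R) :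
    ∃ z, z ≠ ω ∧ Tendsto (fun i => q (x i) z) U (𝓝 0) :=
  hP (U.map x) y R hy hx

lemma IsAffineGauge.tendsto_dist (hq : IsAffineGauge q ω) {ι : Type*} {F : Filter ι}
    {x x' : ι → X} {z z' : X} (hz : z ≠ ω) (hz' : z' ≠ ω) (hx : ∀ᶠ i in F, x i ≠ ω)
    (hx' : ∀ᶠ i in F, x' i ≠ ω) (h : Tendsto (fun i => q (x i) z) F (𝓝 0))
    (h' : Tendsto (fun i => q (x' i) z') F (𝓝 0)) :
    Tendsto (fun i => q (x i) (x' i)) F (𝓝 (q z z')) := by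
  rw [tendsto_iff_dist_tendsto_zero]
  refine squeeze_zero' (Eventually.of_forall fun _ => dist_nonneg) ?_ (add_zero (0 : ℝ) ▸ h.add h')
  filter_upwards [hx, hx'] with i hi hi'
  have hleft := hq.abs_dist_sub_le hi hz hi'
  have hright := hq.abs_dist_sub_le hi' hz' hz
  rw [hq.symm _ z, hq.symm _ z] at hright
  exact (dist_triangle _ (q z (x' i)) _).trans (add_le_add hleft hright)

lemma IsAffineGauge.exists_line_of_tendsto (hq : IsAffineGauge q ω) (hP : IsProper q ω)
    {p : ℝ → ℝ} {ι : Type*} {U : Ultrafilter ι} {z : ι → ℝ → X} {y : X} (hy : y ≠ ω)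
    (hz0 : ∀ᶠ i in U, z i 0 = y) (hzω : ∀ τ, ∀ᶠ i in U, z i τ ≠ ω)
    (hz : ∀ τ τ', Tendsto (fun i => q (z i τ) (z i τ')) U (𝓝 (p |τ - τ'|))) :
    ∃ E, IsLine p q ω E ∧ E 0 = y ∧ ∀ τ, Tendsto (fun i => q (z i τ) (E τ)) U (𝓝 0) := by
  have hlim (τ : ℝ) : ∃ x, x ≠ ω ∧ Tendsto (fun i => q (z i τ) x) U (𝓝 0) := by
    refine hP.exists_tendsto (R := p |τ - 0| + 1) hy ?_
    filter_upwards [hz0, hzω τ, (hz τ 0).eventually (gt_mem_nhds (lt_add_one _))] with i hi hω hlt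
    exact ⟨hω, hi ▸ hlt.le⟩
  choose E hEω hE using hlim
  refine ⟨E, ⟨hEω, fun τ τ' => ?_⟩, ?_, hE⟩
  · exact tendsto_nhds_unique
      (hq.tendsto_dist (hEω τ) (hEω τ') (hzω τ) (hzω τ') (hE τ) (hE τ')) (hz τ τ')
  · have hconst : Tendsto (fun _ : ι => q y (E 0)) U (𝓝 0) := (hE 0).congr' <| by
      filter_upwards [hz0] with i hi
      rw [hi]
    exact (hq.eq_of_eq_zero (tendsto_nhds_unique tendsto_const_nhds hconst)).symm

namespace IsFrame

lemma dist_m (hf : IsFrame q ω e n m) {y : X} (hy : y ∉ frameCircle ω e) (a b : ℝ) :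
    q (m a y) (m b y) = √|a - b| * (q (m a y) (e 0) * q (m b y) (e 0)) := by
  have hne (b : ℝ) : m b y ≠ e 0 := ne_center_of_notMem (hf.m_notMem b hy)
  have h := (hf.shift_m.complexLine y (ne_center_of_notMem hy)).dist a b
  rw [normAt_apply q (hne a) (hne b)] at h
  exact (div_eq_iff
    (mul_pos (hf.gauge.pos _ _ (hne a)) (hf.gauge.pos _ _ (hne b))).ne').1 h

lemma tendsto_dist_m_center (hf : IsFrame q ω e n m) {y : X} (hy : y ∉ frameCircle ω e) :
    Tendsto (fun b => q (m b y) (e 0)) (𝓝 0) (𝓝 (q y (e 0))) := by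
  have hpos {x : X} (hx : x ∉ frameCircle ω e) : 0 < q x (e 0) :=
    hf.gauge.pos _ _ (ne_center_of_notMem hx)
  have hinv : Tendsto (fun b => (q (m b y) (e 0))⁻¹) (𝓝 0) (𝓝 (q y (e 0))⁻¹) := by
    rw [tendsto_iff_dist_tendsto_zero]
    refine squeeze_zero (g := fun b => √|b|) (fun _ => dist_nonneg) (fun b => ?_) ?_
    · have hm := hf.m_notMem b hy
      have hdist := hf.dist_m hy b 0
      have hle := hf.gauge.abs_dist_sub_le (ne_omega_of_notMem hm) (ne_omega_of_notMem hy)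
        (hf.complexLine.ne 0)
      rw [hf.shift_m.zero, sub_zero] at hdist
      rwa [Real.dist_eq, inv_sub_inv (hpos hm).ne' (hpos hy).ne', abs_div, abs_sub_comm,
        abs_of_pos (mul_pos (hpos hm) (hpos hy)), div_le_iff₀ (mul_pos (hpos hm) (hpos hy)),
        ← hdist]
    · have : Continuous fun b : ℝ => √|b| := by fun_prop
      simpa using this.tendsto 0
  simpa using hinv.inv₀ (inv_ne_zero (hpos hy).ne')

/-- Blowing up the `ℂ`-circle through `e 0` and `y` makes it converge to a `ℂ`-line. -/
lemma tendsto_dist_dilation_m (hf : IsFrame q ω e n m) {y : X} (hy : y ∉ frameCircle ω e)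
    {e' : ℝ → X} {n' m' : ℝ → X → X} (hf' : IsFrame q ω e' n' m') (τ τ' : ℝ) :
    Tendsto (fun t : ℝ => q (dilation n' m' t⁻¹ 1 (m (τ / q y (e 0) ^ 4 * t ^ 2) y))
      (dilation n' m' t⁻¹ 1 (m (τ' / q y (e 0) ^ 4 * t ^ 2) y))) (𝓝[>] 0) (𝓝 √|τ - τ'|) := by
  have hρ : 0 < q y (e 0) := hf.gauge.pos _ _ (ne_center_of_notMem hy)
  set ρ := q y (e 0)
  have hcenter (τ : ℝ) :
      Tendsto (fun t : ℝ => q (m (τ / ρ ^ 4 * t ^ 2) y) (e 0) / ρ) (𝓝[>] 0) (𝓝 1) := by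
    have hparam : Tendsto (fun t : ℝ => τ / ρ ^ 4 * t ^ 2) (𝓝 0) (𝓝 0) := by
      have : Continuous fun t : ℝ => τ / ρ ^ 4 * t ^ 2 := by fun_prop
      simpa using this.tendsto 0
    have h := ((hf.tendsto_dist_m_center hy).comp hparam).div_const ρ
    rw [div_self hρ.ne'] at h
    exact h.mono_left nhdsWithin_le_nhds
  have hlim := ((hcenter τ).mul (hcenter τ')).const_mul √|τ - τ'|
  rw [one_mul, mul_one] at hlim
  refine hlim.congr' ?_
  filter_upwards [self_mem_nhdsWithin] with t (ht : 0 < t)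
  have hω (b : ℝ) : m b y ≠ ω := ne_omega_of_notMem (hf.m_notMem b hy)
  have hscale : |τ / ρ ^ 4 * t ^ 2 - τ' / ρ ^ 4 * t ^ 2| = |τ - τ'| * (t / ρ ^ 2) ^ 2 := by
    rw [← abs_of_nonneg (sq_nonneg (t / ρ ^ 2)), ← abs_mul]
    congr 1
    field_simp
  rw [hf'.dist_dilation (inv_pos.2 ht) one_ne_zero (hω _) (hω _), hf.dist_m hy, hscale,
    Real.sqrt_mul (abs_nonneg _), Real.sqrt_sq (by positivity)]
  field_simp

/-- The `ℂ`-circle through `e 0` and `y` is tangent to the `ℂ`-line through `y`. -/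
lemma exists_tangent (hf : IsFrame q ω e n m) (hP : IsProper q ω) {y : X}
    (hy : y ∉ frameCircle ω e) {U : Ultrafilter ℝ} (hU : (U : Filter ℝ) ≤ 𝓝[>] 0) :
    ∃ κ : ℝ, Tendsto (fun t => q (m (κ * t ^ 2) y) (n (t ^ 2) y) / t) U (𝓝 0) := by
  have hq := hf.gauge
  have hyω := ne_omega_of_notMem hy
  have hline := hf.shift_n.complexLine y hyω
  have hpos : ∀ᶠ t : ℝ in U, 0 < t := hU self_mem_nhdsWithin
  have hω (b : ℝ) : m b y ≠ ω := ne_omega_of_notMem (hf.m_notMem b hy)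
  obtain ⟨n', m', hf'⟩ := hq.exists_isFrame hline
  have hdilation {t : ℝ} (ht : 0 < t) (a : ℝ) :
      dilation n' m' t⁻¹ 1 (n (t ^ 2 * a) y) = n a y := by
    have h := hf'.dilation_apply (inv_pos.2 ht).ne' one_ne_zero (t ^ 2 * a)
    rwa [← mul_assoc, inv_pow, inv_mul_cancel₀ (pow_pos ht 2).ne', one_mul] at h
  obtain ⟨E, hE, hE0, hlim⟩ := hq.exists_line_of_tendsto hP (U := U)
    (z := fun t τ => dilation n' m' t⁻¹ 1 (m (τ / q y (e 0) ^ 4 * t ^ 2) y)) hyω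
    (by
      filter_upwards [hpos] with t ht
      have h := hdilation ht 0
      rw [mul_zero, hf.shift_n.zero] at h
      rw [zero_div, zero_mul, hf.shift_m.zero, h])
    (fun τ => by
      filter_upwards [hpos] with t ht
      exact hf'.dilation_ne (inv_pos.2 ht).ne' one_ne_zero (hω _))
    fun τ τ' => (hf.tendsto_dist_dilation_m hy hf' τ τ').mono_left hU
  have hEy : E 0 = n 0 y := by rw [hE0, hf.shift_n.zero]
  obtain ⟨τ, hτ⟩ : ∃ τ : ℝ, E τ = n 1 y := by
    have : n 1 y ∈ Set.range fun a => n a y := ⟨1, rfl⟩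
    rwa [← hq.range_complexLine_eq hE hline hEy] at this
  refine ⟨τ / q y (e 0) ^ 4, (hlim τ).congr' ?_⟩
  filter_upwards [hpos] with t ht
  have h := hdilation ht 1
  rw [mul_one] at h
  rw [hτ, ← h, hf'.dist_dilation (inv_pos.2 ht) one_ne_zero (hω _) (hf.shift_n.ne hyω _)]
  exact inv_mul_eq_div _ _

lemma dist_m_n_pow_four (hf : IsFrame q ω e n m) (hr : IsRealLine q ω r) (h0 : r 0 = e 0)
    {s δ : ℝ} (hs : s ≠ 0)
    (hw : ∀ c b a, wordDist q n m (r s) (r s) s c b a = wordForm s s δ δ c b a) (κ t : ℝ) :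
    q (m (κ * t ^ 2) (n 1 (r s))) (n (t ^ 2) (n 1 (r s))) ^ 4 * modSq (κ * t ^ 2) 1 s =
      t ^ 4 * ((1 + κ + κ * t ^ 2) ^ 2 + s ^ 8 * κ ^ 2 + s ^ 4 * κ ^ 2 * (1 + (t ^ 2 + 1) ^ 2) -
        2 * s ^ 4 * κ - (δ - 4 * s ^ 4) * κ) := by
  have h := hf.wordDist_swap hr h0 hs hs (-1) (-(κ * t ^ 2)) (t ^ 2 + 1)
  rw [neg_neg, neg_neg, hf.shift_n.add] at h
  rw [← h, hw, wordForm, wordLeadingForm]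
  ring

lemma defect_self_eq_zero (hf : IsFrame q ω e n m) (hP : IsProper q ω) (hr : IsRealLine q ω r)
    (h0 : r 0 = e 0) {s δ : ℝ} (hs : s ≠ 0) (hδ : 0 ≤ δ) (hδs : δ ≤ 4 * s ^ 4)
    (hw : ∀ c b a, wordDist q n m (r s) (r s) s c b a = wordForm s s δ δ c b a) : δ = 0 := by
  have hU : (Ultrafilter.of (𝓝[>] (0 : ℝ)) : Filter ℝ) ≤ 𝓝[>] 0 := Ultrafilter.of_le _
  set U := Ultrafilter.of (𝓝[>] (0 : ℝ))
  obtain ⟨κ, hκ⟩ := hf.exists_tangent hP (hf.n_notMem 1 (hf.realLine_notMem hr h0 hs)) hU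
  set y := n 1 (r s)
  set P : ℝ → ℝ := fun t => (1 + κ + κ * t ^ 2) ^ 2 + s ^ 8 * κ ^ 2 +
    s ^ 4 * κ ^ 2 * (1 + (t ^ 2 + 1) ^ 2) - 2 * s ^ 4 * κ - (δ - 4 * s ^ 4) * κ with hP_def
  have hP_eq : ∀ᶠ t in U,
      (q (m (κ * t ^ 2) y) (n (t ^ 2) y) / t) ^ 4 * modSq (κ * t ^ 2) 1 s = P t := by
    filter_upwards [hU self_mem_nhdsWithin] with t (ht : 0 < t)
    rw [div_pow, div_mul_eq_mul_div, hf.dist_m_n_pow_four hr h0 hs hw,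
      mul_div_cancel_left₀ _ (pow_pos ht 4).ne']
  have hU0 : (U : Filter ℝ) ≤ 𝓝 0 := hU.trans nhdsWithin_le_nhds
  have hmod : Continuous fun t : ℝ => modSq (κ * t ^ 2) 1 s := by
    unfold modSq
    fun_prop
  have hP_cont : Continuous P := by fun_prop
  have hP0 : P 0 = 0 := by
    have hzero := (hκ.pow 4).mul ((hmod.tendsto 0).mono_left hU0)
    rw [zero_pow four_ne_zero, zero_mul] at hzero
    exact tendsto_nhds_unique ((hP_cont.tendsto 0).mono_left hU0) (hzero.congr' hP_eq)
  -- `P 0` is a quadratic polynomial in `κ` whose discriminant is negative for `0 < δ < 4 (1 + s⁴)`.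
  have hsquare : (2 * (1 + s ^ 4) ^ 2 * κ + (2 * (1 + s ^ 4) - δ)) ^ 2 +
      δ * (4 * (1 + s ^ 4) - δ) = 4 * (1 + s ^ 4) ^ 2 * P 0 := by
    simp only [hP_def]
    ring
  rw [hP0, mul_zero] at hsquare
  have hnonneg : 0 ≤ δ * (4 * (1 + s ^ 4) - δ) := mul_nonneg hδ (by linarith)
  have hprod : δ * (4 * (1 + s ^ 4) - δ) = 0 := by
    linarith [sq_nonneg (2 * (1 + s ^ 4) ^ 2 * κ + (2 * (1 + s ^ 4) - δ))]
  exact (mul_eq_zero.1 hprod).resolve_right (by linarith)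

lemma tendsto_dist_slide_self (hf : IsFrame q ω e n m) (hP : IsProper q ω)
    (hr : IsRealLine q ω r) (h0 : r 0 = e 0) {s : ℝ} (hs : 0 < s) {l : ℝ} (hl : l ≠ 0) :
    Tendsto (fun b => q (r s) (slide n m l b (r s)) ^ 4) (𝓝[≠] 0) (𝓝 ((s - l * s) ^ 4)) := by
  obtain ⟨δ, hδ, hw, hlim⟩ := hf.exists_defect hr h0 hs hs
  have hreflect : 0 ≤ (s - -1 * s) ^ 4 + -1 * δ * (-1 - 1) ^ 2 :=
    ge_of_tendsto' (hlim (-1) (by norm_num)) fun _ => pow_nonneg (hf.gauge.nonneg _ _) 4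
  obtain rfl : δ = 0 := hf.defect_self_eq_zero hP hr h0 hs.ne' hδ (by linarith) hw
  simpa using hlim l hl

end IsFrame

end Tangency

/-! ### The dilation as a limit of words -/

section Dilation

variable {X : Type*} {q : X → X → ℝ} {ω : X} {e r : ℝ → X} {n m : ℝ → X → X} {l : ℝ}

/-- A homothety with coefficient `l` of the complement of `ω`, extended by fixing `ω`. -/
structure IsHomothety (q : X → X → ℝ) (ω : X) (l : ℝ) (h : X → X) : Prop where
  map_omega : h ω = ω
  ne : ∀ x, x ≠ ω → h x ≠ ω
  dist : ∀ x y, x ≠ ω → y ≠ ω → q (h x) (h y) = l * q x y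

/-- A homothety with center `e 0` that preserves the lines through the center; it multiplies the
parameter of the `ℂ`-line `e` by `l ^ 2`, because distances along `e` are square roots. -/
structure IsDilation (q : X → X → ℝ) (ω : X) (e : ℝ → X) (l : ℝ) (h : X → X) : Prop
    extends IsHomothety q ω l h where
  complexLine : ∀ t, h (e t) = e (l ^ 2 * t)
  realLine : ∀ r, IsRealLine q ω r → r 0 = e 0 → ∀ s, h (r s) = r (l * s)

lemma IsAffineGauge.exists_limit_homothety (hq : IsAffineGauge q ω) (hP : IsProper q ω)
    {ι : Type*} {U : Ultrafilter ι} {f : ι → X → X} {o : X} (ho : o ≠ ω)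
    (hf : ∀ᶠ i in U, IsHomothety q ω l (f i)) (hfo : ∀ᶠ i in U, f i o = o) :
    ∃ h, IsHomothety q ω l h ∧
      ∀ x z, x ≠ ω → z ≠ ω → Tendsto (fun i => q (f i x) z) U (𝓝 0) → h x = z := by
  have hne {x : X} (hx : x ≠ ω) : ∀ᶠ i in U, f i x ≠ ω := hf.mono fun i hi => hi.ne x hx
  have hlim (x : X) : ∃ z, (x = ω → z = ω) ∧
      (x ≠ ω → z ≠ ω ∧ Tendsto (fun i => q (f i x) z) U (𝓝 0)) := by
    rcases eq_or_ne x ω with hx | hx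
    · exact ⟨ω, fun _ => rfl, fun h => absurd hx h⟩
    · obtain ⟨z, hz⟩ := hP.exists_tendsto (U := U) (x := fun i => f i x) (R := l * q x o) ho <| by
        filter_upwards [hf, hfo] with i hi hio
        have hdist := hi.dist x o hx ho
        rw [hio] at hdist
        exact ⟨hi.ne x hx, hdist.le⟩
      exact ⟨z, fun h => absurd h hx, fun _ => hz⟩
  choose h hω hh using hlim
  refine ⟨h, ⟨hω ω rfl, fun x hx => (hh x hx).1, fun x y hx hy => ?_⟩, fun x z hx hz hxz => ?_⟩
  · have hdist := hq.tendsto_dist (hh x hx).1 (hh y hy).1 (hne hx) (hne hy) (hh x hx).2 (hh y hy).2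
    refine tendsto_nhds_unique (hdist.congr' ?_) tendsto_const_nhds
    exact hf.mono fun i hi => hi.dist x y hx hy
  · have hdist := hq.tendsto_dist (hh x hx).1 hz (hne hx) (hne hx) (hh x hx).2 hxz
    simp only [hq.self] at hdist
    exact hq.eq_of_eq_zero (tendsto_nhds_unique hdist tendsto_const_nhds)

namespace IsFrame

lemma isHomothety_dilation (hf : IsFrame q ω e n m) (hl : 0 < l) {b : ℝ} (hb : b ≠ 0) :
    IsHomothety q ω l (dilation n m l b) :=
  ⟨hf.dilation_omega hl.ne' hb, fun _ => hf.dilation_ne hl.ne' hb,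
    fun _ _ => hf.dist_dilation hl hb⟩

/-- Comparing the two limits of slides along the triangle `r s'`, `r s`, `r (k s)`. -/
lemma defect_le (hf : IsFrame q ω e n m) (hP : IsProper q ω) (hr : IsRealLine q ω r)
    (h0 : r 0 = e 0) {s s' δ k : ℝ} (hs : 0 < s) (hk : k ≠ 0)
    (hlim : Tendsto (fun b => q (r s') (slide n m k b (r s)) ^ 4) (𝓝[≠] 0)
      (𝓝 ((s' - k * s) ^ 4 + k * δ * (k - 1) ^ 2))) :
    (s' - k * s) ^ 4 + k * δ * (k - 1) ^ 2 ≤ (|s' - s| + |s - k * s|) ^ 4 := by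
  have hself := tendsto_of_pow_four (fun _ => hf.gauge.nonneg _ _)
    (hf.tendsto_dist_slide_self hP hr h0 hs hk)
  refine le_of_tendsto_of_tendsto hlim ((hself.const_add |s' - s|).pow 4)
    (Eventually.of_forall fun b => ?_)
  have hslide := hf.slide_notMem k b (hf.realLine_notMem hr h0 hs.ne')
  have htriangle := hf.gauge.triangle hf.gauge.normalized (hr.ne s') (hr.ne s)
    (ne_omega_of_notMem hslide)
  rw [hr.dist] at htriangle
  exact pow_le_pow_left₀ (hf.gauge.nonneg _ _) htriangle 4

lemma tendsto_slide (hf : IsFrame q ω e n m) (hP : IsProper q ω) (hr : IsRealLine q ω r)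
    (h0 : r 0 = e 0) {s : ℝ} (hs : 0 < s) (hl : 0 < l) (hl1 : l ≠ 1) :
    Tendsto (fun b => q (slide n m l b (r s)) (r (l * s))) (𝓝[≠] 0) (𝓝 0) := by
  obtain ⟨δ, hδ, -, hlim⟩ := hf.exists_defect hr h0 hs (mul_pos hl hs)
  have hδ0 : δ = 0 := by
    -- For these values of `k` the point `r s` lies between `r (l s)` and `r (k s)`.
    rcases lt_or_gt_of_ne hl1 with h | h
    · have hle := hf.defect_le hP hr h0 hs two_ne_zero (hlim 2 two_ne_zero)
      rw [abs_of_nonpos (by nlinarith), abs_of_nonpos (by linarith),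
        show -(l * s - s) + -(s - 2 * s) = -(l * s - 2 * s) by ring,
        Even.neg_pow (by decide : Even 4)] at hle
      linarith
    · have hle := hf.defect_le hP hr h0 hs one_half_pos.ne' (hlim (1 / 2) one_half_pos.ne')
      rw [abs_of_nonneg (by nlinarith), abs_of_nonneg (by linarith), sub_add_sub_cancel] at hle
      linarith
  have hpow : Tendsto (fun b => q (slide n m l b (r s)) (r (l * s)) ^ 4) (𝓝[≠] 0)
      (𝓝 ((0 : ℝ) ^ 4)) := by
    have h := hlim l hl.ne'
    simp only [hf.gauge.symm (r _)] at h
    convert h using 2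
    rw [hδ0]
    ring
  simpa using tendsto_of_pow_four (fun _ => hf.gauge.nonneg _ _) hpow

lemma tendsto_dilation (hf : IsFrame q ω e n m) (hP : IsProper q ω) (hr : IsRealLine q ω r)
    (h0 : r 0 = e 0) {s : ℝ} (hs : 0 < s) (hl : 0 < l) (hl1 : l ≠ 1) :
    Tendsto (fun b => q (dilation n m l b (r s)) (r (l * s))) (𝓝[≠] 0) (𝓝 0) := by
  have hq := hf.gauge
  have hx := hf.realLine_notMem hr h0 hs.ne'
  have hdilation_slide : Tendsto (fun b => l * (√|0 - b * l| *
      (q (r s) (e 0) * q (m (b * l) (r s)) (e 0)))) (𝓝 0) (𝓝 0) := by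
    have hparam : Tendsto (fun b : ℝ => b * l) (𝓝 0) (𝓝 0) := by
      simpa using (continuous_mul_const l).tendsto 0
    have hsqrt : Tendsto (fun b : ℝ => √|0 - b * l|) (𝓝 0) (𝓝 0) := by
      have : Continuous fun b : ℝ => √|0 - b * l| := by fun_prop
      simpa using this.tendsto 0
    have hcenter := ((hf.tendsto_dist_m_center hx).comp hparam).const_mul (q (r s) (e 0))
    simpa using (hsqrt.mul hcenter).const_mul l
  have hsum := (hdilation_slide.mono_left (nhdsWithin_le_nhds (s := {0}ᶜ))).add
    (hf.tendsto_slide hP hr h0 hs hl hl1)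
  rw [add_zero] at hsum
  refine squeeze_zero' (Eventually.of_forall fun _ => hq.nonneg _ _) ?_ hsum
  filter_upwards [self_mem_nhdsWithin] with b hb
  have hm := ne_omega_of_notMem (hf.m_notMem (b * l) hx)
  have hdist := hf.dist_m hx 0 (b * l)
  rw [hf.shift_m.zero] at hdist
  rw [← hdist, ← hf.dist_dilation hl hb (hr.ne s) hm, ← hf.slide_eq_dilation]
  exact hq.triangle hq.normalized (hf.dilation_ne hl.ne' hb (hr.ne s))
    (ne_omega_of_notMem (hf.slide_notMem l b hx)) (hr.ne _)

end IsFrame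

lemma isDilation_one : IsDilation q ω e 1 id where
  map_omega := rfl
  ne _ h := h
  dist _ _ _ _ := (one_mul _).symm
  complexLine t := by rw [one_pow, one_mul, id]
  realLine r _ _ s := by rw [one_mul, id]

theorem IsAffineGauge.exists_isDilation (hq : IsAffineGauge q ω) (hP : IsProper q ω)
    (he : IsComplexLine q ω e) (hl : 0 < l) : ∃ h, IsDilation q ω e l h := by
  rcases eq_or_ne l 1 with rfl | hl1
  · exact ⟨id, isDilation_one⟩
  obtain ⟨n, m, hf⟩ := hq.exists_isFrame he
  have hU : (Ultrafilter.of (𝓝[≠] (0 : ℝ)) : Filter ℝ) ≤ 𝓝[≠] 0 := Ultrafilter.of_le _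
  have hne : ∀ᶠ b : ℝ in 𝓝[≠] 0, b ≠ 0 := self_mem_nhdsWithin
  have hfix (t : ℝ) : ∀ᶠ b in 𝓝[≠] 0, dilation n m l b (e t) = e (l ^ 2 * t) :=
    hne.mono fun b hb => hf.dilation_apply hl.ne' hb t
  obtain ⟨h, hh, hlim⟩ := hq.exists_limit_homothety hP (f := dilation n m l) (he.ne 0)
    (hU (hne.mono fun b hb => hf.isHomothety_dilation hl hb))
    (hU ((hfix 0).mono fun b hb => by rwa [mul_zero] at hb))
  have hcomplex (t : ℝ) : h (e t) = e (l ^ 2 * t) := by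
    refine hlim _ _ (he.ne t) (he.ne _) (tendsto_const_nhds.congr' (hU ?_))
    filter_upwards [hfix t] with b hb
    rw [hb, hq.self]
  have hreal {r : ℝ → X} (hr : IsRealLine q ω r) (h0 : r 0 = e 0) {s : ℝ} (hs : 0 < s) :
      h (r s) = r (l * s) :=
    hlim _ _ (hr.ne s) (hr.ne _) ((hf.tendsto_dilation hP hr h0 hs hl hl1).mono_left hU)
  refine ⟨h, hh, hcomplex, fun r hr h0 s => ?_⟩
  rcases lt_trichotomy s 0 with hs | rfl | hs
  · simpa using hreal hr.neg (by rwa [neg_zero]) (neg_pos.2 hs)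
  · simpa [h0] using hcomplex 0
  · exact hreal hr h0 hs

end Dilation

/-! ### Coordinates and dilations -/

section Coordinates

variable {X : Type*} {q : X → X → ℝ} {ω : X} {T : ℝ → X → X} {e : ℝ → X} {l : ℝ} {h : X → X}

lemma IsAffineGauge.complexLine_eq_shift (hq : IsAffineGauge q ω) (hT : IsShiftGroup q ω T)
    (he : IsComplexLine q ω e) : (∀ a, e a = T a (e 0)) ∨ ∀ a, e a = T (-a) (e 0) := by
  have hc := hT.complexLine (e 0) (he.ne 0)
  have h0 : e 0 = T 0 (e 0) := (hT.zero _).symm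
  exact hc.eq_or_eq_neg .sqrt hq.toIsGauge he h0 (hq.range_complexLine_eq he hc h0).subset

lemma IsAffineGauge.exists_complexCircle_iff (hq : IsAffineGauge q ω) (hT : IsShiftGroup q ω T)
    {x p : X} (hx : x ≠ ω) (hp : p ≠ ω) :
    (∃ G, IsComplexCircle q G ∧ ω ∈ G ∧ x ∈ G ∧ p ∈ G) ↔ ∃ a, x = T a p := by
  constructor
  · rintro ⟨G, hG, hω, hxG, hpG⟩
    obtain ⟨e, he, rfl, hr⟩ := hG.exists_line .sqrt hq.toIsGauge hq.normalized hω hpG hp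
    obtain ⟨a, rfl⟩ : x ∈ Set.range e := hr ▸ ⟨hxG, hx⟩
    rcases hq.complexLine_eq_shift hT he with h | h
    · exact ⟨a, h a⟩
    · exact ⟨-a, h a⟩
  · rintro ⟨a, rfl⟩
    exact ⟨_, hq.isCircle (hT.complexLine p hp), Or.inl rfl, Or.inr ⟨a, rfl⟩,
      Or.inr ⟨0, hT.zero p⟩⟩

lemma IsShiftGroup.realLine (hT : IsShiftGroup q ω T) (hq : IsAffineGauge q ω) {r : ℝ → X}
    (hr : IsRealLine q ω r) (a : ℝ) : IsRealLine q ω fun s => T a (r s) :=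
  ⟨fun s => hT.ne (hr.ne s) a, fun s t => by rw [hT.isometry hq, hr.dist]⟩

lemma IsAffineGauge.exists_coordinates (hq : IsAffineGauge q ω) (he : IsComplexLine q ω e)
    (hT : IsShiftGroup q ω T) (hTe : ∀ a t, T a (e t) = e (t + a)) {x : X} (hx : x ≠ ω)
    (hxe : x ∉ Set.range e) : ∃ r a s, IsRealLine q ω r ∧ r 0 = e 0 ∧ x = T a (r s) := by
  obtain ⟨r, t, s, hr, h0, hs⟩ := hq.exists_realLine_foot he hx hxe
  refine ⟨fun s => T (-t) (r s), t, s, hT.realLine hq hr _, ?_, ?_⟩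
  · simp only [h0, hTe, add_neg_cancel]
  · simp only [hT.apply_neg, hs]

/-- The union of the `ℂ`-lines that meet the curve `r`. -/
def semiplane (T : ℝ → X → X) (r : ℝ → X) : Set X := {x | ∃ s a, x = T a (r s)}

lemma IsShiftGroup.semiplane_shift (hT : IsShiftGroup q ω T) (b : ℝ) (r : ℝ → X) :
    semiplane T (fun s => T b (r s)) = semiplane T r := by
  ext x
  constructor
  · rintro ⟨s, a, rfl⟩
    exact ⟨s, a + b, (hT.add _ _ _).symm⟩
  · rintro ⟨s, a, rfl⟩
    exact ⟨s, a - b, by rw [← hT.add, sub_add_cancel]⟩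

lemma IsAffineGauge.eq_shift_of_coordinates (hq : IsAffineGauge q ω) (he : IsComplexLine q ω e)
    (hT : IsShiftGroup q ω T) (hTe : ∀ a t, T a (e t) = e (t + a)) {r : ℝ → X}
    (hr : IsRealLine q ω r) (h0 : r 0 = e 0) {s : ℝ} (hs : s ≠ 0) {z : X} {p : ℝ} (hz : z ≠ ω)
    (hG : ∃ G, IsComplexCircle q G ∧ ω ∈ G ∧ z ∈ G ∧ r s ∈ G)
    (hσ : ∃ σ, IsRealCircle q σ ∧ ω ∈ σ ∧ z ∈ σ ∧ e p ∈ σ) : z = T p (r s) := by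
  obtain ⟨a, rfl⟩ := (hq.exists_complexCircle_iff hT hz (hr.ne s)).1 hG
  obtain ⟨σ, hσ, hω, hzσ, hpσ⟩ := hσ
  obtain ⟨c, hc, hc0, hcσ⟩ := hσ.exists_line .id hq.toIsGauge hq.normalized hω hpσ (he.ne p)
  obtain ⟨s', hs'⟩ : T a (r s) ∈ Set.range c := hcσ ▸ ⟨hzσ, hz⟩
  have hrs_notMem : r s ∉ insert ω (Set.range e) := by
    rintro (h | ⟨t, h⟩)
    · exact hr.ne s h
    · exact hs (hq.eq_zero_of_meet hr he h0 h.symm).1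
  have hc'0 : T (-a) (c 0) = e (p - a) := by rw [hc0, hTe, sub_eq_add_neg]
  have hc's' : T (-a) (c s') = r s := by rw [hs', hT.neg_apply]
  have hcircle := (hq.existsUnique_realCircle _ (hq.isCircle he) ω (Or.inl rfl) _ hrs_notMem).unique
    ⟨hq.isCircle (hT.realLine hq hc (-a)), Or.inl rfl, Or.inr ⟨s', hc's'⟩, _, Or.inr ⟨0, hc'0⟩,
      Or.inr ⟨_, rfl⟩, he.ne _⟩
    ⟨hq.isCircle hr, Or.inl rfl, Or.inr ⟨s, rfl⟩, _, Or.inr ⟨0, h0⟩, Or.inr ⟨_, rfl⟩, he.ne _⟩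
  have hmem : e (p - a) ∈ insert ω (Set.range r) := hcircle ▸ Or.inr ⟨0, hc'0⟩
  obtain ⟨t, ht⟩ := hmem.resolve_left (he.ne _)
  rw [sub_eq_zero.1 (hq.eq_zero_of_meet hr he h0 ht).2]

lemma IsHomothety.complexLine_apply (hh : IsHomothety q ω l h) (hl : 0 < l)
    (he : IsComplexLine q ω e) : IsComplexLine q ω fun a => h (e (a / l ^ 2)) := by
  refine ⟨fun a => hh.ne _ (he.ne _), fun s t => ?_⟩
  rw [hh.dist _ _ (he.ne _) (he.ne _), he.dist, ← sub_div, abs_div,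
    Real.sqrt_div (abs_nonneg _), abs_of_pos (by positivity : 0 < l ^ 2), Real.sqrt_sq hl.le]
  field_simp

lemma IsHomothety.apply_shift (hh : IsHomothety q ω l h) (hq : IsAffineGauge q ω)
    (hT : IsShiftGroup q ω T) (hl : 0 < l) {x : X} (hx : x ≠ ω) :
    (∀ a, h (T a x) = T (l ^ 2 * a) (h x)) ∨ ∀ a, h (T a x) = T (-(l ^ 2 * a)) (h x) := by
  have hscale (a : ℝ) : l ^ 2 * a / l ^ 2 = a := mul_div_cancel_left₀ a (by positivity)
  refine (hq.complexLine_eq_shift hT (hh.complexLine_apply hl (hT.complexLine x hx))).imp ?_ ?_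
  all_goals
    intro H a
    have := H (l ^ 2 * a)
    beta_reduce at this
    rwa [hscale, zero_div, hT.zero] at this

lemma IsHomothety.exists_apply_shift (hh : IsHomothety q ω l h) (hq : IsAffineGauge q ω)
    (hT : IsShiftGroup q ω T) (hl : 0 < l) {x : X} (hx : x ≠ ω) (a : ℝ) :
    ∃ b, h (T a x) = T b (h x) := by
  rcases hh.apply_shift hq hT hl hx with H | H <;> exact ⟨_, H a⟩

lemma IsHomothety.exists_shift_apply (hh : IsHomothety q ω l h) (hq : IsAffineGauge q ω)
    (hT : IsShiftGroup q ω T) (hl : 0 < l) {x : X} (hx : x ≠ ω) (a : ℝ) :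
    ∃ b, T a (h x) = h (T b x) := by
  have hl2 : l ^ 2 ≠ 0 := by positivity
  rcases hh.apply_shift hq hT hl hx with H | H
  · exact ⟨a / l ^ 2, by rw [H, mul_div_cancel₀ _ hl2]⟩
  · exact ⟨-a / l ^ 2, by rw [H, mul_div_cancel₀ _ hl2, neg_neg]⟩

open Classical in
lemma IsHomothety.isConformalMap (hh : IsHomothety q ω l h) (hq : IsAffineGauge q ω)
    (hl : 0 < l) : IsConformalMap q q h := by
  have hsqrt := Real.sqrt_pos.2 hl
  refine ⟨fun x => if x = ω then (√l)⁻¹ else √l, fun x => ?_, fun x y => ?_⟩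
  · beta_reduce
    split_ifs
    · exact inv_pos.2 hsqrt
    · exact hsqrt
  · by_cases hx : x = ω <;> by_cases hy : y = ω
    · rw [hx, hy, hq.self, hq.self, mul_zero]
    · rw [hx, hh.map_omega, hq.symm, hq.normalized _ (hh.ne _ hy), hq.symm, hq.normalized _ hy]
      simp [hy, hsqrt.ne']
    · rw [hy, hh.map_omega, hq.normalized _ (hh.ne _ hx), hq.normalized _ hx]
      simp [hx, hsqrt.ne']
    · simp only [hx, hy, if_false]
      rw [hh.dist _ _ hx hy, Real.mul_self_sqrt hl.le]

lemma IsDilation.surjective (hh : IsDilation q ω e l h) (hq : IsAffineGauge q ω)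
    (he : IsComplexLine q ω e) (hl : 0 < l) : Function.Surjective h := by
  obtain ⟨T, hT, hTe⟩ := hq.exists_isShiftGroup he
  intro z
  by_cases hz : z = ω
  · exact ⟨ω, hh.map_omega.trans hz.symm⟩
  by_cases hze : z ∈ Set.range e
  · obtain ⟨t, rfl⟩ := hze
    exact ⟨e (t / l ^ 2), by rw [hh.complexLine, mul_div_cancel₀ _ (by positivity)]⟩
  · obtain ⟨r, a, s, hr, h0, rfl⟩ := hq.exists_coordinates he hT hTe hz hze
    obtain ⟨b, hb⟩ := hh.exists_shift_apply hq hT hl (hr.ne (s / l)) a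
    rw [hh.realLine r hr h0, mul_div_cancel₀ _ hl.ne'] at hb
    exact ⟨_, hb.symm⟩

lemma IsDilation.image_semiplane (hh : IsDilation q ω e l h) (hq : IsAffineGauge q ω)
    (hT : IsShiftGroup q ω T) (hl : 0 < l) {r : ℝ → X} (hr : IsRealLine q ω r) (h0 : r 0 = e 0) :
    h '' semiplane T r = semiplane T r := by
  apply Set.Subset.antisymm
  · rintro _ ⟨_, ⟨s, a, rfl⟩, rfl⟩
    obtain ⟨b, hb⟩ := hh.exists_apply_shift hq hT hl (hr.ne s) a
    exact ⟨l * s, b, by rw [hb, hh.realLine r hr h0]⟩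
  · rintro _ ⟨s, a, rfl⟩
    obtain ⟨b, hb⟩ := hh.exists_shift_apply hq hT hl (hr.ne (s / l)) a
    rw [hh.realLine r hr h0, mul_div_cancel₀ _ hl.ne'] at hb
    exact ⟨_, ⟨s / l, b, rfl⟩, hb.symm⟩

lemma IsDilation.image_semiplane_of_meet (hh : IsDilation q ω e l h) (hq : IsAffineGauge q ω)
    (hT : IsShiftGroup q ω T) (hTe : ∀ a t, T a (e t) = e (t + a)) (hl : 0 < l)
    {r : ℝ → X} (hr : IsRealLine q ω r) {t : ℝ} (h0 : r 0 = e t) :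
    h '' semiplane T r = semiplane T r := by
  rw [← hT.semiplane_shift (-t)]
  exact hh.image_semiplane hq hT hl (hT.realLine hq hr _) (by rw [h0, hTe, add_neg_cancel])

end Coordinates

/-! ### Möbius maps are the conformal maps of the factors -/

section Separation

variable {Y : Type*} {R : Y → Y → ℝ} {a b c : Y}

lemma mul_div_eq_of_cross_ratio (hs : ∀ x y, R x y = R y x) (hp : ∀ x y, x ≠ y → 0 < R x y)
    (hcr : ∀ x y z u, x ≠ y → z ≠ u → x ≠ z → y ≠ u → R x y * R z u = R x z * R y u)
    (hba : b ≠ a) (hca : c ≠ a) (hbc : b ≠ c) {x y : Y} (hx : x ≠ a) (hy : y ≠ a) (hxy : x ≠ y) :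
    R x a * R y a / R x y = R b a * R c a / R b c := by
  have hsymm (x y : Y) : R x a * R y a / R x y = R y a * R x a / R y x := by
    rw [hs x y, mul_comm (R x a)]
  have hstep {x y z : Y} (hy : y ≠ a) (hz : z ≠ a) (hxy : x ≠ y) (hxz : x ≠ z) :
      R x a * R y a / R x y = R x a * R z a / R x z := by
    rw [div_eq_div_iff (hp _ _ hxy).ne' (hp _ _ hxz).ne']
    linear_combination R x a * hcr x z y a hxz hy hxy hz
  rw [hsymm b c]
  by_cases hxc : x = c
  · subst hxc
    exact hstep hy hba hxy hbc.symm
  · rw [hstep hy hca hxy hxc, hsymm x c]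
    exact hstep hx hba (Ne.symm hxc) hbc.symm

open Classical in
lemma exists_mul_eq_of_cross_ratio (hs : ∀ x y, R x y = R y x) (hp : ∀ x y, x ≠ y → 0 < R x y)
    (hcr : ∀ x y z u, x ≠ y → z ≠ u → x ≠ z → y ≠ u → R x y * R z u = R x z * R y u)
    (hba : b ≠ a) (hca : c ≠ a) (hbc : b ≠ c) :
    ∃ φ : Y → ℝ, (∀ x, 0 < φ x) ∧ ∀ x y, x ≠ y → R x y = φ x * φ y := by
  obtain ⟨C, hC⟩ : ∃ C, R b a * R c a / R b c = C := ⟨_, rfl⟩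
  have hCp : 0 < C := hC ▸ div_pos (mul_pos (hp _ _ hba) (hp _ _ hca)) (hp _ _ hbc)
  have hsqrt : 0 < √C := Real.sqrt_pos.2 hCp
  have hsqrt_ne := hsqrt.ne'
  refine ⟨fun x => if x = a then √C else R x a / √C, fun x => ?_, fun x y hxy => ?_⟩
  · beta_reduce
    split_ifs with hx
    · exact hsqrt
    · exact div_pos (hp _ _ hx) hsqrt
  · by_cases hx : x = a
    · subst hx
      simp only [if_true, Ne.symm hxy, if_false]
      rw [hs x y, mul_div_cancel₀ _ hsqrt_ne]
    · by_cases hy : y = a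
      · subst hy
        simp only [if_true, hx, if_false]
        rw [div_mul_cancel₀ _ hsqrt_ne]
      · simp only [hx, hy, if_false]
        have h := mul_div_eq_of_cross_ratio hs hp hcr hba hca hbc hx hy hxy
        rw [hC, div_eq_iff (hp _ _ hxy).ne'] at h
        rw [div_mul_div_comm, Real.mul_self_sqrt hCp.le, h, mul_div_cancel_left₀ _ hCp.ne']

end Separation

section Factor

variable {X Y : Type*}

lemma factor_symm (d : ExtMetric X) (x y : X) : d.factor x y = d.factor y x := by
  simp only [ExtMetric.factor, d.symm x y]

lemma factor_self (d : ExtMetric X) (x : X) : d.factor x x = 0 := by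
  simp [ExtMetric.factor, d.dist_self]

lemma factor_pos (d : ExtMetric X) {x y : X} (h : x ≠ y) : 0 < d.factor x y := by
  unfold ExtMetric.factor
  split_ifs with htop
  · exact one_pos
  · exact ENNReal.toReal_pos (mt (d.eq_of_dist_eq_zero x y) h) htop

lemma factor_nonneg (d : ExtMetric X) (x y : X) : 0 ≤ d.factor x y := by
  by_cases h : x = y
  · rw [h, factor_self]
  · exact (factor_pos d h).le

lemma sameProjPoint_crt_iff {d : ExtMetric X} {d' : ExtMetric Y} {x y z u : X} {x' y' z' u' : Y} :
    SameProjPoint (d.crt x y z u) (d'.crt x' y' z' u') ↔ ∃ k : ℝ, k ≠ 0 ∧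
      d.factor x y * d.factor z u = k * (d'.factor x' y' * d'.factor z' u') ∧
      d.factor x z * d.factor y u = k * (d'.factor x' z' * d'.factor y' u') ∧
      d.factor x u * d.factor y z = k * (d'.factor x' u' * d'.factor y' z') := by
  simp only [SameProjPoint, ExtMetric.crt, funext_iff, Fin.forall_fin_succ, Pi.smul_apply,
    smul_eq_mul, Matrix.cons_val_zero, Matrix.cons_val_succ, IsEmpty.forall_iff, and_true]

lemma admissible_map {f : Y → X} (hf : Function.Injective f) {x y z u : Y}
    (h : Admissible x y z u) : Admissible (f x) (f y) (f z) (f u) := by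
  simpa only [Admissible, hf.eq_iff] using h

lemma admissible_of_ne {x y z u : X} (hxy : x ≠ y) (hzu : z ≠ u) (hxz : x ≠ z) :
    Admissible x y z u :=
  ⟨fun h => hxy h.1, fun h => hxy h.1, fun h => hxz h.1, fun h => hzu h.2⟩

lemma IsConformalMap.sameProjPoint {d : ExtMetric X} {d' : ExtMetric Y} {f : Y → X}
    (hf : IsConformalMap d'.factor d.factor f) (x y z u : Y) :
    SameProjPoint (d.crt (f x) (f y) (f z) (f u)) (d'.crt x y z u) := by
  obtain ⟨φ, hφ, h⟩ := hf
  have hk : φ x * φ y * φ z * φ u ≠ 0 := by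
    have := fun x => (hφ x).ne'
    simp only [ne_eq, mul_eq_zero, this, or_self, not_false_eq_true]
  refine sameProjPoint_crt_iff.2 ⟨_, hk, ?_, ?_, ?_⟩ <;>
    · simp only [h]
      ring

lemma IsConformalMap.isMoebiusMap {M : MoebiusStructure X} {N : MoebiusStructure Y}
    {d : ExtMetric X} (hd : d ∈ M.metrics) {d' : ExtMetric Y} (hd' : d' ∈ N.metrics) {f : Y → X}
    (hf : IsConformalMap d'.factor d.factor f) : IsMoebiusMap N M f := by
  have hinj := hf.injective (factor_self d) fun _ _ => factor_pos d'
  refine ⟨hinj, fun d₁ hd₁ e₁ he₁ x y z u hA => ?_⟩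
  exact ((M.equivalent e₁ he₁ d hd _ _ _ _ (admissible_map hinj hA)).trans
    (hf.sameProjPoint x y z u)).trans (N.equivalent d' hd' d₁ hd₁ x y z u hA)

lemma isConformalMap_of_isMoebiusMap {M : MoebiusStructure X} {N : MoebiusStructure Y}
    {d : ExtMetric X} (hd : d ∈ M.metrics) {d' : ExtMetric Y} (hd' : d' ∈ N.metrics) {f : Y → X}
    (hf : IsMoebiusMap N M f) {a b c : Y} (hba : b ≠ a) (hca : c ≠ a) (hbc : b ≠ c) :
    IsConformalMap d'.factor d.factor f := by
  have hcr (x y z u : Y) (hxy : x ≠ y) (hzu : z ≠ u) (hxz : x ≠ z) (hyu : y ≠ u) :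
      d.factor (f x) (f y) / d'.factor x y * (d.factor (f z) (f u) / d'.factor z u) =
        d.factor (f x) (f z) / d'.factor x z * (d.factor (f y) (f u) / d'.factor y u) := by
    obtain ⟨k, -, h₁, h₂, -⟩ := sameProjPoint_crt_iff.1
      (hf.2 d' hd' d hd x y z u (admissible_of_ne hxy hzu hxz))
    rw [div_mul_div_comm, div_mul_div_comm, h₁, h₂,
      mul_div_cancel_right₀ _ (mul_pos (factor_pos d' hxy) (factor_pos d' hzu)).ne',
      mul_div_cancel_right₀ _ (mul_pos (factor_pos d' hxz) (factor_pos d' hyu)).ne']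
  obtain ⟨φ, hφ, h⟩ := exists_mul_eq_of_cross_ratio
    (R := fun x y => d.factor (f x) (f y) / d'.factor x y)
    (fun x y => by simp only [factor_symm d (f x), factor_symm d' x])
    (fun x y hxy => div_pos (factor_pos d (hf.1.ne hxy)) (factor_pos d' hxy)) hcr hba hca hbc
  refine ⟨φ, hφ, fun x y => ?_⟩
  by_cases hxy : x = y
  · rw [hxy, factor_self, factor_self, mul_zero]
  · rw [← h x y hxy, div_mul_cancel₀ _ (factor_pos d' hxy).ne']

lemma self_mem_moebiusStructure (d : ExtMetric X) : d ∈ d.moebiusStructure.metrics :=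
  fun _ _ _ _ _ => SameProjPoint.refl _

lemma isMoebiusMap_id {M : MoebiusStructure X} : IsMoebiusMap M M id :=
  ⟨Function.injective_id, fun d hd e he x y z u hA => M.equivalent e he d hd x y z u hA⟩

lemma isMoebiusAutomorphism_of_isConformalMap {M : MoebiusStructure X} {d : ExtMetric X}
    (hd : d ∈ M.metrics) {h : X → X} (hh : IsConformalMap d.factor d.factor h)
    (hs : Function.Surjective h) : IsMoebiusAutomorphism M h :=
  ⟨⟨(hh.isMoebiusMap hd hd).1, hs⟩, hh.isMoebiusMap hd hd⟩

lemma factor_extRealLine : extRealLine.factor = model fun x => x := by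
  funext x y
  cases x <;> cases y <;>
    simp [ExtMetric.factor, extRealLine, ExtMetric.ofMetric, extendedDist, model]

lemma factor_sqrtExtRealLine : sqrtExtRealLine.factor = model Real.sqrt := by
  funext x y
  cases x <;> cases y <;>
    simp [ExtMetric.factor, sqrtExtRealLine, ExtMetric.ofMetric, extendedDist, model]

end Factor

/-! ### The factors of a space with the incidence axioms -/

section Incidence

variable {X : Type*} {M : MoebiusStructure X} {d : ExtMetric X} {ω : X}

lemma exists_isMoebiusMap_range_iff (hd : d ∈ M.metrics) {p : ℝ → ℝ} {d' : ExtMetric (OnePoint ℝ)}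
    (hp : d'.factor = model p) {σ : Set X} :
    (∃ f : OnePoint ℝ → X, IsMoebiusMap d'.moebiusStructure M f ∧ Set.range f = σ) ↔
      IsCircle p d.factor σ := by
  have hd' := self_mem_moebiusStructure d'
  refine exists_congr fun f => and_congr_left fun _ => ?_
  rw [← hp]
  exact ⟨fun hf => isConformalMap_of_isMoebiusMap hd hd' hf (a := OnePoint.infty)
    (b := ((0 : ℝ) : OnePoint ℝ)) (c := ((1 : ℝ) : OnePoint ℝ)) (by simp) (by simp) (by simp),
    fun hf => hf.isMoebiusMap hd hd'⟩

lemma isRCircle_iff (hd : d ∈ M.metrics) {σ : Set X} :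
    M.IsRCircle σ ↔ IsRealCircle d.factor σ :=
  exists_isMoebiusMap_range_iff hd factor_extRealLine

lemma isCCircle_iff (hd : d ∈ M.metrics) {F : Set X} :
    M.IsCCircle F ↔ IsComplexCircle d.factor F :=
  exists_isMoebiusMap_range_iff hd factor_sqrtExtRealLine

lemma harmonic_iff (hd : d ∈ M.metrics) {x z y u : X} : M.Harmonic x z y u ↔
    Admissible x z y u ∧ d.factor x z * d.factor y u = d.factor x u * d.factor z y := by
  refine and_congr_right fun hA => ⟨fun h => ?_, fun h d' hd' => ?_⟩
  · rw [h d hd, factor_symm d z y]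
  · obtain ⟨k, -, h₁, -, h₃⟩ := sameProjPoint_crt_iff.1 (M.equivalent d' hd' d hd x z y u hA)
    rw [h₁, factor_symm d' y z, h₃, h]

lemma normalizedAt_factor (hdω : d.Remote ω) : NormalizedAt d.factor ω := fun x hx => by
  simp only [ExtMetric.factor, hdω x hx, if_true]

lemma isGauge_factor (hd : d ∈ M.metrics) (h_ptolemy : M.Ptolemy) : IsGauge d.factor where
  symm := factor_symm d
  self := factor_self d
  pos _ _ := factor_pos d
  ptolemy x y z u := by
    by_cases hA : Admissible x y z u
    · exact h_ptolemy d hd x y z u hA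
    have hzero : d.factor x z * d.factor y u = 0 := by
      have : (x = y ∧ y = z) ∨ (x = y ∧ y = u) ∨ (x = z ∧ z = u) ∨ (y = z ∧ z = u) := by
        unfold Admissible at hA
        tauto
      rcases this with ⟨rfl, rfl⟩ | ⟨-, rfl⟩ | ⟨rfl, -⟩ | ⟨rfl, rfl⟩ <;> simp [factor_self]
    rw [hzero]
    exact add_nonneg (mul_nonneg (factor_nonneg d _ _) (factor_nonneg d _ _))
      (mul_nonneg (factor_nonneg d _ _) (factor_nonneg d _ _))

lemma isAffineGauge_factor (hd : d ∈ M.metrics) (hdω : d.Remote ω) (h_ptolemy : M.Ptolemy)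
    (h_EC : M.AxiomEC) (h_ER : M.AxiomER) (h_OC : M.AxiomOC) (h_OR : M.AxiomOR) :
    IsAffineGauge d.factor ω where
  toIsGauge := isGauge_factor hd h_ptolemy
  existsUnique_complexCircle x y hxy := by
    simpa only [isCCircle_iff hd] using h_EC x y hxy
  existsUnique_realCircle F hF ω hω u hu := by
    simpa only [isRCircle_iff hd] using h_ER F ((isCCircle_iff hd).2 hF) ω hω u hu
  harmonic_complexCircle σ F hσ hF o ho ω hω hoω u hu v hv h w hw := by
    simp only [Set.mem_sdiff, Set.mem_insert_iff, Set.mem_singleton_iff, not_or] at hu hv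
    exact ((harmonic_iff hd).1 (h_OC σ F ((isRCircle_iff hd).2 hσ) ((isCCircle_iff hd).2 hF) o ω
      hoω ho.1 ho.2 hω.1 hω.2 u hu.1 v hv.1 ((harmonic_iff hd).2
      ⟨admissible_of_ne (Ne.symm hu.2.1) (Ne.symm hv.2.2) hoω, h⟩) w hw)).2
  harmonic_realCircle σ F hσ hF o ho ω hω hoω x hx y hy h w hw := by
    simp only [Set.mem_sdiff, Set.mem_insert_iff, Set.mem_singleton_iff, not_or] at hx hy
    exact ((harmonic_iff hd).1 (h_OR σ F ((isRCircle_iff hd).2 hσ) ((isCCircle_iff hd).2 hF) o ω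
      hoω ho.1 ho.2 hω.1 hω.2 x hx.1 y hy.1 ((harmonic_iff hd).2
      ⟨admissible_of_ne (Ne.symm hx.2.1) (Ne.symm hy.2.2) hoω, h⟩) w hw)).2
  normalized := normalizedAt_factor hdω

end Incidence

section Compactness

variable {X : Type*} {M : MoebiusStructure X} {d : ExtMetric X} {ω : X}

lemma isProper_of_isConformalMap_dist [MetricSpace X] [CompactSpace X] {q : X → X → ℝ}
    (hn : NormalizedAt q ω) (hq : IsConformalMap dist q id) : IsProper q ω := by
  obtain ⟨φ, hφ, h⟩ := hq
  simp only [id_eq] at h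
  have hdist_pos {x : X} (hx : x ≠ ω) : 0 < φ ω * dist x ω := mul_pos (hφ ω) (dist_pos.2 hx)
  have hq_eq {x : X} (hx : x ≠ ω) (y : X) : q x y = φ y * dist x y / (φ ω * dist x ω) := by
    have hnorm := hn x hx
    rw [h] at hnorm
    rw [h, eq_div_iff (hdist_pos hx).ne']
    linear_combination (φ y * dist x y) * hnorm
  intro U y R hy hU
  have : Nonempty X := ⟨ω⟩
  obtain ⟨z, hz⟩ : ∃ z, Tendsto (fun x : X => x) U (𝓝 z) := ⟨_, U.le_nhds_lim⟩
  have hlim (p : X) : Tendsto (fun x => φ p * dist x p) U (𝓝 (φ p * dist z p)) :=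
    (hz.dist tendsto_const_nhds).const_mul _
  have hzω : z ≠ ω := by
    rintro rfl
    have hle : φ y * dist z y ≤ R * (φ z * dist z z) := by
      refine le_of_tendsto_of_tendsto (hlim y) ((hlim z).const_mul R) ?_
      filter_upwards [hU] with x hx
      rw [← div_le_iff₀ (hdist_pos hx.1), ← hq_eq hx.1]
      exact hx.2
    rw [dist_self, mul_zero, mul_zero] at hle
    exact hle.not_gt (mul_pos (hφ y) (dist_pos.2 hy.symm))
  refine ⟨z, hzω, ?_⟩
  have hquot := (hlim z).div (hlim ω) (hdist_pos hzω).ne'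
  rw [dist_self, mul_zero, zero_div] at hquot
  refine hquot.congr' ?_
  filter_upwards [hU] with x hx using (hq_eq hx.1 z).symm

lemma isProper_factor (hd : d ∈ M.metrics) (hdω : d.Remote ω) (hM : M.Compact) {a b c : X}
    (hba : b ≠ a) (hca : c ≠ a) (hbc : b ≠ c) : IsProper d.factor ω := by
  obtain ⟨d₀, hd₀, hfin, hcpt⟩ := hM
  let _ := d₀.toMetricSpace hfin
  have hdist : d₀.factor = dist := by
    funext x y
    rw [ExtMetric.factor, if_neg (hfin x y)]
    rfl
  refine isProper_of_isConformalMap_dist (normalizedAt_factor hdω) ?_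
  rw [← hdist]
  exact isConformalMap_of_isMoebiusMap hd hd₀ isMoebiusMap_id hba hca hbc

end Compactness

/-! ### Pure homotheties of Möbius spaces -/

section PureHomothety

variable {X : Type*} {M : MoebiusStructure X} {d : ExtMetric X} {ω : X}

lemma dist_ne_top (hdω : d.Remote ω) {x y : X} (hx : x ≠ ω) (hy : y ≠ ω) : d.dist x y ≠ ⊤ :=
  fun h => (d.remote_of_top x y h).elim (fun h => hx (d.remote_unique _ _ h hdω))
    fun h => hy (d.remote_unique _ _ h hdω)

lemma dist_eq_ofReal_factor (hdω : d.Remote ω) {x y : X} (hx : x ≠ ω) (hy : y ≠ ω) :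
    d.dist x y = ENNReal.ofReal (d.factor x y) := by
  have h := dist_ne_top hdω hx hy
  rw [ExtMetric.factor, if_neg h, ENNReal.ofReal_toReal h]

lemma isLine_of_dist (hdω : d.Remote ω) {p : ℝ → ℝ} {c : ℝ → X} {σ : Set X}
    (hp : ∀ x, 0 ≤ p |x|) (hr : Set.range c = σ \ {ω})
    (hc : ∀ s t, d.dist (c s) (c t) = ENNReal.ofReal (p |s - t|)) : IsLine p d.factor ω c := by
  have hne (s : ℝ) : c s ≠ ω := (hr ▸ Set.mem_range_self s : c s ∈ σ \ {ω}).2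
  refine ⟨hne, fun s t => ?_⟩
  have h := dist_eq_ofReal_factor hdω (hne s) (hne t)
  rw [hc, ENNReal.ofReal_eq_ofReal_iff (hp _) (factor_nonneg d _ _)] at h
  exact h.symm

lemma dist_of_isLine (hdω : d.Remote ω) {p : ℝ → ℝ} {c : ℝ → X} (hc : IsLine p d.factor ω c)
    (s t : ℝ) : d.dist (c s) (c t) = ENNReal.ofReal (p |s - t|) := by
  rw [dist_eq_ofReal_factor hdω (hc.ne s) (hc.ne t), hc.dist]

variable {e : ℝ → X} {l : ℝ} {h : X → X} {T : ℝ → X → X}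

lemma range_of_isCLine (hd : d ∈ M.metrics) (hq : IsAffineGauge d.factor ω)
    (he : IsComplexLine d.factor ω e) {F : Set X} (hF : M.IsCLine ω (e 0) F) :
    F = insert ω (Set.range e) :=
  (hq.existsUnique_complexCircle (e 0) ω hF.2.2.2).unique
    ⟨(isCCircle_iff hd).1 hF.1, hF.2.2.1, hF.2.1⟩
    ⟨hq.isCircle he, Or.inr ⟨0, rfl⟩, Or.inl rfl⟩

lemma exists_realLine_of_isRLine (hd : d ∈ M.metrics) (hq : IsAffineGauge d.factor ω) {o : X}
    {σ : Set X} (hσ : M.IsRLine ω o σ) :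
    ∃ r, IsRealLine d.factor ω r ∧ r 0 = o ∧ Set.range r = σ \ {ω} :=
  ((isRCircle_iff hd).1 hσ.1).exists_line .id hq.toIsGauge hq.normalized hσ.2.1 hσ.2.2.1 hσ.2.2.2

lemma isCLine_insert_range (hd : d ∈ M.metrics) (hq : IsAffineGauge d.factor ω)
    (he : IsComplexLine d.factor ω e) (t : ℝ) : M.IsCLine ω (e t) (insert ω (Set.range e)) :=
  ⟨(isCCircle_iff hd).2 (hq.isCircle he), Or.inl rfl, Or.inr ⟨t, rfl⟩, he.ne t⟩

lemma isRLine_insert_range (hd : d ∈ M.metrics) (hq : IsAffineGauge d.factor ω) {r : ℝ → X}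
    (hr : IsRealLine d.factor ω r) (s : ℝ) : M.IsRLine ω (r s) (insert ω (Set.range r)) :=
  ⟨(isRCircle_iff hd).2 (hq.isCircle hr), Or.inl rfl, Or.inr ⟨s, rfl⟩, hr.ne s⟩

lemma exists_isCLine_iff (hd : d ∈ M.metrics) (hq : IsAffineGauge d.factor ω)
    (hT : IsShiftGroup d.factor ω T) {x p : X} (hx : x ≠ ω) (hp : p ≠ ω) :
    (∃ G, M.IsCLine ω x G ∧ p ∈ G) ↔ ∃ a, x = T a p := by
  rw [← hq.exists_complexCircle_iff hT hx hp]
  simp only [MoebiusStructure.IsCLine, isCCircle_iff hd, hx, ne_eq, not_false_eq_true, and_true,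
    and_assoc]

lemma semiCPlane_eq (hd : d ∈ M.metrics) (hq : IsAffineGauge d.factor ω)
    (hT : IsShiftGroup d.factor ω T) {σ : Set X} {r : ℝ → X} (hr : Set.range r = σ \ {ω}) :
    M.semiCPlane ω σ = semiplane T r := by
  have hrσ (s : ℝ) : r s ∈ σ \ {ω} := hr ▸ Set.mem_range_self s
  ext x
  constructor
  · rintro ⟨p, hp, hpω, G, hG, hpG⟩
    obtain ⟨s, rfl⟩ : p ∈ Set.range r := hr ▸ ⟨hp, hpω⟩
    obtain ⟨a, ha⟩ := (exists_isCLine_iff hd hq hT hG.2.2.2 hpω).1 ⟨G, hG, hpG⟩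
    exact ⟨s, a, ha⟩
  · rintro ⟨s, a, rfl⟩
    have hpω : r s ≠ ω := (hrσ s).2
    exact ⟨r s, (hrσ s).1, hpω, (exists_isCLine_iff hd hq hT (hT.ne hpω a) hpω).2 ⟨a, rfl⟩⟩

lemma image_insert_range_of_scales {c : ℝ → X} {k : ℝ} (hk : k ≠ 0) (hω : h ω = ω)
    (hc : ∀ t, h (c t) = c (k * t)) : h '' insert ω (Set.range c) = insert ω (Set.range c) := by
  rw [Set.image_insert_eq, hω, ← Set.range_comp, funext hc (f := h ∘ c)]
  congr 1
  exact (mul_left_surjective₀ hk).range_comp c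

lemma IsDilation.image_isCLine (hh : IsDilation d.factor ω e l h) (hd : d ∈ M.metrics)
    (hq : IsAffineGauge d.factor ω) (he : IsComplexLine d.factor ω e) (hl : l ≠ 0) {F : Set X}
    (hF : M.IsCLine ω (e 0) F) : h '' F = F := by
  rw [range_of_isCLine hd hq he hF]
  exact image_insert_range_of_scales (pow_ne_zero 2 hl) hh.map_omega hh.complexLine

lemma IsDilation.image_isRLine (hh : IsDilation d.factor ω e l h) (hd : d ∈ M.metrics)
    (hq : IsAffineGauge d.factor ω) (hl : l ≠ 0) {σ : Set X} (hσ : M.IsRLine ω (e 0) σ) :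
    h '' σ = σ := by
  obtain ⟨r, hr, h0, hrσ⟩ := exists_realLine_of_isRLine hd hq hσ
  have hσ_eq : σ = insert ω (Set.range r) := by
    rw [hrσ, Set.insert_sdiff_singleton, Set.insert_eq_of_mem hσ.2.1]
  rw [hσ_eq]
  exact image_insert_range_of_scales hl hh.map_omega (hh.realLine r hr h0)

lemma IsDilation.scalesCLine (hh : IsDilation d.factor ω e l h) (hdω : d.Remote ω)
    (hq : IsAffineGauge d.factor ω) (he : IsComplexLine d.factor ω e) (F : Set X) :
    MoebiusStructure.ScalesCLine d ω (e 0) l F h := by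
  intro c hr h0 hdist t
  have hc : IsComplexLine d.factor ω c := isLine_of_dist hdω (fun _ => Real.sqrt_nonneg _) hr hdist
  rcases he.eq_or_eq_neg .sqrt hq.toIsGauge hc h0 (hq.range_complexLine_eq hc he h0).subset
    with hce | hce
  · rw [hce, hce, hh.complexLine]
  · rw [hce, hce, hh.complexLine, mul_neg]

lemma IsDilation.image_semiCPlane (hh : IsDilation d.factor ω e l h) (hd : d ∈ M.metrics)
    (hq : IsAffineGauge d.factor ω) (he : IsComplexLine d.factor ω e) (hl : 0 < l) {σ : Set X}
    (hσ : M.IsRCircle σ) (hω : ω ∈ σ) (ho : e 0 ∈ M.semiCPlane ω σ) :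
    h '' M.semiCPlane ω σ = M.semiCPlane ω σ := by
  obtain ⟨T, hT, hTe⟩ := hq.exists_isShiftGroup he
  obtain ⟨p, hp, hpω, G, hG, hpG⟩ := ho
  rw [range_of_isCLine hd hq he hG] at hpG
  obtain ⟨t, rfl⟩ := hpG.resolve_left hpω
  obtain ⟨r, hr, h0, hrσ⟩ := exists_realLine_of_isRLine hd hq ⟨hσ, hω, hp, hpω⟩
  rw [semiCPlane_eq hd hq hT hrσ]
  exact hh.image_semiplane_of_meet hq hT hTe hl hr h0

lemma isVerticalProj_map (hd : d ∈ M.metrics) (hh : IsConformalMap d.factor d.factor h)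
    (hω : h ω = ω) {F : Set X} (hF : h '' F = F) {x p : X} (hxp : M.IsVerticalProj ω F x p) :
    M.IsVerticalProj ω F (h x) (h p) := by
  have hinj := (hh.isMoebiusMap hd hd).1
  have hmem (y : X) : h y ∈ F ↔ y ∈ F := by
    nth_rewrite 1 [← hF]
    exact hinj.mem_set_image
  rcases hxp with ⟨hxF, rfl⟩ | ⟨hxF, hpF, hpω, τ, hτ, hωτ, hxτ, hpτ⟩
  · exact Or.inl ⟨(hmem _).2 hxF, rfl⟩
  · exact Or.inr ⟨mt (hmem x).1 hxF, (hmem p).2 hpF, fun hp => hpω (hinj (hp.trans hω.symm)),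
      h '' τ, (isRCircle_iff hd).2 (((isRCircle_iff hd).1 hτ).image hh), ⟨ω, hωτ, hω⟩,
      ⟨x, hxτ, rfl⟩, ⟨p, hpτ, rfl⟩⟩

lemma isHorizontalProj_map (hd : d ∈ M.metrics) (hh : IsConformalMap d.factor d.factor h)
    (hω : h ω = ω) {σ : Set X} (hσ : h '' σ = σ) {x p : X} (hxp : M.IsHorizontalProj ω σ x p) :
    M.IsHorizontalProj ω σ (h x) (h p) := by
  have hne {y : X} (hy : y ≠ ω) : h y ≠ ω := fun h' =>
    hy ((hh.isMoebiusMap hd hd).1 (h'.trans hω.symm))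
  obtain ⟨hpσ, hpω, G, ⟨hG, hωG, hxG, hx⟩, hpG⟩ := hxp
  exact ⟨hσ ▸ Set.mem_image_of_mem h hpσ, hne hpω, h '' G,
    ⟨(isCCircle_iff hd).2 (((isCCircle_iff hd).1 hG).image hh), ⟨ω, hωG, hω⟩, ⟨x, hxG, rfl⟩,
      hne hx⟩, ⟨p, hpG, rfl⟩⟩

theorem IsDilation.isPureHomothetyMap (hh : IsDilation d.factor ω e l h) (hd : d ∈ M.metrics)
    (hdω : d.Remote ω) (hq : IsAffineGauge d.factor ω) (he : IsComplexLine d.factor ω e)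
    (hl : 0 < l) : M.IsPureHomothetyMap d ω (e 0) l h where
  map_omega := hh.map_omega
  mapsTo := hh.ne
  map_center := by rw [hh.complexLine, mul_zero]
  image_cline _ hF := hh.image_isCLine hd hq he hl.ne' hF
  scales_cline F _ := hh.scalesCLine hdω hq he F
  image_rline _ hσ := hh.image_isRLine hd hq hl.ne' hσ
  scales_rline _ _ c hr h0 hc t :=
    hh.realLine c (isLine_of_dist hdω (fun _ => abs_nonneg _) hr hc) h0 t
  image_semiCPlane _ _ hF hσ hω hsub :=
    hh.image_semiCPlane hd hq he hl hσ hω (hsub ⟨hF.2.2.1, he.ne 0⟩)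
  coordinatewise _ _ hF hσ _ _ _ _ hxF hxσ :=
    have hconf := hh.isConformalMap hq hl
    ⟨isVerticalProj_map hd hconf hh.map_omega (hh.image_isCLine hd hq he hl.ne' hF) hxF,
      isHorizontalProj_map hd hconf hh.map_omega (hh.image_isRLine hd hq hl.ne' hσ) hxσ⟩

/-! ### Uniqueness -/

lemma shift_realLine_notMem (hq : IsAffineGauge d.factor ω) (he : IsComplexLine d.factor ω e)
    (hT : IsShiftGroup d.factor ω T) (hTe : ∀ a t, T a (e t) = e (t + a)) {r : ℝ → X}
    (hr : IsRealLine d.factor ω r) (h0 : r 0 = e 0) {s : ℝ} (hs : s ≠ 0) (a : ℝ) :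
    T a (r s) ∉ insert ω (Set.range e) := by
  rintro (h | ⟨t, h⟩)
  · exact hT.ne (hr.ne s) a h
  · have hmeet : r s = e (t + -a) := by rw [← hTe, h, hT.neg_apply]
    exact hs (hq.eq_zero_of_meet hr he h0 hmeet).1

lemma apply_complexLine_of_isPureHomothetyMap (hd : d ∈ M.metrics) (hdω : d.Remote ω)
    (hq : IsAffineGauge d.factor ω) (he : IsComplexLine d.factor ω e)
    (hh : M.IsPureHomothetyMap d ω (e 0) l h) (t : ℝ) : h (e t) = e (l ^ 2 * t) :=
  hh.scales_cline _ (isCLine_insert_range hd hq he 0) e he.range_eq_diff rfl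
    (dist_of_isLine hdω he) t

lemma apply_realLine_of_isPureHomothetyMap (hd : d ∈ M.metrics) (hdω : d.Remote ω)
    (hq : IsAffineGauge d.factor ω) {o : X} (hh : M.IsPureHomothetyMap d ω o l h) {r : ℝ → X}
    (hr : IsRealLine d.factor ω r) (h0 : r 0 = o) (s : ℝ) : h (r s) = r (l * s) :=
  hh.scales_rline _ (h0 ▸ isRLine_insert_range hd hq hr 0) r hr.range_eq_diff h0
    (dist_of_isLine hdω hr) s

lemma apply_shift_of_isPureHomothetyMap (hd : d ∈ M.metrics) (hdω : d.Remote ω)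
    (hq : IsAffineGauge d.factor ω) (he : IsComplexLine d.factor ω e)
    (hT : IsShiftGroup d.factor ω T) (hTe : ∀ a t, T a (e t) = e (t + a)) (hl : l ≠ 0)
    (hh : M.IsPureHomothetyMap d ω (e 0) l h) {r : ℝ → X} (hr : IsRealLine d.factor ω r)
    (h0 : r 0 = e 0) {s : ℝ} (hs : s ≠ 0) (t : ℝ) :
    h (T t (r s)) = T (l ^ 2 * t) (r (l * s)) := by
  have hnotMem {s : ℝ} (hs : s ≠ 0) (a : ℝ) := shift_realLine_notMem hq he hT hTe hr h0 hs a
  have hls : l * s ≠ 0 := mul_ne_zero hl hs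
  have hσ : M.IsRLine ω (e 0) (insert ω (Set.range r)) := h0 ▸ isRLine_insert_range hd hq hr 0
  have hvert : M.IsVerticalProj ω (insert ω (Set.range e)) (T t (r s)) (e t) :=
    Or.inr ⟨hnotMem hs t, Or.inr ⟨t, rfl⟩, he.ne t, _,
      (isRCircle_iff hd).2 (hq.isCircle (hT.realLine hq hr t)), Or.inl rfl, Or.inr ⟨s, rfl⟩,
      Or.inr ⟨0, by simp only [h0, hTe, zero_add]⟩⟩
  have hhor : M.IsHorizontalProj ω (insert ω (Set.range r)) (T t (r s)) (r s) :=
    ⟨Or.inr ⟨s, rfl⟩, hr.ne s,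
      (exists_isCLine_iff hd hq hT (hT.ne (hr.ne s) t) (hr.ne s)).2 ⟨t, rfl⟩⟩
  obtain ⟨hv, -, -, G, hG, hpG⟩ := hh.coordinatewise _ _ (isCLine_insert_range hd hq he 0) hσ _
    ⟨_, hhor⟩ _ _ hvert hhor
  rw [apply_realLine_of_isPureHomothetyMap hd hdω hq hh hr h0] at hpG
  rw [apply_complexLine_of_isPureHomothetyMap hd hdω hq he hh] at hv
  obtain ⟨a, ha⟩ := (exists_isCLine_iff hd hq hT hG.2.2.2 (hr.ne _)).1 ⟨G, hG, hpG⟩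
  obtain ⟨-, -, -, τ, hτ, hωτ, hxτ, hpτ⟩ :=
    hv.resolve_left fun hv => hnotMem hls a (ha ▸ hv.1)
  exact hq.eq_shift_of_coordinates he hT hTe hr h0 hls hG.2.2.2
    ⟨G, (isCCircle_iff hd).1 hG.1, hG.2.1, hG.2.2.1, hpG⟩
    ⟨τ, (isRCircle_iff hd).1 hτ, hωτ, hxτ, hpτ⟩

theorem isPureHomothetyMap_unique (hd : d ∈ M.metrics) (hdω : d.Remote ω)
    (hq : IsAffineGauge d.factor ω) (he : IsComplexLine d.factor ω e) (hl : l ≠ 0) {h' : X → X}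
    (hh : M.IsPureHomothetyMap d ω (e 0) l h) (hh' : M.IsPureHomothetyMap d ω (e 0) l h') :
    h = h' := by
  obtain ⟨T, hT, hTe⟩ := hq.exists_isShiftGroup he
  funext x
  by_cases hx : x = ω
  · rw [hx, hh.map_omega, hh'.map_omega]
  by_cases hxe : x ∈ Set.range e
  · obtain ⟨t, rfl⟩ := hxe
    rw [apply_complexLine_of_isPureHomothetyMap hd hdω hq he hh,
      apply_complexLine_of_isPureHomothetyMap hd hdω hq he hh']
  · obtain ⟨r, t, s, hr, h0, rfl⟩ := hq.exists_coordinates he hT hTe hx hxe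
    have hs : s ≠ 0 := by
      rintro rfl
      exact hxe ⟨0 + t, by rw [h0, hTe]⟩
    rw [apply_shift_of_isPureHomothetyMap hd hdω hq he hT hTe hl hh hr h0 hs,
      apply_shift_of_isPureHomothetyMap hd hdω hq he hT hTe hl hh' hr h0 hs]

end PureHomothety

end MoebiusGauge

theorem mainTheorem9 {X : Type*} (M : MoebiusStructure X)
    (h_compact : M.Compact) (h_ptolemy : M.Ptolemy)
    (h_EC : M.AxiomEC) (h_ER : M.AxiomER) (h_OC : M.AxiomOC) (h_OR : M.AxiomOR)
    (ω : X) (d : ExtMetric X) (hd : d ∈ M.metrics) (hdω : d.Remote ω)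
    (o : X) (ho : o ≠ ω) (lam : ℝ) (hlam : 0 < lam) :
    (∃! h : X → X, M.IsPureHomothetyMap d ω o lam h) ∧
    ∀ h : X → X, M.IsPureHomothetyMap d ω o lam h →
      (∀ x y, x ≠ ω → y ≠ ω → d.dist (h x) (h y) = ENNReal.ofReal lam * d.dist x y) ∧
      IsMoebiusAutomorphism M h := by
  have hq := MoebiusGauge.isAffineGauge_factor hd hdω h_ptolemy h_EC h_ER h_OC h_OR
  obtain ⟨e, he, rfl⟩ := hq.exists_complexLine ho
  have hproper := MoebiusGauge.isProper_factor hd hdω h_compact (he.ne 0) (he.ne 1)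
    ((he.injective .sqrt hq.toIsGauge).ne zero_ne_one)
  obtain ⟨g, hg⟩ := hq.exists_isDilation hproper he hlam
  have hg_pure := hg.isPureHomothetyMap hd hdω hq he hlam
  have hunique (h : X → X) (hh : M.IsPureHomothetyMap d ω (e 0) lam h) : h = g :=
    MoebiusGauge.isPureHomothetyMap_unique hd hdω hq he hlam.ne' hh hg_pure
  refine ⟨⟨g, hg_pure, hunique⟩, fun h hh => ?_⟩
  obtain rfl := hunique h hh
  refine ⟨fun x y hx hy => ?_, MoebiusGauge.isMoebiusAutomorphism_of_isConformalMap hd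
    (hg.isConformalMap hq hlam) (hg.surjective hq he hlam)⟩
  rw [MoebiusGauge.dist_eq_ofReal_factor hdω (hg.ne x hx) (hg.ne y hy), hg.dist x y hx hy,
    ENNReal.ofReal_mul hlam.le, ← MoebiusGauge.dist_eq_ofReal_factor hdω hx hy]
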